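/- Let $p$ be a prime number, let $m,n\ge 0$ be integers, let $S$ be a scheme on which $p$ is nilpotent, and let $f\colon X\to S$ be a smooth morphism with local coordinates $t_1,\dots,t_n\in\Gamma(X,\mathcal O_X)$, i.e. the $S$-morphism $X\to\mathbb A^n_S$ that they define is étale. Let $\partial_j^{[k]}$ ($1\le j\le n$, $k\ge 0$) be the operator on $\mathcal O_X$ that sends $a$ to the coefficient of $T^k$ in its Taylor expansion in the direction of $t_j$, i.e. in the image of $a$ under the unique homomorphism of $f^{-1}\mathcal O_S$-algebras $\mathcal O_X\to\mathcal O_X[[T]]$ that lifts the identity and sends $t_i$ to $t_i+\delta_{ij}T$. For $k\in\mathbb N$ put $q_k=\lfloor k/p^m\rfloor$. Let $\mathcal D=\mathcal D^{(m)}_{X/S}$ be the sheaf of differential operators of level $m$. It is the sheaf of rings generated by $\mathcal O_X$ and operators $\partial_j^{\langle k\rangle}$ ($1\le j\le n$, $k\ge0$), with the relations: $\partial_j^{\langle 0\rangle}=1$, the $\partial_j^{\langle k\rangle}$ commute with each other, $$\partial_j^{\langle k\rangle}\partial_j^{\langle l\rangle}=\binom{k+l}{k}\frac{q_k!\,q_l!}{q_{k+l}!}\,\partial_j^{\langle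 k+l\rangle},\qquad \partial_j^{\langle k\rangle}\,a=\sum_{i+l=k}\frac{q_k!}{q_l!}\,\partial_j^{[i]}(a)\,\partial_j^{\langle l\rangle}\quad(a\in\mathcal O_X).$$ It acts on $\mathcal O_X$ by $\partial_j^{\langle k\rangle}(a)=q_k!\,\partial_j^{[k]}(a)$, and $f^{-1}\mathcal O_S$ is central in $\mathcal D$. For a left $\mathcal D$-module $\mathcal F$, let $\mathcal F\otimes_{\mathcal O_X}\hat\Omega^{(m),\bullet}_{X/S}$ be its higher de Rham complex. It is the complex of $f^{-1}\mathcal O_S$-modules with terms $\bigoplus_{j_1<\dots<j_r}\mathcal F\,\tau_{j_1}\wedge\dots\wedge\tau_{j_r}$ in degree $r$ ($\hat\Omega^{(m),\bullet}_{X/S}$ being, as a graded $\mathcal O_X$-module, the exterior algebra of the free module with basis $\tau_1,\dots,\tau_n$) and with differential $$d(x\otimes\omega)=\sum_{j=1}^n\partial_j^{\langle p^m\rangle}(x)\otimes\tau_j\wedge\omega\qquad(x\in\mathcal F,\ \omega=\tau_{j_1}\wedge\dots\wedge\tau_{j_r}).$$ Let $\mathrm{Sp}^\bullet=\mathcal Hom_{\mathcal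 O_X}(\hat\Omega^{(m),\bullet}_{X/S},\mathcal D)$ be the Spencer complex. It is the complex of free left $\mathcal D$-modules $\mathrm{Sp}^{-r}=\bigoplus_{|s|=r}\mathcal D\,\tau_s^\vee$ ($s\subseteq\{1,\dots,n\}$, $0\le r\le n$), with differential $$d(P\tau_s^\vee)=\sum_{j\in s}(-1)^{\#\{i\in s:\,i<j\}}P\,\partial_j^{\langle p^m\rangle}\,\tau_{s\smallsetminus\{j\}}^\vee .$$ Then: 1. There is a quasi-isomorphism of complexes of $\mathcal D$-modules $\pi\colon\mathrm{Sp}^\bullet\to\mathcal O_X^{\oplus p^{mn}}$ (target placed in degree $0$). So $\mathrm{Sp}^\bullet$ is a free resolution of $\mathcal O_X^{\oplus p^{mn}}$. 2. There is an isomorphism of complexes of $f^{-1}\mathcal O_S$-modules, natural in the $\mathcal D$-module $\mathcal F$, $$e\colon\ \mathcal F\otimes_{\mathcal O_X}\hat\Omega^{(m),\bullet}_{X/S}\ \cong\ \mathcal Hom_{\mathcal D}(\mathrm{Sp}^\bullet,\mathcal F).$$ 3. There is an isomorphism in the derived category of $f^{-1}\mathcal O_S$-modules, natural in the $\mathcal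 D$-module $\mathcal F$, $$\Phi\colon\ \mathcal F\otimes_{\mathcal O_X}\hat\Omega^{(m),\bullet}_{X/S}\ \cong\ R\mathcal Hom_{\mathcal D}(\mathcal O_X,\mathcal F)^{\oplus p^{mn}}.$$ It comes from the resolution: for $1\le i\le p^{mn}$, let $\pi_i\colon\mathrm{Sp}^\bullet\to\mathcal O_X$ be the $i$-th component of $\pi$. The composite $$\mathcal Hom_{\mathcal D}(\mathcal O_X,\mathcal F)\xrightarrow{\ \pi_i^*\ }\mathcal Hom_{\mathcal D}(\mathrm{Sp}^\bullet,\mathcal F)\xrightarrow{\ e^{-1}\ }\mathcal F\otimes_{\mathcal O_X}\hat\Omega^{(m),\bullet}_{X/S}\xrightarrow{\ \Phi\ }R\mathcal Hom_{\mathcal D}(\mathcal O_X,\mathcal F)^{\oplus p^{mn}}$$ is the canonical morphism $\mathcal Hom_{\mathcal D}(\mathcal O_X,\mathcal F)\to R\mathcal Hom_{\mathcal D}(\mathcal O_X,\mathcal F)$ followed by the inclusion of the $i$-th summand. -/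

import Mathlib

open CategoryTheory Limits AlgebraicGeometry Opposite

universe u w₁ w₂

namespace HigherDeRham

instance sheafOfModules_isGrothendieckAbelian {C : Type u} [SmallCategory C] {J : GrothendieckTopology C}
    (R : Sheaf J RingCat.{u}) [HasSheafify J AddCommGrpCat.{u}] [J.WEqualsLocallyBijective AddCommGrpCat.{u}]  :
    IsGrothendieckAbelian.{u} (SheafOfModules.{u} R) := by
  let adj := PresheafOfModules.sheafificationAdjunction (𝟙 R.obj)
  have h1 : ∀ (K : Type u) [SmallCategory K] [IsFiltered K],
      HasExactColimitsOfShape K (PresheafOfModules.{u} R.obj) := fun K _ _ =>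
    HasExactColimitsOfShape.domain_of_functor K (PresheafOfModules.toPresheaf R.obj)
  have : (SheafOfModules.forget R ⋙ PresheafOfModules.restrictScalars (𝟙 R.obj)).Full := inferInstance
  have h2 : AB5OfSize.{u, u} (SheafOfModules.{u} R) :=
    ⟨fun K _ _ => adj.hasExactColimitsOfShape K⟩
  have h3 : HasSeparator (SheafOfModules.{u} R) := by
    let S : C → SheafOfModules.{u} R := fun X =>
      (PresheafOfModules.sheafification (𝟙 R.obj)).obj ((PresheafOfModules.free R.obj).obj (yoneda.obj X))
    have hS : (ObjectProperty.ofObj S).IsSeparating := by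
      intro M N f g h
      apply (SheafOfModules.forget R ⋙ PresheafOfModules.restrictScalars (𝟙 R.obj)).map_injective
      apply PresheafOfModules.freeYoneda.isSeparating R.obj
      rintro _ ⟨X⟩ a
      apply (adj.homEquiv _ _).symm.injective
      rw [adj.homEquiv_naturality_right_symm, adj.homEquiv_naturality_right_symm]
      exact h _ (ObjectProperty.ofObj_apply S X) _
    exact ⟨_, hS.isSeparator_coproduct⟩
  exact { }

section Ring
variable {P A B : Type*} [CommRing P] [CommRing A] [CommRing B]

theorem hom_ext_of_constantCoeff (φ : P →+* A) (hφ : φ.FormallyEtale) {G H : A →+* PowerSeries B}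
    (h : G.comp φ = H.comp φ)
    (h0 : (PowerSeries.constantCoeff (R := B)).comp G = (PowerSeries.constantCoeff (R := B)).comp H) :
    G = H := by
  algebraize [φ, G.comp φ]
  let G' : A →ₐ[P] PowerSeries B := { G with commutes' := fun _ => rfl }
  let H' : A →ₐ[P] PowerSeries B := { H with commutes' := fun r => (RingHom.congr_fun h r).symm }
  have hI : ⨅ i, (Ideal.span {(PowerSeries.X : PowerSeries B)}) ^ i = ⊥ := by
    rw [eq_bot_iff]
    intro x hx
    rw [Ideal.mem_bot]
    ext k
    have := (Ideal.mem_iInf.1 hx) (k + 1)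
    rw [Ideal.span_singleton_pow, Ideal.mem_span_singleton, PowerSeries.X_pow_dvd_iff] at this
    simpa using this k (Nat.lt_succ_self k)
  have : G' = H' := by
    refine Algebra.FormallyUnramified.ext_of_iInf _ hI fun x => ?_
    rw [Ideal.Quotient.eq, Ideal.mem_span_singleton, PowerSeries.X_dvd_iff, map_sub, sub_eq_zero]
    exact RingHom.congr_fun h0 x
  ext1 x
  exact DFunLike.congr_fun this x

theorem exists_lift (φ : P →+* A) (hφ : φ.FormallyEtale) (ψ : P →+* PowerSeries B) (g : A →+* B)
    (h : (PowerSeries.constantCoeff (R := B)).comp ψ = g.comp φ) :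
    ∃ G : A →+* PowerSeries B, G.comp φ = ψ ∧ (PowerSeries.constantCoeff (R := B)).comp G = g := by
  algebraize [φ, ψ]
  let I := Ideal.span {(PowerSeries.X : PowerSeries B)}
  let f : A →+* PowerSeries B ⧸ I := (Ideal.Quotient.mk I).comp ((PowerSeries.C (R := B)).comp g)
  have key : ∀ x y : PowerSeries B, Ideal.Quotient.mk I x = Ideal.Quotient.mk I y ↔
      PowerSeries.constantCoeff x = PowerSeries.constantCoeff y := fun x y => by
    rw [Ideal.Quotient.eq, Ideal.mem_span_singleton, PowerSeries.X_dvd_iff, map_sub, sub_eq_zero]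
  let f' : A →ₐ[P] PowerSeries B ⧸ I :=
    { f with
      commutes' := fun r => by
        refine (key _ _).2 ?_
        have := RingHom.congr_fun h r
        simp at this ⊢
        exact this.symm }
  obtain ⟨G, hG⟩ := Algebra.FormallySmooth.exists_mkₐ_comp_eq_of_isAdicComplete f'
  refine ⟨G.toRingHom, ?_, ?_⟩
  · ext1 r
    exact G.commutes r
  · ext1 a
    have := (key _ _).1 (DFunLike.congr_fun hG a)
    simpa using this

/-- The ring homomorphism `A⟦X⟧⟦Y⟧ → A⟦X⟧⟦Y⟧` which exchanges the two variables. -/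
noncomputable def swapHom : PowerSeries (PowerSeries A) →+* PowerSeries (PowerSeries A) where
  toFun F := PowerSeries.mk fun l => PowerSeries.mk fun k => PowerSeries.coeff l (PowerSeries.coeff k F)
  map_one' := by
    ext l k
    simp only [PowerSeries.coeff_mk, PowerSeries.coeff_one]
    split_ifs <;> simp_all [PowerSeries.coeff_one]
  map_mul' F G := by
    ext l k
    simp only [PowerSeries.coeff_mk, PowerSeries.coeff_mul, map_sum]
    rw [Finset.sum_comm]
  map_zero' := by ext; simp
  map_add' F G := by ext; simp

/-- The ring homomorphism `A⟦X⟧ → A⟦X⟧⟦Y⟧`, `F ↦ F(X + Y)`. -/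
noncomputable def addHom : PowerSeries A →+* PowerSeries (PowerSeries A) where
  toFun F := PowerSeries.mk fun l => PowerSeries.mk fun k =>
    ((k + l).choose k : A) * PowerSeries.coeff (k + l) F
  map_one' := by
    ext l k
    simp only [PowerSeries.coeff_mk, PowerSeries.coeff_one]
    by_cases hl : l = 0 <;> by_cases hk : k = 0 <;> simp [hl, hk, PowerSeries.coeff_one]
  map_mul' F G := by
    ext l k
    simp only [PowerSeries.coeff_mk, PowerSeries.coeff_mul, map_sum]
    rw [Finset.sum_comm, ← Finset.sum_product', Finset.mul_sum]
    rw [← Finset.sum_fiberwise_of_maps_to (t := Finset.HasAntidiagonal.antidiagonal (k + l))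
      (g := fun x : (ℕ × ℕ) × (ℕ × ℕ) => (x.1.1 + x.2.1, x.1.2 + x.2.2))]
    · refine Finset.sum_congr rfl fun m hm => ?_
      rw [Finset.HasAntidiagonal.mem_antidiagonal] at hm
      have h1 : ((k + l).choose k : A) =
          ∑ x ∈ Finset.HasAntidiagonal.antidiagonal k, ((m.1.choose x.1 : A) * (m.2.choose x.2 : A)) := by
        rw [← hm, Nat.add_choose_eq]
        push_cast
        rfl
      rw [h1, Finset.sum_mul]
      rw [← Finset.sum_filter_add_sum_filter_not (Finset.HasAntidiagonal.antidiagonal k)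
        (fun x => x.1 ≤ m.1 ∧ x.2 ≤ m.2)]
      rw [Finset.sum_eq_zero (s := Finset.filter (fun x => ¬ _) _), add_zero]
      · refine Finset.sum_bij' (fun x _ => (x, (m.1 - x.1, m.2 - x.2))) (fun y _ => y.1) ?_ ?_ ?_ ?_ ?_
        · intro x hx
          simp only [Finset.mem_filter, Finset.HasAntidiagonal.mem_antidiagonal, Finset.mem_product] at hx ⊢
          refine ⟨⟨hx.1, by omega⟩, ?_⟩
          ext <;> simp <;> omega
        · rintro ⟨⟨a, b⟩, ⟨c, d⟩⟩ hx
          simp only [Finset.mem_filter, Finset.HasAntidiagonal.mem_antidiagonal, Finset.mem_product] at hx ⊢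
          rw [← hx.2]
          exact ⟨hx.1.1, by simp, by simp⟩
        · intro x hx
          rfl
        · rintro ⟨⟨a, b⟩, ⟨c, d⟩⟩ hx
          simp only [Finset.mem_filter, Finset.HasAntidiagonal.mem_antidiagonal, Finset.mem_product] at hx ⊢
          rw [← hx.2]
          simp
        · intro x hx
          simp only [Finset.mem_filter, Finset.HasAntidiagonal.mem_antidiagonal] at hx
          dsimp only
          rw [Nat.add_sub_cancel' hx.2.1, Nat.add_sub_cancel' hx.2.2]
          ring
      · intro x hx
        simp only [Finset.mem_filter, not_and_or, not_le] at hx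
        rcases hx.2 with h | h <;> simp [Nat.choose_eq_zero_of_lt h]
    · intro x hx
      simp only [Finset.HasAntidiagonal.mem_antidiagonal, Finset.mem_product] at hx ⊢
      omega
  map_zero' := by ext; simp
  map_add' F G := by ext; simp [mul_add]

end Ring

section Taylor
variable {R A R' A' σ : Type*} [CommRing R] [CommRing A] [CommRing R'] [CommRing A'] [DecidableEq σ]

/-- The ring homomorphism `R[x₁, …, xₙ] → A⟦X⟧`, `xᵢ ↦ tᵢ + δᵢⱼ X`. -/
noncomputable def shiftHom (φ : MvPolynomial σ R →+* A) (j : σ) : MvPolynomial σ R →+* PowerSeries A :=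
  MvPolynomial.eval₂Hom ((PowerSeries.C (R := A)).comp (φ.comp MvPolynomial.C)) fun i =>
    PowerSeries.C (φ (MvPolynomial.X i)) + if i = j then PowerSeries.X else 0

theorem exists_taylor (φ : MvPolynomial σ R →+* A) (hφ : φ.FormallyEtale) (j : σ) :
    ∃ G : A →+* PowerSeries A, G.comp φ = shiftHom φ j ∧
      (PowerSeries.constantCoeff (R := A)).comp G = RingHom.id A := by
  refine exists_lift φ hφ _ _ ?_
  ext i
  · simp [shiftHom]
  · by_cases h : i = j <;> simp [shiftHom, h]

/-- Taylor expansion in the direction of the `j`-th coordinate: the unique ring homomorphism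
`T : A → A⟦X⟧` over `R` with `T(tᵢ) = tᵢ + δᵢⱼ X` and `T(a) ≡ a mod X`, where `A` is formally étale
over `R[x₁, …, xₙ]`, `xᵢ ↦ tᵢ`. -/
noncomputable def taylor (φ : MvPolynomial σ R →+* A) (hφ : φ.FormallyEtale) (j : σ) :
    A →+* PowerSeries A :=
  (exists_taylor φ hφ j).choose

variable (φ : MvPolynomial σ R →+* A) (hφ : φ.FormallyEtale)

theorem taylor_comp (j : σ) : (taylor φ hφ j).comp φ = shiftHom φ j :=
  (exists_taylor φ hφ j).choose_spec.1

theorem constantCoeff_taylor (j : σ) (a : A) : PowerSeries.constantCoeff (taylor φ hφ j a) = a :=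
  RingHom.congr_fun (exists_taylor φ hφ j).choose_spec.2 a

theorem taylor_C (j : σ) (r : R) :
    taylor φ hφ j (φ (MvPolynomial.C r)) = PowerSeries.C (φ (MvPolynomial.C r)) := by
  have := RingHom.congr_fun (taylor_comp φ hφ j) (MvPolynomial.C r)
  simpa [shiftHom] using this

theorem taylor_X (i j : σ) :
    taylor φ hφ j (φ (MvPolynomial.X i)) =
      PowerSeries.C (φ (MvPolynomial.X i)) + if i = j then PowerSeries.X else 0 := by
  have := RingHom.congr_fun (taylor_comp φ hφ j) (MvPolynomial.X i)
  simpa [shiftHom] using this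

theorem map_taylor (φ' : MvPolynomial σ R' →+* A') (hφ' : φ'.FormallyEtale) (r : R →+* R')
    (g : A →+* A') (h : g.comp φ = φ'.comp (MvPolynomial.map r)) (j : σ) (a : A) :
    PowerSeries.map g (taylor φ hφ j a) = taylor φ' hφ' j (g a) := by
  refine RingHom.congr_fun (f := (PowerSeries.map g).comp (taylor φ hφ j))
    (g := (taylor φ' hφ' j).comp g) (hom_ext_of_constantCoeff φ hφ ?_ ?_) a
  · have hC : ∀ c, g (φ (MvPolynomial.C c)) = φ' (MvPolynomial.C (r c)) := fun c => by
      simpa using RingHom.congr_fun h (MvPolynomial.C c)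
    have hX : ∀ i, g (φ (MvPolynomial.X i)) = φ' (MvPolynomial.X i) := fun i => by
      simpa using RingHom.congr_fun h (MvPolynomial.X i)
    refine MvPolynomial.ringHom_ext' ?_ fun i => ?_
    · ext1 c
      simp [taylor_C, hC]
    · by_cases hi : i = j <;> simp [taylor_X, hX, hi]
  · ext1 a
    have h0 : ∀ F : PowerSeries A, PowerSeries.constantCoeff (PowerSeries.map g F) =
        g (PowerSeries.constantCoeff F) := fun F => by
      rw [← PowerSeries.coeff_zero_eq_constantCoeff_apply, PowerSeries.coeff_map,
        PowerSeries.coeff_zero_eq_constantCoeff_apply]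
    simp only [RingHom.comp_apply, h0, constantCoeff_taylor]

theorem taylor_comm (i j : σ) (k l : ℕ) (a : A) :
    PowerSeries.coeff k (taylor φ hφ i (PowerSeries.coeff l (taylor φ hφ j a))) =
      PowerSeries.coeff l (taylor φ hφ j (PowerSeries.coeff k (taylor φ hφ i a))) := by
  have key : (PowerSeries.map (taylor φ hφ i)).comp (taylor φ hφ j) =
      swapHom.comp ((PowerSeries.map (taylor φ hφ j)).comp (taylor φ hφ i)) := by
    have h : ((PowerSeries.map (taylor φ hφ i)).comp (taylor φ hφ j)).comp φ =
        (swapHom.comp ((PowerSeries.map (taylor φ hφ j)).comp (taylor φ hφ i))).comp φ := by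
      have h1 : ∀ b : A, swapHom (PowerSeries.C (PowerSeries.C b)) = PowerSeries.C (PowerSeries.C b) := by
        intro b
        ext k l
        simp only [swapHom, RingHom.coe_mk, MonoidHom.coe_mk, OneHom.coe_mk, PowerSeries.coeff_mk,
          PowerSeries.coeff_C]
        split_ifs <;> simp_all [PowerSeries.coeff_C]
      have h2 : swapHom (PowerSeries.C (PowerSeries.X : PowerSeries A)) = PowerSeries.X := by
        ext k l
        simp only [swapHom, RingHom.coe_mk, MonoidHom.coe_mk, OneHom.coe_mk, PowerSeries.coeff_mk,
          PowerSeries.coeff_C, PowerSeries.coeff_X]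
        split_ifs <;> simp_all [PowerSeries.coeff_X, PowerSeries.coeff_one]
      have h3 : swapHom (PowerSeries.X : PowerSeries (PowerSeries A)) = PowerSeries.C PowerSeries.X := by
        ext k l
        simp only [swapHom, RingHom.coe_mk, MonoidHom.coe_mk, OneHom.coe_mk, PowerSeries.coeff_mk,
          PowerSeries.coeff_C, PowerSeries.coeff_X]
        split_ifs <;> simp_all [PowerSeries.coeff_X, PowerSeries.coeff_one]
      refine MvPolynomial.ringHom_ext' ?_ fun m => ?_
      · ext1 c
        simp [taylor_C, h1]
      · by_cases hi : m = i <;> by_cases hj : m = j <;>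
          simp [taylor_X, hi, hj, h1, h2, h3] <;> simp_all [add_right_comm]
    refine hom_ext_of_constantCoeff φ hφ h (hom_ext_of_constantCoeff φ hφ ?_ ?_)
    · exact congrArg (PowerSeries.constantCoeff.comp ·) h
    · ext1 b
      simp only [RingHom.comp_apply, ← PowerSeries.coeff_zero_eq_constantCoeff_apply,
        PowerSeries.coeff_map, swapHom, RingHom.coe_mk, MonoidHom.coe_mk, OneHom.coe_mk,
        PowerSeries.coeff_mk]
      simp [constantCoeff_taylor]
  have := congr(PowerSeries.coeff k (PowerSeries.coeff l ($key a)))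
  simpa [swapHom] using this

theorem taylor_taylor (j : σ) (k l : ℕ) (a : A) :
    PowerSeries.coeff k (taylor φ hφ j (PowerSeries.coeff l (taylor φ hφ j a))) =
      ((k + l).choose k : A) * PowerSeries.coeff (k + l) (taylor φ hφ j a) := by
  have key : (PowerSeries.map (taylor φ hφ j)).comp (taylor φ hφ j) = addHom.comp (taylor φ hφ j) := by
    have h : ((PowerSeries.map (taylor φ hφ j)).comp (taylor φ hφ j)).comp φ =
        (addHom.comp (taylor φ hφ j)).comp φ := by
      have h1 : ∀ b : A, addHom (PowerSeries.C b) = PowerSeries.C (PowerSeries.C b) := by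
        intro b
        ext k l
        simp only [addHom, RingHom.coe_mk, MonoidHom.coe_mk, OneHom.coe_mk, PowerSeries.coeff_mk,
          PowerSeries.coeff_C]
        by_cases hk : k = 0 <;> by_cases hl : l = 0 <;> simp [hl, hk, PowerSeries.coeff_C]
      have h2 : addHom (PowerSeries.X : PowerSeries A) = PowerSeries.X + PowerSeries.C PowerSeries.X := by
        ext k l
        simp only [addHom, RingHom.coe_mk, MonoidHom.coe_mk, OneHom.coe_mk, PowerSeries.coeff_mk,
          PowerSeries.coeff_C, PowerSeries.coeff_X, map_add]
        rcases k with _ | _ | k <;> rcases l with _ | _ | l <;>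
          simp [PowerSeries.coeff_X, PowerSeries.coeff_one]
        intro h
        omega
      refine MvPolynomial.ringHom_ext' ?_ fun m => ?_
      · ext1 c
        simp [taylor_C, h1]
      · by_cases hj : m = j <;> simp [taylor_X, hj, h1, h2]
        ring
    refine hom_ext_of_constantCoeff φ hφ h (hom_ext_of_constantCoeff φ hφ ?_ ?_)
    · exact congrArg (PowerSeries.constantCoeff.comp ·) h
    · ext1 b
      simp only [RingHom.comp_apply, ← PowerSeries.coeff_zero_eq_constantCoeff_apply,
        PowerSeries.coeff_map, addHom, RingHom.coe_mk, MonoidHom.coe_mk, OneHom.coe_mk,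
        PowerSeries.coeff_mk]
      simp [constantCoeff_taylor]
  have := congr(PowerSeries.coeff k (PowerSeries.coeff l ($key a)))
  simpa [addHom] using this

end Taylor

section Etale
open AffineSpace

variable {X S : Scheme.{u}} (f : X ⟶ S) {n : ℕ} (t : Fin n → Γ(X, ⊤))

/-- `t₁, …, tₙ` are local coordinates of `X` over `S`: the morphism `X ⟶ 𝔸ⁿ_S` that they define
is étale. -/
def IsCoordinates : Prop :=
  Etale (AffineSpace.homOfVector (n := ULift.{u} (Fin n)) f fun i => t i.down)

/-- The ring homomorphism `Γ(S, V)[x₁, …, xₙ] → Γ(X, U)`, `xᵢ ↦ tᵢ`. -/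
noncomputable def polyMap {U : X.Opens} {V : S.Opens} (e : U ≤ f ⁻¹ᵁ V) :
    MvPolynomial (ULift.{u} (Fin n)) Γ(S, V) →+* Γ(X, U) :=
  MvPolynomial.eval₂Hom (f.appLE V U e).hom fun i => X.presheaf.map (homOfLE le_top).op (t i.down)

variable {f t} in
theorem IsCoordinates.etale_polyMap (h : IsCoordinates f t) {U : X.Opens} {V : S.Opens}
    (hU : IsAffineOpen U) (hV : IsAffineOpen V) (e : U ≤ f ⁻¹ᵁ V) : (polyMap f t e).Etale := by
  have : Etale (AffineSpace.homOfVector (n := ULift.{u} (Fin n)) f fun i => t i.down) := h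
  let N := ULift.{u} (Fin n)
  have h1 : Spec.map (CommRingCat.ofHom (polyMap f t e)) ≫ (SpecIso N Γ(S, V)).inv ≫
      AffineSpace.map N hV.fromSpec = hU.fromSpec ≫ AffineSpace.homOfVector f fun i => t i.down := by
    apply AffineSpace.hom_ext
    · simp only [Category.assoc, map_over, SpecIso_inv_over_assoc, homOfVector_over]
      rw [← Spec.map_comp_assoc, ← CommRingCat.ofHom_comp, polyMap, MvPolynomial.eval₂Hom_comp_C,
        CommRingCat.ofHom_hom, IsAffineOpen.SpecMap_appLE_fromSpec]
    · intro i
      rw [Scheme.Hom.comp_appTop, Scheme.Hom.comp_appTop, Scheme.Hom.comp_appTop,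
        CommRingCat.comp_apply, CommRingCat.comp_apply, CommRingCat.comp_apply,
        map_appTop_coord, SpecIso_inv_appTop_coord, homOfVector_appTop_coord,
        ← CommRingCat.comp_apply, ← Scheme.ΓSpecIso_inv_naturality, CommRingCat.comp_apply]
      have h2 : (ConcreteCategory.hom (CommRingCat.ofHom (polyMap f t e))) (MvPolynomial.X i) =
          X.presheaf.map (homOfLE le_top).op (t i.down) := by
        rw [CommRingCat.ofHom_apply, polyMap, MvPolynomial.coe_eval₂Hom, MvPolynomial.eval₂_X]
      rw [h2, Scheme.Hom.appTop, hU.fromSpec_app_of_le ⊤ le_top]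
      have h3 : (Spec Γ(X, U)).presheaf.map (homOfLE (le_top : hU.fromSpec ⁻¹ᵁ ⊤ ≤ ⊤)).op = 𝟙 _ :=
        (Spec Γ(X, U)).presheaf.map_id _
      rw [h3]
      rfl
  have h2 : Etale (Spec.map (CommRingCat.ofHom (polyMap f t e)) ≫ (SpecIso N Γ(S, V)).inv ≫
      AffineSpace.map N hV.fromSpec) := h1 ▸ inferInstance
  have : IsOpenImmersion (AffineSpace.map N hV.fromSpec) :=
    MorphismProperty.of_isPullback (P := @IsOpenImmersion) (isPullback_map hV.fromSpec).flip inferInstance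
  have h3 : Etale (Spec.map (CommRingCat.ofHom (polyMap f t e))) :=
    Etale.of_comp _ ((SpecIso N Γ(S, V)).inv ≫ AffineSpace.map N hV.fromSpec)
  exact (HasRingHomProperty.Spec_iff (P := @Etale)).1 h3

end Etale

section Hasse
variable {X S : Scheme.{u}} {f : X ⟶ S} {n : ℕ} {t : Fin n → Γ(X, ⊤)}

/-- Restriction of sections of `O_X`. -/
noncomputable def res {U W : X.Opens} (h : W ≤ U) : Γ(X, U) →+* Γ(X, W) :=
  (X.presheaf.map (homOfLE h).op).hom

theorem res_res {U V W : X.Opens} (h : V ≤ U) (h' : W ≤ V) (a : Γ(X, U)) :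
    res h' (res h a) = res (h'.trans h) a := by
  simp only [res, ← CommRingCat.comp_apply, ← X.presheaf.map_comp]
  rfl

theorem res_rfl {U : X.Opens} (a : Γ(X, U)) : res le_rfl a = a := by
  simp [res]

variable (f) in
/-- A pair of affine open subsets `W ⊆ X`, `V ⊆ S` with `f(W) ⊆ V`. -/
structure Chart where
  /-- the open subset of `X` -/
  W : X.Opens
  /-- the open subset of `S` -/
  V : S.Opens
  hW : IsAffineOpen W
  hV : IsAffineOpen V
  le : W ≤ f ⁻¹ᵁ V

theorem Chart.exists_le (x : X) {U : X.Opens} (hx : x ∈ U) {V : S.Opens} (hV : f x ∈ V) :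
    ∃ c : Chart f, x ∈ c.W ∧ c.W ≤ U ∧ c.V ≤ V := by
  obtain ⟨V', hV', h1, h2⟩ := TopologicalSpace.Opens.isBasis_iff_nbhd.1 S.isBasis_affineOpens hV
  obtain ⟨W, hW, h3, h4⟩ := TopologicalSpace.Opens.isBasis_iff_nbhd.1 X.isBasis_affineOpens
    (show x ∈ U ⊓ f ⁻¹ᵁ V' from ⟨hx, h1⟩)
  exact ⟨⟨W, V', hW, hV', h4.trans inf_le_right⟩, h3, h4.trans inf_le_left, h2⟩

/-- Sections of `O_X` that agree on all small charts are equal. -/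
theorem eq_of_charts {U : X.Opens} (a b : Γ(X, U))
    (h : ∀ x ∈ U, ∃ (W : X.Opens) (hW : W ≤ U), x ∈ W ∧ res hW a = res hW b) : a = b := by
  choose W hW hx h using h
  refine X.sheaf.eq_of_locally_eq' (fun x : U => W x x.2) U (fun x => homOfLE (hW x x.2)) ?_ a b
    fun x => h x x.2
  intro x hxU
  exact TopologicalSpace.Opens.mem_iSup.2 ⟨⟨x, hxU⟩, hx x hxU⟩

theorem Chart.formallyEtale (c : Chart f) (ht : IsCoordinates f t) :
    (polyMap f t c.le).FormallyEtale :=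
  (ht.etale_polyMap c.hW c.hV c.le).formallyEtale

/-- The Taylor expansion on a chart. -/
noncomputable def Chart.taylor (c : Chart f) (ht : IsCoordinates f t) (j : Fin n) :
    Γ(X, c.W) →+* PowerSeries Γ(X, c.W) :=
  HigherDeRham.taylor (polyMap f t c.le) (c.formallyEtale ht) ⟨j⟩

theorem Chart.taylor_res (c c' : Chart f) (ht : IsCoordinates f t) (j : Fin n)
    (hW : c'.W ≤ c.W) (hV : c'.V ≤ c.V) (k : ℕ) (a : Γ(X, c.W)) :
    res hW (PowerSeries.coeff k (c.taylor ht j a)) =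
      PowerSeries.coeff k (c'.taylor ht j (res hW a)) := by
  have := map_taylor (polyMap f t c.le) (c.formallyEtale ht)
    (polyMap f t c'.le) (c'.formallyEtale ht)
    (S.presheaf.map (homOfLE hV).op).hom (res hW) ?_ ⟨j⟩ a
  · rw [Chart.taylor, Chart.taylor, ← this, PowerSeries.coeff_map]
  · refine MvPolynomial.ringHom_ext' ?_ fun i => ?_
    · ext1 r
      simp only [polyMap, res, RingHom.comp_apply, MvPolynomial.coe_eval₂Hom, MvPolynomial.eval₂_C,
        MvPolynomial.map_C]
      simp only [← CommRingCat.comp_apply]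
      rw [Scheme.Hom.appLE_map, Scheme.Hom.map_appLE]
    · simp only [polyMap, RingHom.comp_apply, MvPolynomial.coe_eval₂Hom, MvPolynomial.eval₂_X,
        MvPolynomial.map_X]
      exact res_res _ _ _

theorem exists_hasse (ht : IsCoordinates f t) (j : Fin n) (k : ℕ) {U : X.Opens} (a : Γ(X, U)) :
    ∃ b : Γ(X, U), ∀ (c : Chart f) (hc : c.W ≤ U),
      res hc b = PowerSeries.coeff k (c.taylor ht j (res hc a)) := by
  let I := { c : Chart f // c.W ≤ U }
  have hcov : U ≤ ⨆ i : I, i.1.W := by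
    intro x hx
    obtain ⟨c, hxc, hc, -⟩ := Chart.exists_le (f := f) x hx (V := ⊤) trivial
    exact TopologicalSpace.Opens.mem_iSup.2 ⟨⟨c, hc⟩, hxc⟩
  have hcomp : TopCat.Presheaf.IsCompatible X.presheaf (fun i : I => i.1.W)
      (fun i => PowerSeries.coeff k (i.1.taylor ht j (res i.2 a))) := by
    intro c c'
    refine eq_of_charts (X := X) _ _ fun x hx => ?_
    obtain ⟨d, hxd, hd, hdV⟩ := Chart.exists_le (f := f) x hx
      (V := c.1.V ⊓ c'.1.V) ⟨c.1.le hx.1, c'.1.le hx.2⟩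
    refine ⟨d.W, hd, hxd, ?_⟩
    refine (res_res (inf_le_left : c.1.W ⊓ c'.1.W ≤ c.1.W) hd _).trans
      (Eq.trans ?_ (res_res (inf_le_right : c.1.W ⊓ c'.1.W ≤ c'.1.W) hd _).symm)
    rw [Chart.taylor_res c.1 d ht j (hd.trans inf_le_left) (hdV.trans inf_le_left),
      Chart.taylor_res c'.1 d ht j (hd.trans inf_le_right) (hdV.trans inf_le_right), res_res, res_res]
  obtain ⟨b, hb, -⟩ := X.sheaf.existsUnique_gluing' (fun i : I => i.1.W) U
    (fun i => homOfLE i.2) hcov _ hcomp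
  exact ⟨b, fun c hc => hb ⟨c, hc⟩⟩

/-- The operator `∂_j^{[k]}` on sections of `O_X`: the coefficient of `X^k` in the Taylor expansion
in the direction of the `j`-th coordinate. -/
noncomputable def hasse (ht : IsCoordinates f t) (j : Fin n) (k : ℕ) {U : X.Opens} (a : Γ(X, U)) :
    Γ(X, U) :=
  (exists_hasse ht j k a).choose

variable (ht : IsCoordinates f t)

theorem res_hasse_chart (j : Fin n) (k : ℕ) {U : X.Opens} (a : Γ(X, U)) (c : Chart f)
    (hc : c.W ≤ U) :
    res hc (hasse ht j k a) = PowerSeries.coeff k (c.taylor ht j (res hc a)) :=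
  (exists_hasse ht j k a).choose_spec c hc

theorem hasse_ext {f : X ⟶ S} {U : X.Opens} {a b : Γ(X, U)}
    (h : ∀ (c : Chart f) (hc : c.W ≤ U), res hc a = res hc b) : a = b :=
  eq_of_charts a b fun x hx => by
    obtain ⟨c, hxc, hc, -⟩ := Chart.exists_le (f := f) x hx (V := ⊤) trivial
    exact ⟨c.W, hc, hxc, h c hc⟩

theorem hasse_res (j : Fin n) (k : ℕ) {U W : X.Opens} (h : W ≤ U) (a : Γ(X, U)) :
    hasse ht j k (res h a) = res h (hasse ht j k a) :=
  hasse_ext (f := f) fun c hc => by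
    rw [res_hasse_chart, res_res, res_res, res_hasse_chart]

theorem hasse_zero_right (j : Fin n) {U : X.Opens} (a : Γ(X, U)) : hasse ht j 0 a = a :=
  hasse_ext (f := f) fun c hc => by
    rw [res_hasse_chart, PowerSeries.coeff_zero_eq_constantCoeff_apply, Chart.taylor,
      constantCoeff_taylor]

theorem hasse_add (j : Fin n) (k : ℕ) {U : X.Opens} (a b : Γ(X, U)) :
    hasse ht j k (a + b) = hasse ht j k a + hasse ht j k b :=
  hasse_ext (f := f) fun c hc => by
    simp only [res_hasse_chart, map_add]

theorem hasse_mul (j : Fin n) (k : ℕ) {U : X.Opens} (a b : Γ(X, U)) :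
    hasse ht j k (a * b) = ∑ x ∈ Finset.HasAntidiagonal.antidiagonal k,
      hasse ht j x.1 a * hasse ht j x.2 b :=
  hasse_ext (f := f) fun c hc => by
    simp only [res_hasse_chart, map_mul, map_sum, PowerSeries.coeff_mul]

theorem hasse_comm (i j : Fin n) (k l : ℕ) {U : X.Opens} (a : Γ(X, U)) :
    hasse ht i k (hasse ht j l a) = hasse ht j l (hasse ht i k a) :=
  hasse_ext (f := f) fun c hc => by
    simp only [res_hasse_chart]
    exact taylor_comm _ _ _ _ _ _ _

theorem hasse_hasse (j : Fin n) (k l : ℕ) {U : X.Opens} (a : Γ(X, U)) :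
    hasse ht j k (hasse ht j l a) = ((k + l).choose k : Γ(X, U)) * hasse ht j (k + l) a :=
  hasse_ext (f := f) fun c hc => by
    simp only [res_hasse_chart, map_mul, map_natCast]
    exact taylor_taylor _ _ _ _ _ _

theorem hasse_appLE (j : Fin n) (k : ℕ) {U : X.Opens} {V : S.Opens} (e : U ≤ f ⁻¹ᵁ V) (s : Γ(S, V)) :
    hasse ht j k ((f.appLE V U e).hom s) = if k = 0 then (f.appLE V U e).hom s else 0 :=
  eq_of_charts _ _ fun x hx => by
    obtain ⟨c, hxc, hc, hcV⟩ := Chart.exists_le (f := f) x hx (V := V) (e hx)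
    refine ⟨c.W, hc, hxc, ?_⟩
    have h : res hc ((f.appLE V U e).hom s) = polyMap f t c.le
        (MvPolynomial.C ((S.presheaf.map (homOfLE hcV).op).hom s)) := by
      simp only [polyMap, res, MvPolynomial.coe_eval₂Hom, MvPolynomial.eval₂_C]
      simp only [← CommRingCat.comp_apply]
      rw [Scheme.Hom.appLE_map, Scheme.Hom.map_appLE]
    rw [res_hasse_chart, h, Chart.taylor, taylor_C, PowerSeries.coeff_C]
    split_ifs
    · exact h.symm
    · simp

end Hasse

section DiffRing
variable (p m : ℕ) {X S : Scheme.{u}} {f : X ⟶ S} {n : ℕ} {t : Fin n → Γ(X, ⊤)}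
  (ht : IsCoordinates f t)

/-- `q_k = ⌊k / p^m⌋`. -/
def floorQuot (k : ℕ) : ℕ := k / p ^ m

/-- The number `⟨k+l; k⟩ = binom(k+l, k) q_k! q_l! / q_{k+l}!`, whose denominator is prime
to `p`. -/
def angle (k l : ℕ) : ℚ :=
  ((k + l).choose k : ℚ) * (floorQuot p m k).factorial * (floorQuot p m l).factorial / (floorQuot p m (k + l)).factorial

/-- Generators of the ring of differential operators of level `m` on `U`: the sections of `O_X`
on `U` and the symbols `∂_j^{⟨k⟩}`. -/
abbrev DiffGen (X : Scheme.{u}) (n : ℕ) (U : X.Opens) : Type u :=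
  FreeAlgebra ℤ (Γ(X, U) ⊕ (Fin n × ℕ))

/-- The generator given by a function. -/
def DiffGen.fn {U : X.Opens} (a : Γ(X, U)) : DiffGen X n U := FreeAlgebra.ι ℤ (Sum.inl a)

/-- The generator `∂_j^{⟨k⟩}`. -/
def DiffGen.del (U : X.Opens) (j : Fin n) (k : ℕ) : DiffGen X n U :=
  FreeAlgebra.ι ℤ (Sum.inr (j, k))

open DiffGen in
/-- Defining relations of the ring of differential operators of level `m`. In the relation
`leibniz`, the coefficient `(q_k! / q_l!) ∂_j^{[i]}(a)`, `k = i + l`, is `{k; i} ∂_j^{⟨i⟩}(a)` with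
`{k; i} = q_k! / (q_i! q_l!)` and `∂_j^{⟨i⟩}(a) = q_i! ∂_j^{[i]}(a)`. -/
inductive DiffRel (U : X.Opens) : DiffGen X n U → DiffGen X n U → Prop
  | fn_one : DiffRel U (fn 1) 1
  | fn_add (a b : Γ(X, U)) : DiffRel U (fn (a + b)) (fn a + fn b)
  | fn_mul (a b : Γ(X, U)) : DiffRel U (fn (a * b)) (fn a * fn b)
  | del_zero (j : Fin n) : DiffRel U (del U j 0) 1
  | del_comm (i j : Fin n) (k l : ℕ) : DiffRel U (del U i k * del U j l) (del U j l * del U i k)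
  | del_mul (j : Fin n) (k l : ℕ) :
      DiffRel U ((angle p m k l).den • (del U j k * del U j l))
        ((angle p m k l).num • del U j (k + l))
  | leibniz (j : Fin n) (k : ℕ) (a : Γ(X, U)) :
      DiffRel U (del U j k * fn a)
        (∑ x ∈ Finset.HasAntidiagonal.antidiagonal k,
          fn (((floorQuot p m k).factorial / (floorQuot p m x.2).factorial) • hasse ht j x.1 a) * del U j x.2)

/-- The ring of differential operators of level `m` on `U`, by generators and relations. -/
def DiffRing (U : X.Opens) : Type u := RingQuot (DiffRel p m ht U)

noncomputable instance (U : X.Opens) : Ring (DiffRing p m ht U) :=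
  inferInstanceAs (Ring (RingQuot (DiffRel p m ht U)))

namespace DiffRing

/-- The projection from the free algebra. -/
noncomputable def mk (U : X.Opens) : DiffGen X n U →+* DiffRing p m ht U :=
  RingQuot.mkRingHom (DiffRel p m ht U)

variable {p m ht} in
theorem mk_rel {U : X.Opens} {x y : DiffGen X n U} (h : DiffRel p m ht U x y) :
    mk p m ht U x = mk p m ht U y :=
  RingQuot.mkRingHom_rel h

/-- The operator `∂_j^{⟨k⟩}`. -/
noncomputable def del (U : X.Opens) (j : Fin n) (k : ℕ) : DiffRing p m ht U :=
  mk p m ht U (DiffGen.del U j k)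

/-- The ring homomorphism from functions to differential operators. -/
noncomputable def fn (U : X.Opens) : Γ(X, U) →+* DiffRing p m ht U where
  toFun a := mk p m ht U (DiffGen.fn a)
  map_one' := by rw [mk_rel (.fn_one), map_one]
  map_mul' a b := by rw [mk_rel (.fn_mul a b), map_mul]
  map_add' a b := by rw [mk_rel (.fn_add a b), map_add]
  map_zero' := by
    have := mk_rel (p := p) (m := m) (ht := ht) (.fn_add (U := U) 0 0)
    rwa [add_zero, map_add, left_eq_add] at this

theorem del_zero (U : X.Opens) (j : Fin n) : del p m ht U j 0 = 1 := by
  rw [del, mk_rel (.del_zero j), map_one]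

theorem del_comm (U : X.Opens) (i j : Fin n) (k l : ℕ) :
    del p m ht U i k * del p m ht U j l = del p m ht U j l * del p m ht U i k := by
  simpa only [map_mul] using! mk_rel (p := p) (m := m) (ht := ht) (.del_comm (U := U) i j k l)

theorem del_mul (U : X.Opens) (j : Fin n) (k l : ℕ) :
    (angle p m k l).den • (del p m ht U j k * del p m ht U j l) =
      (angle p m k l).num • del p m ht U j (k + l) := by
  simpa only [map_nsmul, map_zsmul, map_mul] using!
    mk_rel (p := p) (m := m) (ht := ht) (.del_mul (U := U) j k l)

theorem leibniz (U : X.Opens) (j : Fin n) (k : ℕ) (a : Γ(X, U)) :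
    del p m ht U j k * fn p m ht U a =
      ∑ x ∈ Finset.HasAntidiagonal.antidiagonal k,
        fn p m ht U (((floorQuot p m k).factorial / (floorQuot p m x.2).factorial) • hasse ht j x.1 a) *
          del p m ht U j x.2 := by
  simpa only [map_sum, map_mul] using! mk_rel (p := p) (m := m) (ht := ht) (.leibniz (U := U) j k a)

/-- A homomorphism out of the ring of differential operators is given by its values on the
generators, subject to the relations. -/
noncomputable def lift {U : X.Opens} {A : Type*} [Ring A] (g : Γ(X, U) →+* A) (d : Fin n → ℕ → A)
    (h0 : ∀ j, d j 0 = 1) (hc : ∀ i j k l, d i k * d j l = d j l * d i k)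
    (hm : ∀ j k l, (angle p m k l).den • (d j k * d j l) = (angle p m k l).num • d j (k + l))
    (hl : ∀ j k a, d j k * g a = ∑ x ∈ Finset.HasAntidiagonal.antidiagonal k,
        g (((floorQuot p m k).factorial / (floorQuot p m x.2).factorial) • hasse ht j x.1 a) * d j x.2) :
    DiffRing p m ht U →+* A :=
  RingQuot.lift ⟨(FreeAlgebra.lift ℤ (Sum.elim g fun x => d x.1 x.2) :
      DiffGen X n U →ₐ[ℤ] A).toRingHom, by
    intro x y hxy
    cases hxy <;> simp [DiffGen.fn, DiffGen.del, h0, hl]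
    · exact hc _ _ _ _
    · rename_i j k l
      simpa only [nsmul_eq_mul, zsmul_eq_mul] using hm j k l⟩

section lift
variable {U : X.Opens} {A : Type*} [Ring A] (g : Γ(X, U) →+* A) (d : Fin n → ℕ → A)
    (h0 : ∀ j, d j 0 = 1) (hc : ∀ i j k l, d i k * d j l = d j l * d i k)
    (hm : ∀ j k l, (angle p m k l).den • (d j k * d j l) = (angle p m k l).num • d j (k + l))
    (hl : ∀ j k a, d j k * g a = ∑ x ∈ Finset.HasAntidiagonal.antidiagonal k,
        g (((floorQuot p m k).factorial / (floorQuot p m x.2).factorial) • hasse ht j x.1 a) * d j x.2)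

theorem lift_fn (a : Γ(X, U)) : lift p m ht g d h0 hc hm hl (fn p m ht U a) = g a :=
  (RingQuot.lift_mkRingHom_apply _ _ _).trans (by simp [DiffGen.fn])

theorem lift_del (j : Fin n) (k : ℕ) : lift p m ht g d h0 hc hm hl (del p m ht U j k) = d j k :=
  (RingQuot.lift_mkRingHom_apply _ _ _).trans (by simp [DiffGen.del])

end lift

variable {p m ht} in
theorem induction {U : X.Opens} {C : DiffRing p m ht U → Prop}
    (h1 : ∀ a, C (fn p m ht U a)) (h2 : ∀ j k, C (del p m ht U j k))
    (h3 : ∀ x y, C x → C y → C (x + y)) (h4 : ∀ x y, C x → C y → C (x * y)) (x) : C x := by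
  obtain ⟨x, rfl⟩ := RingQuot.mkRingHom_surjective _ x
  induction x using FreeAlgebra.induction with
  | grade0 r =>
    have : C (fn p m ht U (r : Γ(X, U))) := h1 _
    rw [map_intCast] at this
    have h := map_intCast (RingQuot.mkRingHom (DiffRel p m ht U)) r
    rw [eq_intCast]
    exact h ▸ this
  | grade1 x =>
    rcases x with a | ⟨j, k⟩
    · exact h1 a
    · exact h2 j k
  | mul a b ha hb => rw [map_mul]; exact h4 _ _ ha hb
  | add a b ha hb => rw [map_add]; exact h3 _ _ ha hb

variable {p m ht} in
theorem hom_ext {U : X.Opens} {A : Type*} [Ring A] {g h : DiffRing p m ht U →+* A}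
    (h1 : ∀ a, g (fn p m ht U a) = h (fn p m ht U a))
    (h2 : ∀ j k, g (del p m ht U j k) = h (del p m ht U j k)) : g = h := by
  ext x
  induction x using induction with
  | h1 a => exact h1 a
  | h2 j k => exact h2 j k
  | h3 x y hx hy => rw [map_add, map_add, hx, hy]
  | h4 x y hx hy => rw [map_mul, map_mul, hx, hy]

/-- Restriction of differential operators. -/
noncomputable def res {U W : X.Opens} (h : W ≤ U) : DiffRing p m ht U →+* DiffRing p m ht W :=
  lift p m ht ((fn p m ht W).comp (HigherDeRham.res h)) (fun j k => del p m ht W j k)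
    (fun j => del_zero p m ht W j) (fun i j k l => del_comm p m ht W i j k l)
    (fun j k l => del_mul p m ht W j k l) (fun j k a => by
      simp only [RingHom.comp_apply, leibniz, hasse_res, map_nsmul])

theorem res_fn {U W : X.Opens} (h : W ≤ U) (a : Γ(X, U)) :
    res p m ht h (fn p m ht U a) = fn p m ht W (HigherDeRham.res h a) :=
  lift_fn ..

theorem res_del {U W : X.Opens} (h : W ≤ U) (j : Fin n) (k : ℕ) :
    res p m ht h (del p m ht U j k) = del p m ht W j k :=
  lift_del ..

/-- The action of `∂_j^{⟨k⟩}` on functions, `a ↦ q_k! ∂_j^{[k]}(a)`. -/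
noncomputable def delEnd (U : X.Opens) (j : Fin n) (k : ℕ) : AddMonoid.End Γ(X, U) :=
  AddMonoidHom.mk' (fun a => (floorQuot p m k).factorial • hasse ht j k a) fun a b => by
    rw [hasse_add, smul_add]

theorem hasse_nsmul (b : ℕ) {U : X.Opens} (x : Γ(X, U)) (j : Fin n) (k : ℕ) :
    hasse ht j k (b • x) = b • hasse ht j k x :=
  map_nsmul (AddMonoidHom.mk' (hasse ht j k) (hasse_add ht j k)) b x

theorem angle_den_mul (k l : ℕ) :
    (angle p m k l).den * (floorQuot p m k).factorial * (floorQuot p m l).factorial * (k + l).choose k =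
      (angle p m k l).num * (floorQuot p m (k + l)).factorial := by
  have h : ((floorQuot p m (k + l)).factorial : ℚ) ≠ 0 := by positivity
  have h1 : angle p m k l * (floorQuot p m (k + l)).factorial =
      ((k + l).choose k : ℚ) * (floorQuot p m k).factorial * (floorQuot p m l).factorial := by
    rw [angle, div_mul_cancel₀ _ h]
  have h2 : ((angle p m k l).num : ℚ) = angle p m k l * (angle p m k l).den :=
    (Rat.mul_den_eq_num _).symm
  have : ((angle p m k l).den * (floorQuot p m k).factorial * (floorQuot p m l).factorial * (k + l).choose k : ℚ) =
      (angle p m k l).num * (floorQuot p m (k + l)).factorial := by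
    rw [h2, mul_assoc _ _ ((floorQuot p m (k + l)).factorial : ℚ), mul_comm _ ((floorQuot p m (k + l)).factorial : ℚ),
      ← mul_assoc, h1]
    ring
  exact_mod_cast this

/-- The action of differential operators on functions: `∂_j^{⟨k⟩}` acts as `q_k! ∂_j^{[k]}`. -/
noncomputable def toEnd (U : X.Opens) : DiffRing p m ht U →+* AddMonoid.End Γ(X, U) :=
  lift p m ht (Module.toAddMonoidEnd Γ(X, U) Γ(X, U))
    (delEnd p m ht U)
    (fun j => AddMonoidHom.ext fun a => by
      change (floorQuot p m 0).factorial • hasse ht j 0 a = a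
      simp [floorQuot, hasse_zero_right])
    (fun i j k l => AddMonoidHom.ext fun a => by
      change (floorQuot p m k).factorial • hasse ht i k ((floorQuot p m l).factorial • hasse ht j l a) =
        (floorQuot p m l).factorial • hasse ht j l ((floorQuot p m k).factorial • hasse ht i k a)
      rw [hasse_nsmul, hasse_nsmul, hasse_comm ht i j k l a, smul_comm])
    (fun j k l => AddMonoidHom.ext fun a => by
      change (angle p m k l).den •
          ((floorQuot p m k).factorial • hasse ht j k ((floorQuot p m l).factorial • hasse ht j l a)) =
        (angle p m k l).num • ((floorQuot p m (k + l)).factorial • hasse ht j (k + l) a)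
      have h1 := congrArg (Int.cast : ℤ → Γ(X, U)) (angle_den_mul p m k l)
      push_cast at h1
      rw [hasse_nsmul, hasse_hasse]
      simp only [nsmul_eq_mul, zsmul_eq_mul]
      linear_combination hasse ht j (k + l) a * h1)
    (fun j k a => AddMonoidHom.ext fun b => by
      refine Eq.trans ?_ (AddMonoidHom.finsetSum_apply (M := Γ(X, U)) (N := Γ(X, U)) _ _ _).symm
      change (floorQuot p m k).factorial • hasse ht j k (a * b) =
        ∑ x ∈ Finset.HasAntidiagonal.antidiagonal k,
          (((floorQuot p m k).factorial / (floorQuot p m x.2).factorial) • hasse ht j x.1 a) *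
            ((floorQuot p m x.2).factorial • hasse ht j x.2 b)
      rw [hasse_mul, Finset.smul_sum]
      refine Finset.sum_congr rfl fun x hx => ?_
      have h1 : (floorQuot p m k).factorial / (floorQuot p m x.2).factorial * (floorQuot p m x.2).factorial =
          (floorQuot p m k).factorial := by
        refine Nat.div_mul_cancel (Nat.factorial_dvd_factorial (Nat.div_le_div_right ?_))
        rw [Finset.HasAntidiagonal.mem_antidiagonal] at hx
        omega
      have h2 := congrArg (Nat.cast : ℕ → Γ(X, U)) h1
      rw [Nat.cast_mul] at h2
      rw [nsmul_eq_mul, nsmul_eq_mul, nsmul_eq_mul, ← h2]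
      ring)

theorem toEnd_fn (U : X.Opens) (a b : Γ(X, U)) : toEnd p m ht U (fn p m ht U a) b = a * b :=
  DFunLike.congr_fun (lift_fn ..) b

theorem toEnd_del (U : X.Opens) (j : Fin n) (k : ℕ) (b : Γ(X, U)) :
    toEnd p m ht U (del p m ht U j k) b = (floorQuot p m k).factorial • hasse ht j k b :=
  DFunLike.congr_fun (lift_del ..) b

theorem res_toEnd {U W : X.Opens} (h : W ≤ U) (P : DiffRing p m ht U) (a : Γ(X, U)) :
    HigherDeRham.res h (toEnd p m ht U P a) =
      toEnd p m ht W (res p m ht h P) (HigherDeRham.res h a) := by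
  induction P using induction generalizing a with
  | h1 b => rw [res_fn, toEnd_fn, toEnd_fn, map_mul]
  | h2 j k => rw [res_del, toEnd_del, toEnd_del, map_nsmul, hasse_res]
  | h3 x y hx hy =>
    rw [map_add, map_add, map_add]
    exact (map_add (HigherDeRham.res h) _ _).trans (congrArg₂ (· + ·) (hx a) (hy a))
  | h4 x y hx hy =>
    rw [map_mul, map_mul, map_mul]
    exact (hx _).trans (congrArg _ (hy a))

/-- Functions as a module over differential operators. -/
@[reducible]
noncomputable def module (U : X.Opens) : Module (DiffRing p m ht U) Γ(X, U) :=
  Module.compHom (Γ(X, U)) (toEnd p m ht U)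

theorem commute_const {U : X.Opens} {V : S.Opens} (e : U ≤ f ⁻¹ᵁ V) (s : Γ(S, V))
    (P : DiffRing p m ht U) : Commute (fn p m ht U ((f.appLE V U e).hom s)) P := by
  induction P using induction with
  | h1 b => rw [commute_iff_eq, ← map_mul, ← map_mul, mul_comm]
  | h2 j k =>
    rw [commute_iff_eq, leibniz, Finset.sum_eq_single (0, k)]
    · rw [hasse_zero_right, Nat.div_self (Nat.factorial_pos _), one_smul]
    · rintro ⟨a, b⟩ hab h
      have : a ≠ 0 := by
        rintro rfl
        rw [Finset.HasAntidiagonal.mem_antidiagonal] at hab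
        simp_all
      rw [hasse_appLE, if_neg this, smul_zero, map_zero, zero_mul]
    · intro h
      simp [Finset.HasAntidiagonal.mem_antidiagonal] at h
  | h3 x y hx hy => exact hx.add_right hy
  | h4 x y hx hy => exact hx.mul_right hy

end DiffRing

/-- The presheaf `U ↦ DiffRing U`. -/
noncomputable def diffPresheaf : (TopologicalSpace.Opens X)ᵒᵖ ⥤ RingCat.{u} where
  obj U := RingCat.of (DiffRing p m ht U.unop)
  map i := RingCat.ofHom (DiffRing.res p m ht i.unop.le)
  map_id U := by
    ext1
    refine DiffRing.hom_ext (fun a => ?_) fun j k => ?_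
    · exact (DiffRing.res_fn ..).trans (by rw [res_rfl]; rfl)
    · exact DiffRing.res_del ..
  map_comp i j := by
    ext1
    refine DiffRing.hom_ext (fun a => ?_) fun j k => ?_
    · simp only [RingCat.hom_comp, RingCat.hom_ofHom, RingHom.comp_apply, DiffRing.res_fn, res_res]
    · simp only [RingCat.hom_comp, RingCat.hom_ofHom, RingHom.comp_apply, DiffRing.res_del]

/-- The sheaf of rings `D^{(m)}_{X/S}` of differential operators of level `m`. -/
noncomputable def diffSheaf : Sheaf (Opens.grothendieckTopology X) RingCat.{u} :=
  (presheafToSheaf (Opens.grothendieckTopology X) RingCat.{u}).obj (diffPresheaf p m ht)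

/-- The canonical morphism from the presheaf of differential operators to the associated sheaf. -/
noncomputable def toDiffSheaf : diffPresheaf p m ht ⟶ (diffSheaf p m ht).obj :=
  toSheafify (Opens.grothendieckTopology X) (diffPresheaf p m ht)

instance : Presheaf.IsLocallyInjective (Opens.grothendieckTopology X) (toDiffSheaf p m ht) :=
  inferInstanceAs (Presheaf.IsLocallyInjective _
    (toSheafify (Opens.grothendieckTopology X) (diffPresheaf p m ht)))

instance : Presheaf.IsLocallySurjective (Opens.grothendieckTopology X) (toDiffSheaf p m ht) :=
  inferInstanceAs (Presheaf.IsLocallySurjective _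
    (toSheafify (Opens.grothendieckTopology X) (diffPresheaf p m ht)))

end DiffRing

section StructureSheaf
variable (p m : ℕ) {X S : Scheme.{u}} {f : X ⟶ S} {n : ℕ} {t : Fin n → Γ(X, ⊤)}
  (ht : IsCoordinates f t)

variable (X) in
/-- The structure sheaf as a sheaf of rings. -/
noncomputable def ringSheaf : Sheaf (Opens.grothendieckTopology X) RingCat.{u} :=
  (sheafCompose _ (forget₂ CommRingCat.{u} RingCat.{u})).obj X.sheaf

variable (X) in
/-- The structure sheaf as a sheaf of abelian groups. -/
noncomputable def addSheaf : Sheaf (Opens.grothendieckTopology X) AddCommGrpCat.{u} :=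
  (sheafCompose _ (forget₂ RingCat.{u} AddCommGrpCat.{u})).obj (ringSheaf X)

/-- Functions as a presheaf of modules over the presheaf of differential operators. -/
noncomputable def structPresheafOfModules : PresheafOfModules.{u} (diffPresheaf p m ht) :=
  letI (U : (TopologicalSpace.Opens X)ᵒᵖ) :
      Module ((diffPresheaf p m ht).obj U) ((addSheaf X).obj.obj U) :=
    DiffRing.module p m ht U.unop
  PresheafOfModules.ofPresheaf (addSheaf X).obj fun _ _ i P a =>
    DiffRing.res_toEnd p m ht i.unop.le P a

/-- The identity, from the presheaf underlying the previous one to the sheaf of abelian groups. -/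
noncomputable def structPresheafHom :
    (structPresheafOfModules p m ht).presheaf ⟶ (addSheaf X).obj :=
  𝟙 (addSheaf X).obj

instance : Presheaf.IsLocallyInjective (Opens.grothendieckTopology X)
    (structPresheafHom p m ht) :=
  Presheaf.isLocallyInjective_of_injective _ _ fun _ _ _ h => h

instance : Presheaf.IsLocallySurjective (Opens.grothendieckTopology X)
    (structPresheafHom p m ht) :=
  Presheaf.isLocallySurjective_of_surjective _ _ fun _ a => ⟨a, rfl⟩

/-- The structure sheaf `O_X` as a sheaf of modules over the sheaf of differential operators. -/
noncomputable def structModule : SheafOfModules.{u} (diffSheaf p m ht) :=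
  PresheafOfModules.sheafify (toDiffSheaf p m ht) (structPresheafHom p m ht)

end StructureSheaf

section Const
variable {X S : Scheme.{u}} (f : X ⟶ S)

/-- `a` is locally the inverse image of a section of `O_S`. -/
def IsLocallyConst {U : X.Opens} (a : Γ(X, U)) : Prop :=
  ∀ x ∈ U, ∃ (W : X.Opens) (hW : W ≤ U) (V : S.Opens) (e : W ≤ f ⁻¹ᵁ V) (s : Γ(S, V)),
    x ∈ W ∧ res hW a = (f.appLE V W e).hom s

theorem IsLocallyConst.res {U W : X.Opens} (h : W ≤ U) {a : Γ(X, U)} (ha : IsLocallyConst f a) :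
    IsLocallyConst f (res h a) := by
  intro x hx
  obtain ⟨W', hW', V, e, s, hxW, hs⟩ := ha x (h hx)
  refine ⟨W ⊓ W', inf_le_left, V, inf_le_right.trans e, s, ⟨hx, hxW⟩, ?_⟩
  rw [res_res, ← res_res hW' (inf_le_right : W ⊓ W' ≤ W'), hs]
  simp only [HigherDeRham.res, ← CommRingCat.comp_apply]
  rw [Scheme.Hom.appLE_map]

theorem IsLocallyConst.exists₂ {U : X.Opens} {a b : Γ(X, U)} (ha : IsLocallyConst f a)
    (hb : IsLocallyConst f b) (x : X) (hx : x ∈ U) :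
    ∃ (W : X.Opens) (hW : W ≤ U) (V : S.Opens) (e : W ≤ f ⁻¹ᵁ V) (s s' : Γ(S, V)),
      x ∈ W ∧ HigherDeRham.res hW a = (f.appLE V W e).hom s ∧
        HigherDeRham.res hW b = (f.appLE V W e).hom s' := by
  obtain ⟨W, hW, V, e, s, hxW, hs⟩ := ha x hx
  obtain ⟨W', hW', V', e', s', hxW', hs'⟩ := hb x hx
  have e'' : W ⊓ W' ≤ f ⁻¹ᵁ (V ⊓ V') := le_inf (inf_le_left.trans e) (inf_le_right.trans e')
  refine ⟨W ⊓ W', inf_le_left.trans hW, V ⊓ V', e'',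
    (S.presheaf.map (homOfLE inf_le_left).op).hom s,
    (S.presheaf.map (homOfLE inf_le_right).op).hom s', ⟨hxW, hxW'⟩, ?_, ?_⟩
  · rw [← res_res hW (inf_le_left : W ⊓ W' ≤ W), hs]
    simp only [HigherDeRham.res, ← CommRingCat.comp_apply]
    rw [Scheme.Hom.appLE_map, Scheme.Hom.map_appLE]
  · rw [← res_res hW' (inf_le_right : W ⊓ W' ≤ W'), hs']
    simp only [HigherDeRham.res, ← CommRingCat.comp_apply]
    rw [Scheme.Hom.appLE_map, Scheme.Hom.map_appLE]

theorem isLocallyConst_appLE {U : X.Opens} {V : S.Opens} (e : U ≤ f ⁻¹ᵁ V) (s : Γ(S, V)) :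
    IsLocallyConst f ((f.appLE V U e).hom s) :=
  fun x hx => ⟨U, le_rfl, V, e, s, hx, res_rfl _⟩

/-- The subring of `Γ(X, U)` of sections that are locally inverse images of sections of `O_S`. -/
def constSubring (U : X.Opens) : Subring Γ(X, U) where
  carrier := {a | IsLocallyConst f a}
  mul_mem' {a b} ha hb x hx := by
    obtain ⟨W, hW, V, e, s, s', hxW, h, h'⟩ := IsLocallyConst.exists₂ f ha hb x hx
    exact ⟨W, hW, V, e, s * s', hxW, by rw [map_mul, map_mul, h, h']⟩
  add_mem' {a b} ha hb x hx := by
    obtain ⟨W, hW, V, e, s, s', hxW, h, h'⟩ := IsLocallyConst.exists₂ f ha hb x hx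
    exact ⟨W, hW, V, e, s + s', hxW, by rw [map_add, map_add, h, h']⟩
  one_mem' := by simpa using isLocallyConst_appLE f (U := U) (V := ⊤) le_top 1
  zero_mem' := by simpa using isLocallyConst_appLE f (U := U) (V := ⊤) le_top 0
  neg_mem' {a} ha x hx := by
    obtain ⟨W, hW, V, e, s, hxW, h⟩ := ha x hx
    exact ⟨W, hW, V, e, -s, hxW, by rw [map_neg, map_neg, h]⟩

/-- The presheaf `U ↦ constSubring U`. -/
noncomputable def constPresheaf : (TopologicalSpace.Opens X)ᵒᵖ ⥤ RingCat.{u} where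
  obj U := RingCat.of (constSubring f U.unop)
  map {U V} i := RingCat.ofHom
    ((res i.unop.le).restrict (constSubring f U.unop) (constSubring f V.unop)
      fun _ ha => ha.res f i.unop.le)
  map_id U := by
    refine RingCat.hom_ext (RingHom.ext fun a => ?_)
    exact Subtype.ext (res_rfl (U := U.unop) a.1)
  map_comp i j := by
    refine RingCat.hom_ext (RingHom.ext fun a => ?_)
    exact Subtype.ext (res_res i.unop.le j.unop.le a.1).symm

/-- The sheaf of rings `f⁻¹ O_S`, realized for flat `f` as the subsheaf of `O_X` of sections that
are locally inverse images of sections of `O_S`. -/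
noncomputable def constSheaf : Sheaf (Opens.grothendieckTopology X) RingCat.{u} where
  obj := constPresheaf f
  property := by
    have : TopCat.Presheaf.IsSheaf (X := X.carrier) (constPresheaf f) := by
      rw [TopCat.Presheaf.isSheaf_iff_isSheafUniqueGluing]
      intro ι U sf hsf
      obtain ⟨s, hs, hs'⟩ := X.sheaf.existsUnique_gluing U (fun i => (sf i).1)
        (fun i j => congrArg Subtype.val (hsf i j))
      refine ⟨⟨s, ?_⟩, fun i => Subtype.ext (hs i), fun s' h => Subtype.ext
        (hs' _ fun i => congrArg Subtype.val (h i))⟩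
      intro x hx
      obtain ⟨i, hi⟩ := TopologicalSpace.Opens.mem_iSup.1 hx
      obtain ⟨W, hW, V, e, r, hxW, hr⟩ := (sf i).2 x hi
      refine ⟨W, hW.trans (le_iSup U i), V, e, r, hxW, ?_⟩
      rw [← hr]
      exact (res_res (le_iSup U i) hW s).symm.trans (congrArg (res hW) (hs i))
    exact this

end Const

open TopologicalSpace

section SheafHom
variable {X : Type u} [TopologicalSpace X] {D : Sheaf (Opens.grothendieckTopology X) RingCat.{u}}

/-- Sections of a sheaf of modules. -/
abbrev Sec (M : SheafOfModules.{u} D) (U : Opens X) : Type u := M.val.presheaf.obj (op U)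

/-- Restriction of sections of a sheaf of rings. -/
noncomputable def ringRes (D : Sheaf (Opens.grothendieckTopology X) RingCat.{u}) {U V : Opens X} (h : V ≤ U) :
    D.obj.obj (op U) →+* D.obj.obj (op V) :=
  (D.obj.map (homOfLE h).op).hom

theorem ringRes_ringRes {U V W : Opens X} (h : V ≤ U) (h' : W ≤ V) (P : D.obj.obj (op U)) :
    ringRes D h' (ringRes D h P) = ringRes D (h'.trans h) P := by
  have : (homOfLE (h'.trans h)).op = (homOfLE h).op ≫ (homOfLE h').op := rfl
  rw [ringRes, ringRes, ringRes, this, D.obj.map_comp]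
  rfl

/-- Restriction of sections of a sheaf of modules. -/
noncomputable def secRes (M : SheafOfModules.{u} D) {U V : Opens X} (h : V ≤ U) : Sec M U →+ Sec M V :=
  (M.val.presheaf.map (homOfLE h).op).hom

theorem secRes_smul (M : SheafOfModules.{u} D) {U V : Opens X} (h : V ≤ U) (P : D.obj.obj (op U))
    (x : Sec M U) : secRes M h (P • x) = ringRes D h P • secRes M h x :=
  M.val.map_smul (homOfLE h).op P x

theorem secRes_secRes (M : SheafOfModules.{u} D) {U V W : Opens X} (h : V ≤ U) (h' : W ≤ V)
    (x : Sec M U) : secRes M h' (secRes M h x) = secRes M (h'.trans h) x := by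
  have : (homOfLE (h'.trans h)).op = (homOfLE h).op ≫ (homOfLE h').op := rfl
  rw [secRes, secRes, secRes, this, M.val.presheaf.map_comp]
  rfl

theorem secRes_rfl (M : SheafOfModules.{u} D) {U : Opens X} (x : Sec M U) :
    secRes M le_rfl x = x := by
  have : (homOfLE (le_refl U)).op = 𝟙 _ := rfl
  rw [secRes, this, M.val.presheaf.map_id]
  rfl

theorem sec_ext (M : SheafOfModules.{u} D) {ι : Type u} {V : Opens X} (U : ι → Opens X)
    (hU : V ≤ iSup U) {x y : Sec M V}
    (h : ∀ i, secRes M (inf_le_left : V ⊓ U i ≤ V) x = secRes M inf_le_left y) : x = y :=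
  TopCat.Sheaf.eq_of_locally_eq' (X := TopCat.of X) ⟨M.val.presheaf, M.isSheaf⟩
    (fun i => V ⊓ U i) V (fun i => homOfLE inf_le_left) (by rw [← inf_iSup_eq]; exact le_inf le_rfl hU) x y h

theorem sec_glue (M : SheafOfModules.{u} D) {ι : Type u} {V : Opens X} (U : ι → Opens X)
    (hU : V ≤ iSup U) (s : ∀ i, Sec M (V ⊓ U i))
    (hs : ∀ i j, secRes M (inf_le_left : (V ⊓ U i) ⊓ (V ⊓ U j) ≤ V ⊓ U i) (s i) =
      secRes M inf_le_right (s j)) :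
    ∃ x : Sec M V, ∀ i, secRes M inf_le_left x = s i :=
  (TopCat.Sheaf.existsUnique_gluing' (X := TopCat.of X) ⟨M.val.presheaf, M.isSheaf⟩
    (fun i => V ⊓ U i) V (fun i => homOfLE inf_le_left) (by rw [← inf_iSup_eq]; exact le_inf le_rfl hU) s hs).exists

variable (M N : SheafOfModules.{u} D)

/-- The group of `D|_U`-linear maps `M|_U → N|_U`: families of `D(V)`-linear maps `M(V) → N(V)` for
`V ⊆ U` that are compatible with restriction. -/
def homOn (U : Opens X) : AddSubgroup (∀ V : { V : Opens X // V ≤ U }, Sec M V.1 →+ Sec N V.1) where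
  carrier := {φ | (∀ V (P : D.obj.obj (op V.1)) x, φ V (P • x) = P • φ V x) ∧
    ∀ V W (h : W.1 ≤ V.1) x, φ W (secRes M h x) = secRes N h (φ V x)}
  add_mem' {φ ψ} hφ hψ := ⟨fun V P x => by
      change φ V (P • x) + ψ V (P • x) = P • (φ V x + ψ V x)
      rw [hφ.1, hψ.1, smul_add], fun V W h x => by
      change φ W (secRes M h x) + ψ W (secRes M h x) = secRes N h (φ V x + ψ V x)
      rw [hφ.2 V W h, hψ.2 V W h, map_add]⟩
  zero_mem' := ⟨fun V P x => (smul_zero P).symm, fun V W h x => (map_zero (secRes N h)).symm⟩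
  neg_mem' {φ} hφ := ⟨fun V P x => by
      change -φ V (P • x) = P • -φ V x
      rw [hφ.1, smul_neg], fun V W h x => by
      change -φ W (secRes M h x) = secRes N h (-φ V x)
      rw [hφ.2 V W h, map_neg]⟩

variable {M N}

theorem homOn_ext {U : Opens X} {φ ψ : homOn M N U} (h : ∀ V x, φ.1 V x = ψ.1 V x) : φ = ψ :=
  Subtype.ext (funext fun V => AddMonoidHom.ext (h V))

variable (M N)

/-- Restriction of linear maps. -/
noncomputable def homOnRes {U U' : Opens X} (h : U' ≤ U) : homOn M N U →+ homOn M N U' where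
  toFun φ := ⟨fun V => φ.1 ⟨V.1, V.2.trans h⟩, fun V => φ.2.1 ⟨V.1, V.2.trans h⟩,
    fun V W h' => φ.2.2 ⟨V.1, V.2.trans h⟩ ⟨W.1, W.2.trans h⟩ h'⟩
  map_zero' := rfl
  map_add' _ _ := rfl

/-- The presheaf of abelian groups `U ↦ homOn M N U`. -/
noncomputable def homPresheaf : (Opens X)ᵒᵖ ⥤ AddCommGrpCat.{u} where
  obj U := AddCommGrpCat.of (homOn M N U.unop)
  map i := AddCommGrpCat.ofHom (homOnRes M N i.unop.le)
  map_id _ := rfl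
  map_comp _ _ := rfl

theorem homPresheaf_isSheaf :
    Presheaf.IsSheaf (Opens.grothendieckTopology X) (homPresheaf M N) := by
  have : TopCat.Presheaf.IsSheaf (X := TopCat.of X) (homPresheaf M N) := by
    rw [TopCat.Presheaf.isSheaf_iff_isSheafUniqueGluing]
    intro ι U sf hsf
    have key : ∀ (i j : ι) (W : Opens X) (hi : W ≤ U i) (hj : W ≤ U j) (x : Sec M W),
        (sf i).1 ⟨W, hi⟩ x = (sf j).1 ⟨W, hj⟩ x := fun i j W hi hj x =>
      congr($(hsf i j).1 ⟨W, le_inf hi hj⟩ x)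
    have ex : ∀ (V : { V : Opens X // V ≤ iSup U }) (x : Sec M V.1), ∃ y : Sec N V.1, ∀ i,
        secRes N (inf_le_left : V.1 ⊓ U i ≤ V.1) y =
          (sf i).1 ⟨V.1 ⊓ U i, inf_le_right⟩ (secRes M inf_le_left x) := by
      intro V x
      refine sec_glue N U V.2 _ fun i j => ?_
      rw [← (sf i).2.2 ⟨V.1 ⊓ U i, inf_le_right⟩ ⟨_, inf_le_left.trans inf_le_right⟩ inf_le_left,
        ← (sf j).2.2 ⟨V.1 ⊓ U j, inf_le_right⟩ ⟨_, inf_le_right.trans inf_le_right⟩ inf_le_right,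
        secRes_secRes, secRes_secRes]
      exact key i j _ _ _ _
    choose g hg using ex
    have hg' : ∀ (V : { V : Opens X // V ≤ iSup U }) (x : Sec M V.1) (y : Sec N V.1),
        (∀ i, secRes N (inf_le_left : V.1 ⊓ U i ≤ V.1) y =
          (sf i).1 ⟨V.1 ⊓ U i, inf_le_right⟩ (secRes M inf_le_left x)) → g V x = y :=
      fun V x y h => sec_ext N U V.2 fun i => (hg V x i).trans (h i).symm
    refine ⟨⟨fun V => AddMonoidHom.mk' (g V) fun x y => hg' V _ _ fun i => ?_, ?_, ?_⟩, ?_, ?_⟩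
    · rw [map_add, map_add, map_add, hg, hg]
    · intro V P x
      refine hg' V _ _ fun i => ?_
      rw [secRes_smul, secRes_smul]
      exact ((congrArg _ (hg V x i))).trans ((sf i).2.1 ⟨V.1 ⊓ U i, inf_le_right⟩ _ _).symm
    · intro V W h x
      refine hg' W _ _ fun i => ?_
      have h1 := congrArg (secRes N (inf_le_inf_right _ h : W.1 ⊓ U i ≤ V.1 ⊓ U i)) (hg V x i)
      rw [secRes_secRes, ← (sf i).2.2 ⟨V.1 ⊓ U i, inf_le_right⟩ ⟨W.1 ⊓ U i, inf_le_right⟩,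
        secRes_secRes] at h1
      rw [secRes_secRes, secRes_secRes]
      exact h1
    · intro i
      refine homOn_ext fun V x => hg' ⟨V.1, V.2.trans (le_iSup U i)⟩ _ _ fun j => ?_
      rw [← (sf i).2.2 V ⟨V.1 ⊓ U j, inf_le_left.trans V.2⟩]
      exact key i j _ _ _ _
    · intro φ hφ
      refine homOn_ext fun V x => (hg' V _ _ fun i => ?_).symm
      rw [← φ.2.2 V ⟨V.1 ⊓ U i, inf_le_left.trans V.2⟩]
      exact congr($(hφ i).1 ⟨V.1 ⊓ U i, inf_le_right⟩ _)
  exact this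

variable {K : Sheaf (Opens.grothendieckTopology X) RingCat.{u}} (c : K ⟶ D)

/-- The image of the homomorphism of sheaves of rings `c` is in the centre. -/
def IsCentral : Prop :=
  ∀ (U : Opens X) (a : K.obj.obj (op U)) (P : D.obj.obj (op U)),
    Commute ((c.hom.app (op U)).hom a) P

variable {c} (hc : IsCentral c)

theorem ringRes_app (c : K ⟶ D) {U V : Opens X} (h : V ≤ U) (a : K.obj.obj (op U)) :
    (c.hom.app (op V)).hom (ringRes K h a) = ringRes D h ((c.hom.app (op U)).hom a) :=
  ConcreteCategory.congr_hom (c.hom.naturality (homOfLE h).op) a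

/-- The module structure on `homOn M N U` by means of a central homomorphism `K → D`. -/
@[reducible]
noncomputable def homOnModule (U : Opens X) : Module (K.obj.obj (op U)) (homOn M N U) where
  smul a φ := ⟨fun V => (DistribSMul.toAddMonoidHom (Sec N V.1)
      ((c.hom.app (op V.1)).hom (ringRes K V.2 a))).comp (φ.1 V), fun V P x => by
      change (c.hom.app (op V.1)).hom (ringRes K V.2 a) • φ.1 V (P • x) =
        P • (c.hom.app (op V.1)).hom (ringRes K V.2 a) • φ.1 V x
      rw [φ.2.1, smul_smul, smul_smul, (hc _ _ _).eq], fun V W h x => by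
      change (c.hom.app (op W.1)).hom (ringRes K W.2 a) • φ.1 W (secRes M h x) =
        secRes N h ((c.hom.app (op V.1)).hom (ringRes K V.2 a) • φ.1 V x)
      rw [φ.2.2 V W h, secRes_smul, ← ringRes_app, ringRes_ringRes]⟩
  one_smul φ := homOn_ext fun V x => by
    change (c.hom.app (op V.1)).hom (ringRes K V.2 1) • φ.1 V x = φ.1 V x
    rw [map_one, map_one, one_smul]
  mul_smul a b φ := homOn_ext fun V x => by
    change (c.hom.app (op V.1)).hom (ringRes K V.2 (a * b)) • φ.1 V x =
      (c.hom.app (op V.1)).hom (ringRes K V.2 a) • (c.hom.app (op V.1)).hom (ringRes K V.2 b) •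
        φ.1 V x
    rw [map_mul, map_mul, mul_smul]
  smul_zero a := homOn_ext fun V x => smul_zero _
  smul_add a φ ψ := homOn_ext fun V x => smul_add _ _ _
  add_smul a b φ := homOn_ext fun V x => by
    change (c.hom.app (op V.1)).hom (ringRes K V.2 (a + b)) • φ.1 V x =
      (c.hom.app (op V.1)).hom (ringRes K V.2 a) • φ.1 V x +
        (c.hom.app (op V.1)).hom (ringRes K V.2 b) • φ.1 V x
    rw [map_add, map_add, add_smul]
  zero_smul φ := homOn_ext fun V x => by
    change (c.hom.app (op V.1)).hom (ringRes K V.2 0) • φ.1 V x = 0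
    rw [map_zero, map_zero, zero_smul]

/-- The sheaf of modules `Hom_D(M, N)`. -/
noncomputable def sheafHom : SheafOfModules.{u} K where
  val :=
    letI (U : (Opens X)ᵒᵖ) : Module (K.obj.obj U) ((homPresheaf M N).obj U) :=
      homOnModule M N hc U.unop
    PresheafOfModules.ofPresheaf (homPresheaf M N) fun U W i a φ => by
      refine homOn_ext fun V x => ?_
      change (c.hom.app (op V.1)).hom (ringRes K (V.2.trans i.unop.le) a) •
          φ.1 ⟨V.1, V.2.trans i.unop.le⟩ x =
        (c.hom.app (op V.1)).hom (ringRes K V.2 (ringRes K i.unop.le a)) •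
          φ.1 ⟨V.1, V.2.trans i.unop.le⟩ x
      rw [ringRes_ringRes]
  isSheaf := homPresheaf_isSheaf M N

variable {M N} {M' N' : SheafOfModules.{u} D}

/-- The homomorphism of sections defined by a morphism of sheaves of modules. -/
noncomputable def homSec (g : M ⟶ M') (U : Opens X) : Sec M U →+ Sec M' U :=
  (((PresheafOfModules.toPresheaf D.obj).map g.val).app (op U)).hom

theorem homSec_smul (g : M ⟶ M') (U : Opens X) (P : D.obj.obj (op U)) (x : Sec M U) :
    homSec g U (P • x) = P • homSec g U x :=
  (g.val.app (op U)).hom.map_smul P x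

theorem homSec_secRes (g : M ⟶ M') {U V : Opens X} (h : V ≤ U) (x : Sec M U) :
    homSec g V (secRes M h x) = secRes M' h (homSec g U x) :=
  ConcreteCategory.congr_hom (((PresheafOfModules.toPresheaf D.obj).map g.val).naturality
    (homOfLE h).op) x

/-- Composition on both sides, on sections over `U`. -/
noncomputable def homOnMap (g : M' ⟶ M) (h : N ⟶ N') (U : Opens X) : homOn M N U →+ homOn M' N' U where
  toFun φ := ⟨fun V => (homSec h V.1).comp ((φ.1 V).comp (homSec g V.1)), fun V P x => by
      change homSec h V.1 (φ.1 V (homSec g V.1 (P • x))) = P • homSec h V.1 (φ.1 V (homSec g V.1 x))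
      rw [homSec_smul, φ.2.1, homSec_smul], fun V W e x => by
      change homSec h W.1 (φ.1 W (homSec g W.1 (secRes M' e x))) =
        secRes N' e (homSec h V.1 (φ.1 V (homSec g V.1 x)))
      rw [homSec_secRes, φ.2.2 V W e, homSec_secRes]⟩
  map_zero' := homOn_ext fun V x => map_zero (homSec h V.1)
  map_add' φ ψ := homOn_ext fun V x => map_add (homSec h V.1) _ _

/-- Functoriality of `Hom_D(M, N)` in both arguments. -/
noncomputable def sheafHomMap (g : M' ⟶ M) (h : N ⟶ N') :
    sheafHom M N hc ⟶ sheafHom M' N' hc where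
  val := PresheafOfModules.homMk
    { app := fun U => AddCommGrpCat.ofHom (homOnMap g h U.unop)
      naturality := fun _ _ _ => rfl } fun U a φ => by
    refine homOn_ext fun V x => ?_
    exact homSec_smul h V.1 _ _

/-- The functor `N ↦ Hom_D(M, N)`. -/
noncomputable def sheafHomFunctor (M : SheafOfModules.{u} D) :
    SheafOfModules.{u} D ⥤ SheafOfModules.{u} K where
  obj N := sheafHom M N hc
  map h := sheafHomMap hc (𝟙 M) h
  map_id _ := rfl
  map_comp _ _ := rfl

instance : (sheafHomFunctor hc M).Additive where
  map_add := rfl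

theorem sheafHomMap_comp {M₁ M₂ M₃ N : SheafOfModules.{u} D} (g : M₁ ⟶ M₂) (g' : M₂ ⟶ M₃) :
    sheafHomMap hc (g ≫ g') (𝟙 N) = sheafHomMap hc g' (𝟙 N) ≫ sheafHomMap hc g (𝟙 N) :=
  rfl

end SheafHom

section Koszul
variable {n : ℕ}

/-- The sign of `τ_j ∧ τ_s` in terms of `τ_{s ∪ {j}}`, i.e. `(-1)` to the number of elements of `s`
that are smaller than `j`. -/
def koszulSign (j : Fin n) (s : Finset (Fin n)) : ℤ := (-1) ^ (s.filter (· < j)).card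

/-- The `(s, s')` entry of the Koszul differential: `± x_j` if `s' = s ∪ {j}` with `j ∉ s`, and `0`
otherwise. -/
def koszulEntry {E : Type*} [Ring E] (x : Fin n → E) (s s' : Finset (Fin n)) : E :=
  ∑ j, if j ∉ s ∧ s' = insert j s then koszulSign j s • x j else 0

variable {E : Type*} [Ring E] (x : Fin n → E)

theorem koszulEntry_eq_zero {s s' : Finset (Fin n)} (h : s'.card ≠ s.card + 1) :
    koszulEntry x s s' = 0 :=
  Finset.sum_eq_zero fun j _ => if_neg fun hj => h (by
    rw [hj.2, Finset.card_insert_of_notMem hj.1])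

theorem koszulSign_mul {j k : Fin n} {s : Finset (Fin n)} (hj : j ∉ s) (h : j < k) :
    koszulSign j s * koszulSign k (insert j s) = -(koszulSign k s * koszulSign j (insert k s)) := by
  have h1 : (insert j s).filter (· < k) = insert j (s.filter (· < k)) := by
    rw [Finset.filter_insert, if_pos h]
  have h2 : (insert k s).filter (· < j) = s.filter (· < j) := by
    rw [Finset.filter_insert, if_neg h.not_gt]
  rw [koszulSign, koszulSign, koszulSign, koszulSign, h1, h2, Finset.card_insert_of_notMem
    (by simp [hj]), pow_succ]
  ring

theorem koszulEntry_mul (hx : ∀ i j, Commute (x i) (x j)) (s s'' : Finset (Fin n)) :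
    ∑ s', koszulEntry x s s' * koszulEntry x s' s'' = 0 := by
  have h1 : ∀ s', koszulEntry x s s' * koszulEntry x s' s'' = ∑ a : Fin n × Fin n,
      if s' = insert a.1 s then
        (if a.1 ∉ s ∧ a.2 ∉ insert a.1 s ∧ s'' = insert a.2 (insert a.1 s) then
          (koszulSign a.1 s * koszulSign a.2 (insert a.1 s)) • (x a.1 * x a.2) else 0) else 0 := by
    intro s'
    rw [koszulEntry, koszulEntry, Finset.sum_mul_sum, ← Finset.univ_product_univ, Finset.sum_product]
    refine Finset.sum_congr rfl fun j _ => Finset.sum_congr rfl fun k _ => ?_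
    by_cases h : s' = insert j s
    · subst h
      by_cases h1 : j ∈ s <;> by_cases h2 : k ∈ insert j s <;>
        by_cases h3 : s'' = insert k (insert j s) <;>
        simp_all [mul_smul, -zsmul_eq_mul]
      exact smul_comm _ _ _
    · simp [h]
  simp only [h1]
  rw [Finset.sum_comm]
  simp only [Finset.sum_ite_eq', Finset.mem_univ, if_true]
  refine Finset.sum_involution (fun a _ => (a.2, a.1)) ?_ ?_ (fun _ _ => Finset.mem_univ _)
    fun _ _ => rfl
  · rintro ⟨j, k⟩ -
    dsimp only
    by_cases hjk : j = k
    · subst hjk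
      simp
    by_cases hj : j ∈ s
    · simp [hj]
    by_cases hk : k ∈ s
    · simp [hk]
    rw [Finset.insert_comm k j s]
    by_cases h : s'' = insert j (insert k s)
    · have hs : koszulSign j s * koszulSign k (insert j s) =
          -(koszulSign k s * koszulSign j (insert k s)) := by
        rcases lt_or_gt_of_ne hjk with h | h
        · exact koszulSign_mul hj h
        · rw [koszulSign_mul hk h, neg_neg]
      simp [hj, hk, hjk, Ne.symm hjk, h, hs, (hx j k).eq]
    · simp [h]
  · rintro ⟨j, k⟩ - h1 h2
    have : k = j := congrArg Prod.fst h2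
    subst this
    simp at h1

theorem koszulEntry_commute (hx : ∀ i j, Commute (x i) (x j)) (s s' r r' : Finset (Fin n)) :
    Commute (koszulEntry x s s') (koszulEntry x r r') := by
  refine Commute.sum_left _ _ _ fun i _ => Commute.sum_right _ _ _ fun j _ => ?_
  split_ifs
  · exact ((hx i j).smul_right _).smul_left _
  all_goals simp

variable {C : Type*} [Category C] [Preadditive C]

/-- The subsets of `Fin n` with `r` elements; there are none for negative `r`. -/
abbrev Subsets (n : ℕ) (r : ℤ) : Type := { s : Finset (Fin n) // (s.card : ℤ) = r }

theorem sum_subsets {A : Type*} [AddCommMonoid A] (r : ℤ) (g : Finset (Fin n) → A)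
    (hg : ∀ s, g s ≠ 0 → (s.card : ℤ) = r) : ∑ s : Subsets n r, g s.1 = ∑ s, g s := by
  classical
  have h := Finset.sum_subtype (Finset.univ.filter fun s : Finset (Fin n) => (s.card : ℤ) = r)
    (p := fun s => (s.card : ℤ) = r) (F := inferInstance) (by simp) g
  rw [← h, Finset.sum_filter]
  exact Finset.sum_congr rfl fun s _ => by
    by_cases hs : g s = 0
    · simp [hs]
    · simp [hg s hs]

variable (M : C) (δ : Fin n → End M)

/-- The entries of the differentials of the Koszul complexes of `M`. -/
def koszulHom (s s' : Finset (Fin n)) : M ⟶ M := koszulEntry (E := End M) δ s s'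

theorem koszulHom_eq_zero {s s' : Finset (Fin n)} (h : s'.card ≠ s.card + 1) :
    koszulHom M δ s s' = 0 :=
  koszulEntry_eq_zero (E := End M) δ h

theorem koszulHom_comp (hδ : ∀ i j, Commute (δ i) (δ j)) (s s'' : Finset (Fin n)) :
    ∑ s', koszulHom M δ s' s'' ≫ koszulHom M δ s s' = 0 :=
  koszulEntry_mul (E := End M) δ hδ s s''

theorem koszulHom_comm (hδ : ∀ i j, Commute (δ i) (δ j)) (s s' r r' : Finset (Fin n)) :
    koszulHom M δ s s' ≫ koszulHom M δ r r' = koszulHom M δ r r' ≫ koszulHom M δ s s' :=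
  (koszulEntry_commute (E := End M) δ hδ r r' s s').eq

variable {M δ} in
theorem koszulHom_naturality {M' : C} {δ' : Fin n → End M'} (g : M ⟶ M')
    (hg : ∀ i, (show M ⟶ M from δ i) ≫ g = g ≫ (show M' ⟶ M' from δ' i)) (s s' : Finset (Fin n)) :
    koszulHom M δ s s' ≫ g = g ≫ koszulHom M' δ' s s' := by
  have h : ∀ (N : C) (ε : Fin n → End N), koszulHom N ε s s' =
      ∑ j, if j ∉ s ∧ s' = insert j s then koszulSign j s • (show N ⟶ N from ε j) else 0 :=
    fun _ _ => rfl
  rw [h, h, Preadditive.sum_comp, Preadditive.comp_sum]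
  refine Finset.sum_congr rfl fun j _ => ?_
  split_ifs
  · rw [Preadditive.zsmul_comp, Preadditive.comp_zsmul, hg]
  · rw [zero_comp, comp_zero]

variable [HasFiniteBiproducts C]

theorem matrix_comp_matrix {ι κ μ : Type} [Fintype ι] [Fintype κ] [Fintype μ] {M : C}
    (a : ι → κ → (M ⟶ M)) (b : κ → μ → (M ⟶ M)) (h : ∀ i k, ∑ j, a i j ≫ b j k = 0) :
    (biproduct.matrix a : (⨁ fun _ => M) ⟶ ⨁ fun _ => M) ≫
      (biproduct.matrix b : (⨁ fun _ => M) ⟶ ⨁ fun _ => M) = 0 := by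
  refine biproduct.hom_ext' _ _ fun s => biproduct.hom_ext _ _ fun s' => ?_
  rw [Category.assoc, Category.assoc, biproduct.matrix_π, biproduct.ι_matrix_assoc,
    biproduct.lift_desc, h, comp_zero, zero_comp]

theorem matrix_eq_zero {ι κ : Type} [Fintype ι] [Fintype κ] {M : C}
    (a : ι → κ → (M ⟶ M)) (h : ∀ i k, a i k = 0) :
    (biproduct.matrix a : (⨁ fun _ => M) ⟶ ⨁ fun _ => M) = 0 := by
  refine biproduct.hom_ext' _ _ fun s => biproduct.hom_ext _ _ fun s' => ?_
  rw [Category.assoc, biproduct.matrix_π, biproduct.ι_desc, comp_zero, zero_comp, h]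

/-- The cohomological Koszul complex of commuting endomorphisms `δ_1, …, δ_n` of `M`. In degree `r`
it is `⨁_{|s| = r} M τ_s`, and `d(x τ_s) = ∑_j δ_j(x) τ_j ∧ τ_s`. -/
noncomputable def koszulComplex (hδ : ∀ i j, Commute (δ i) (δ j)) : CochainComplex C ℤ where
  X r := ⨁ fun _ : Subsets n r => M
  d r r' := biproduct.matrix fun s s' => koszulHom M δ s.1 s'.1
  shape r r' h := matrix_eq_zero _ fun s s' => koszulHom_eq_zero M δ fun h' => h (by
    rw [ComplexShape.up_Rel, ← s.2, ← s'.2, h']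
    simp)
  d_comp_d' := by
    rintro r r' r'' h -
    refine matrix_comp_matrix _ _ fun s s'' => ?_
    refine (sum_subsets r' (fun s' => koszulHom M δ s.1 s' ≫ koszulHom M δ s' s''.1) ?_).trans ?_
    · intro s' hs'
      by_contra hc
      refine hs' ?_
      rw [koszulHom_eq_zero M δ (s := s.1), zero_comp]
      intro h'
      rw [ComplexShape.up_Rel] at h
      have := s.2
      omega
    · simp only [koszulHom_comm M δ hδ s.1]
      exact koszulHom_comp M δ hδ _ _

/-- The homological Koszul complex of commuting endomorphisms `δ_1, …, δ_n` of `M`, placed in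
nonpositive degrees. In degree `-r` it is `⨁_{|s| = r} M τ_s^∨`, and the matrix of the differential
is the transpose of that of the cohomological Koszul complex. -/
noncomputable def koszulChainComplex (hδ : ∀ i j, Commute (δ i) (δ j)) : CochainComplex C ℤ where
  X r := ⨁ fun _ : Subsets n (-r) => M
  d r r' := biproduct.matrix fun s s' => koszulHom M δ s'.1 s.1
  shape r r' h := matrix_eq_zero _ fun s s' => koszulHom_eq_zero M δ fun h' => h (by
    have h1 := s.2
    have h2 := s'.2
    rw [ComplexShape.up_Rel]
    omega)
  d_comp_d' := by
    rintro r r' r'' h -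
    refine matrix_comp_matrix _ _ fun s s'' => ?_
    refine (sum_subsets (-r') (fun s' => koszulHom M δ s' s.1 ≫ koszulHom M δ s''.1 s') ?_).trans ?_
    · intro s' hs'
      by_contra hc
      refine hs' ?_
      rw [koszulHom_eq_zero M δ (s' := s.1), zero_comp]
      intro h'
      rw [ComplexShape.up_Rel] at h
      have := s.2
      omega
    · exact koszulHom_comp M δ hδ _ _

variable {M δ}

/-- Functoriality of the cohomological Koszul complex. -/
noncomputable def koszulMap {M' : C} {δ' : Fin n → End M'} (hδ : ∀ i j, Commute (δ i) (δ j))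
    (hδ' : ∀ i j, Commute (δ' i) (δ' j)) (g : M ⟶ M')
    (hg : ∀ i, (show M ⟶ M from δ i) ≫ g = g ≫ (show M' ⟶ M' from δ' i)) :
    koszulComplex M δ hδ ⟶ koszulComplex M' δ' hδ' where
  f r := biproduct.map fun _ => g
  comm' r r' h := by
    refine (biproduct.map_matrix _ _).trans (Eq.trans ?_ (biproduct.matrix_map _ _).symm)
    congr 1
    funext s s'
    exact (koszulHom_naturality g hg _ _).symm

end Koszul

instance {X : Type u} [TopologicalSpace X] (D : Sheaf (Opens.grothendieckTopology X) RingCat.{u}) :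
    HasFiniteBiproducts (SheafOfModules.{u} D) :=
  Abelian.hasFiniteBiproducts

/-- The functor that sends an object to the direct sum of `N` copies of it. -/
noncomputable def copies {C : Type*} [Category C] [Preadditive C] [HasFiniteBiproducts C] (N : ℕ) :
    C ⥤ C where
  obj Y := ⨁ fun _ : Fin N => Y
  map g := biproduct.map fun _ => g

/-- The inclusion of the `i`-th copy. -/
noncomputable def copiesι {C : Type*} [Category C] [Preadditive C] [HasFiniteBiproducts C] (N : ℕ)
    (i : Fin N) (Y : C) : Y ⟶ (copies N).obj Y :=
  biproduct.ι (fun _ : Fin N => Y) i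

/-- The projection to the `i`-th copy. -/
noncomputable def copiesπ {C : Type*} [Category C] [Preadditive C] [HasFiniteBiproducts C] (N : ℕ)
    (i : Fin N) (Y : C) : (copies N).obj Y ⟶ Y :=
  biproduct.π (fun _ : Fin N => Y) i

instance {C : Type*} [Category C] [Abelian C] [HasDerivedCategory C] :
    HasFiniteBiproducts (DerivedCategory C) :=
  HasFiniteBiproducts.of_hasFiniteProducts

section MulEnd
variable {X : Type u} [TopologicalSpace X] {D K : Sheaf (Opens.grothendieckTopology X) RingCat.{u}}
  {c : K ⟶ D} (hc : IsCentral c)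

/-- The `K`-linear endomorphism of a `D`-module given by a global section `P` of `D`. -/
noncomputable def mulEnd (P : D.obj.obj (op ⊤)) (F : SheafOfModules.{u} D) :
    End ((SheafOfModules.restrictScalars c).obj F) where
  val := PresheafOfModules.homMk
    { app := fun U => AddCommGrpCat.ofHom (DistribSMul.toAddMonoidHom (Sec F U.unop)
        (ringRes D (le_top : U.unop ≤ ⊤) P))
      naturality := fun U V i => by
        refine AddCommGrpCat.hom_ext (AddMonoidHom.ext fun (x : Sec F U.unop) => ?_)
        change ringRes D (le_top : V.unop ≤ ⊤) P • secRes F i.unop.le x =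
          secRes F i.unop.le (ringRes D (le_top : U.unop ≤ ⊤) P • x)
        rw [secRes_smul, ringRes_ringRes] } fun U a (x : Sec F U.unop) => by
    change ringRes D (le_top : U.unop ≤ ⊤) P • (c.hom.app (op U.unop)).hom a • x =
      (c.hom.app (op U.unop)).hom a • ringRes D (le_top : U.unop ≤ ⊤) P • x
    rw [smul_smul, smul_smul, (hc _ _ _).eq]

theorem mulEnd_commute {P Q : D.obj.obj (op ⊤)} (h : Commute P Q) (F : SheafOfModules.{u} D) :
    Commute (mulEnd hc P F) (mulEnd hc Q F) := by
  refine SheafOfModules.hom_ext (PresheafOfModules.hom_ext fun U => ModuleCat.hom_ext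
    (LinearMap.ext fun (x : Sec F U.unop) => ?_))
  change ringRes D (le_top : U.unop ≤ ⊤) P • ringRes D (le_top : U.unop ≤ ⊤) Q • x =
    ringRes D (le_top : U.unop ≤ ⊤) Q • ringRes D (le_top : U.unop ≤ ⊤) P • x
  rw [smul_smul, smul_smul, ← map_mul, ← map_mul, h.eq]

theorem mulEnd_naturality (P : D.obj.obj (op ⊤)) {F G : SheafOfModules.{u} D} (g : F ⟶ G) :
    mulEnd hc P F ≫ (SheafOfModules.restrictScalars c).map g =
      (SheafOfModules.restrictScalars c).map g ≫ mulEnd hc P G := by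
  refine SheafOfModules.hom_ext (PresheafOfModules.hom_ext fun U => ModuleCat.hom_ext
    (LinearMap.ext fun (x : Sec F U.unop) => ?_))
  exact homSec_smul g _ _ _

/-- The `D`-linear endomorphism `Q ↦ Q P` of `D` given by a global section `P` of `D`. -/
noncomputable def rightMulEnd (P : D.obj.obj (op ⊤)) : End (SheafOfModules.unit D) where
  val := PresheafOfModules.homMk
    { app := fun U => AddCommGrpCat.ofHom (AddMonoidHom.mulRight
        (ringRes D (le_top : U.unop ≤ ⊤) P))
      naturality := fun U V i => by
        refine AddCommGrpCat.hom_ext (AddMonoidHom.ext fun (x : D.obj.obj (op U.unop)) => ?_)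
        change ringRes D i.unop.le x * ringRes D (le_top : V.unop ≤ ⊤) P =
          ringRes D i.unop.le (x * ringRes D (le_top : U.unop ≤ ⊤) P)
        rw [map_mul, ringRes_ringRes] } fun U (a x : D.obj.obj (op U.unop)) => mul_assoc a x _

theorem rightMulEnd_commute {P Q : D.obj.obj (op ⊤)} (h : Commute P Q) :
    Commute (rightMulEnd P) (rightMulEnd Q) := by
  refine SheafOfModules.hom_ext (PresheafOfModules.hom_ext fun U => ModuleCat.hom_ext
    (LinearMap.ext fun (x : D.obj.obj (op U.unop)) => ?_))
  change x * ringRes D (le_top : U.unop ≤ ⊤) Q * ringRes D (le_top : U.unop ≤ ⊤) P =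
    x * ringRes D (le_top : U.unop ≤ ⊤) P * ringRes D (le_top : U.unop ≤ ⊤) Q
  rw [mul_assoc, mul_assoc, ← map_mul, ← map_mul, h.eq]

theorem sheafHomMap_zero {M M' N : SheafOfModules.{u} D} :
    sheafHomMap hc (0 : M' ⟶ M) (𝟙 N) = 0 := by
  refine SheafOfModules.hom_ext (PresheafOfModules.hom_ext fun U => ModuleCat.hom_ext
    (LinearMap.ext fun (φ : homOn M N U.unop) => homOn_ext fun V x => ?_))
  exact map_zero (φ.1 V)

/-- The complex `Hom_D(L, F)`, with `Hom_D(L^{-r}, F)` in degree `r`. -/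
noncomputable def homComplex (L : CochainComplex (SheafOfModules.{u} D) ℤ)
    (F : SheafOfModules.{u} D) : CochainComplex (SheafOfModules.{u} K) ℤ where
  X r := sheafHom (L.X (-r)) F hc
  d r r' := sheafHomMap hc (L.d (-r') (-r)) (𝟙 F)
  shape r r' h := by
    rw [L.shape, sheafHomMap_zero]
    rw [ComplexShape.up_Rel] at h ⊢
    omega
  d_comp_d' r r' r'' _ _ := by
    rw [← sheafHomMap_comp, L.d_comp_d, sheafHomMap_zero]

/-- The functor `F ↦ Hom_D(L, F)`. -/
noncomputable def homComplexFunctor (L : CochainComplex (SheafOfModules.{u} D) ℤ) :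
    SheafOfModules.{u} D ⥤ CochainComplex (SheafOfModules.{u} K) ℤ where
  obj F := homComplex hc L F
  map g := { f := fun r => sheafHomMap hc (𝟙 (L.X (-r))) g }

end MulEnd

section Main
variable (p m : ℕ) {X S : Scheme.{u}} {f : X ⟶ S} {n : ℕ} {t : Fin n → Γ(X, ⊤)}
  (ht : IsCoordinates f t)

/-- The homomorphism `f⁻¹ O_S → D`. -/
noncomputable def constToDiff : constSheaf f ⟶ diffSheaf p m ht where
  hom := { app := fun U => RingCat.ofHom ((DiffRing.fn p m ht U.unop).comp
             (constSubring f U.unop).subtype)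
           naturality := fun U V i => by
             refine RingCat.hom_ext (RingHom.ext fun a => ?_)
             exact (DiffRing.res_fn p m ht i.unop.le a.1).symm } ≫ toDiffSheaf p m ht

theorem isCentral_constToDiff : IsCentral (constToDiff p m ht) := by
  intro U a P
  have key : ∀ x : U, ∃ (W : X.Opens) (hW : W ≤ U) (_ : x.1 ∈ W),
      Commute (ringRes (diffSheaf p m ht) hW (((constToDiff p m ht).hom.app (op U)).hom a))
        (ringRes (diffSheaf p m ht) hW P) := by
    rintro ⟨x, hx⟩
    obtain ⟨W₁, i, ⟨P₀, hP₀⟩, hx₁⟩ := Presheaf.imageSieve_mem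
      (Opens.grothendieckTopology X) (toDiffSheaf p m ht) P x hx
    obtain ⟨W₂, hW₂, V, e, s, hx₂, hs⟩ := a.2 x hx
    have hle : W₁ ⊓ W₂ ≤ W₁ := inf_le_left
    have e' : W₁ ⊓ W₂ ≤ f ⁻¹ᵁ V := inf_le_right.trans e
    refine ⟨W₁ ⊓ W₂, hle.trans i.le, ⟨hx₁, hx₂⟩, ?_⟩
    have h1 : ringRes (diffSheaf p m ht) (hle.trans i.le) P =
        ((toDiffSheaf p m ht).app (op (W₁ ⊓ W₂))).hom (DiffRing.res p m ht hle P₀) := by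
      rw [← ringRes_ringRes i.le hle]
      exact (congrArg (ringRes (diffSheaf p m ht) hle) hP₀).symm.trans
        (ConcreteCategory.congr_hom ((toDiffSheaf p m ht).naturality (homOfLE hle).op) P₀).symm
    have h2 : HigherDeRham.res (hle.trans i.le) a.1 = (f.appLE V (W₁ ⊓ W₂) e').hom s := by
      rw [← res_res hW₂ (inf_le_right : W₁ ⊓ W₂ ≤ W₂), hs]
      simp only [HigherDeRham.res, ← CommRingCat.comp_apply]
      rw [Scheme.Hom.appLE_map]
    have h3 : ringRes (diffSheaf p m ht) (hle.trans i.le)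
        (((constToDiff p m ht).hom.app (op U)).hom a) =
        ((toDiffSheaf p m ht).app (op (W₁ ⊓ W₂))).hom
          (DiffRing.fn p m ht _ ((f.appLE V (W₁ ⊓ W₂) e').hom s)) := by
      rw [← ringRes_app, ← h2]
      rfl
    rw [h1, h3]
    exact (DiffRing.commute_const p m ht e' s _).map _
  choose W hW hxW h using key
  refine TopCat.Sheaf.eq_of_locally_eq' (X := TopCat.of X) (diffSheaf p m ht) W U
    (fun x => homOfLE (hW x)) (fun x hx => TopologicalSpace.Opens.mem_iSup.2 ⟨⟨x, hx⟩, hxW _⟩) _ _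
    fun x => ?_
  have h' := (h x).eq
  rw [← map_mul, ← map_mul] at h'
  exact h'

/-- The global section `∂_j^{⟨p^m⟩}` of the sheaf of differential operators. -/
noncomputable def delTop (j : Fin n) : (diffSheaf p m ht).obj.obj (op ⊤) :=
  ((toDiffSheaf p m ht).app (op ⊤)).hom (DiffRing.del p m ht ⊤ j (p ^ m))

theorem delTop_commute (i j : Fin n) : Commute (delTop p m ht i) (delTop p m ht j) :=
  (show Commute _ _ from DiffRing.del_comm p m ht ⊤ i j (p ^ m) (p ^ m)).map
    ((toDiffSheaf p m ht).app (op ⊤)).hom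

/-- The functor that sends a module `F` over the ring of differential operators of level `m` to its
higher de Rham complex `F ⊗ Ω̂^{(m),•}`, a complex of `f⁻¹ O_S`-modules. As `Ω̂^{(m),r}` is free with
basis `τ_s = τ_{j_1} ∧ … ∧ τ_{j_r}`, `s = {j_1 < … < j_r}`, in degree `r` it is the
direct sum of the `F τ_s`, `|s| = r`, and
`d(x τ_s) = ∑_j ∂_j^{⟨p^m⟩}(x) τ_j ∧ τ_s`. -/
noncomputable def higherDeRham :
    SheafOfModules.{u} (diffSheaf p m ht) ⥤ CochainComplex (SheafOfModules.{u} (constSheaf f)) ℤ where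
  obj F := koszulComplex ((SheafOfModules.restrictScalars (constToDiff p m ht)).obj F)
    (fun j => mulEnd (isCentral_constToDiff p m ht) (delTop p m ht j) F)
    fun i j => mulEnd_commute _ (delTop_commute p m ht i j) F
  map g := koszulMap _ _ ((SheafOfModules.restrictScalars (constToDiff p m ht)).map g)
    fun i => mulEnd_naturality _ _ g
  map_id F := by
    ext1 r
    exact biproduct.hom_ext _ _ fun s => by simp [koszulMap, koszulComplex]
  map_comp g h := by
    ext1 r
    exact biproduct.hom_ext _ _ fun s => by simp [koszulMap, koszulComplex]

/-- The Spencer complex: the complex of free modules over the ring `D` of differential operators of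
level `m` which is `⨁_{|s| = r} D τ_s^∨` in degree `-r`, with differential
`d(P τ_s^∨) = ∑_{j ∈ s} ± P ∂_j^{⟨p^m⟩} τ_{s - j}^∨`. -/
noncomputable def spencer : CochainComplex (SheafOfModules.{u} (diffSheaf p m ht)) ℤ :=
  koszulChainComplex (SheafOfModules.unit (diffSheaf p m ht))
    (fun j => rightMulEnd (delTop p m ht j))
    fun i j => rightMulEnd_commute (delTop_commute p m ht i j)

variable [HasDerivedCategory.{w₁} (SheafOfModules.{u} (diffSheaf p m ht))]
  [HasDerivedCategory.{w₂} (SheafOfModules.{u} (constSheaf f))]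

/-- The functor `F ↦ RHom_D(M, F)`, for sheaves of modules `F` over the ring `D` of differential
operators of level `m`. -/
noncomputable def rhom (M : SheafOfModules.{u} (diffSheaf p m ht)) :
    SheafOfModules.{u} (diffSheaf p m ht) ⥤ DerivedCategory (SheafOfModules.{u} (constSheaf f)) :=
  DerivedCategory.Plus.singleFunctor _ 0 ⋙
    (sheafHomFunctor (isCentral_constToDiff p m ht) M).rightDerivedFunctorPlus ⋙
      DerivedCategory.Plus.ι

/-- The canonical morphism `Hom_D(M, F) ⟶ RHom_D(M, F)` in the derived category. -/
noncomputable def homToRHom (M F : SheafOfModules.{u} (diffSheaf p m ht)) :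
    DerivedCategory.Q.obj
      (((sheafHomFunctor (isCentral_constToDiff p m ht) M).mapHomologicalComplex
        (ComplexShape.up ℤ)).obj ((CochainComplex.singleFunctor _ 0).obj F)) ⟶
      (rhom p m ht M).obj F :=
  (DerivedCategory.quotientCompQhIso _).inv.app _ ≫ DerivedCategory.Plus.ι.map
    ((sheafHomFunctor (isCentral_constToDiff p m ht) M).rightDerivedFunctorPlusUnit.app
      ((HomotopyCategory.Plus.singleFunctor _ 0).obj F))

end Main

end HigherDeRham

open HigherDeRham

/-!
# The Spencer resolution and the higher de Rham complex

Write `D` for the sheaf of differential operators of level `m` and `O` for the structure sheaf.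

**The Spencer complex is a resolution.** As `p` is nilpotent, rational numbers whose denominator is
prime to `p` act on all sections (`ratCast`). The relations of `D` therefore define its regular
representation on finite families of coefficients (`coeffRep`), and locally `D` is free over `O` on
the products `∂^{⟨k⟩}` (`ofCoeff_toCoeff`, `toCoeff_ofCoeff`). In the relation
`∂_j^{⟨k⟩} ∂_j^{⟨p^m⟩} = ⟨k+p^m; k⟩ ∂_j^{⟨k+p^m⟩}`
the coefficient is a unit at `p`, because adding `p^m` to `k` causes no carries in
the lowest `m` digits (`not_dvd_den_inv_angle`). So right multiplication by `∂_j^{⟨p^m⟩}` has a left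
inverse `divDel`, which is not `D`-linear, but is additive, compatible with restriction, and
commutes with right multiplication by the other `∂_i^{⟨p^m⟩}`. These left inverses contract the
Koszul complex, as a complex of sheaves of abelian groups, onto the operators of order `< p^m` in
each variable (`exists_homotopyEquiv_of_contraction`). Finally, `P ↦ (P(t^i))_i`, `0 ≤ i_j < p^m`,
is a `D`-linear map from `D` to the sum of `p^{mn}` copies of `O`. It kills the left ideal generated
by the `∂_j^{⟨p^m⟩}`, and on operators of order `< p^m` in each variable it is given by the matrix
of the binomial expansions of `(t + T)^i`, whose inverse belongs to the opposite shift
(`monomialMatrix_mul_neg`). The result is `quasiIso_spencerAugmentation`. Quasi-isomorphisms may be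
tested on sheaves of abelian groups, since forgetting the module structure is exact.

**The higher de Rham complex is `Hom_D(Sp, F)`.** This is `Hom_D(D, F) = F` (`evalOne`), together
with the fact that dualizing transposes the matrices of the Koszul differentials (`homSpencerIso`).

**The comparison with the derived functor.** The derived functor is computed by injective
resolutions of `F`, so a resolution of the first argument has to be compared with one of the second.
Let `G` be the functor `Hom_D(Sp, -)` and `M` the functor `Hom_D(O^N, -)`, where `N = p^{mn}`. The
terms of `G` are sums of copies of the identity, hence exact (`homComplex_spencer_exact`), and for
injective `J` the functor `Hom_D(-, J)` is exact, so that `G(J)` is a resolution of `M(J)`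
(`sheafHom_exact_of_injective`, `isAdaptedAugmentation_homAugmentation`). For an injective
resolution `I` of `F`, both `G(F)` and the complex `M(I)` are therefore quasi-isomorphic to the
total complex of `G(I)` (`quasiIso_rowAugmentation`, `quasiIso_columnAugmentation`), and `M(I)` is
the sum of `N` copies of `Hom_D(O, I)`, which computes the derived functor. This gives the
isomorphism `comparisonNatIso`. On `Hom_D(O, F)`, placed in degree `0`, both ways into the total
complex agree (`comp_resolutionRow`), which gives the description of the isomorphism in
`map_comp_comparisonNatIso`.
-/

namespace HigherDeRham

open TopologicalSpace

/-! ### Rational numbers whose denominator is prime to `p` -/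

section PadicCast
variable {p : ℕ} [Fact p.Prime]

/-- The image in `A` of a rational number: numerator times the inverse of the denominator. It is
meaningful if the denominator is invertible in `A`, and is a junk value otherwise. -/
noncomputable def ratCast (A : Type*) [CommRing A] (q : ℚ) : A := q.num * Ring.inverse (q.den : A)

variable {A B : Type*} [CommRing A] [CommRing B]

theorem isUnit_natCast_of_isNilpotent (hA : IsNilpotent (p : A)) {d : ℕ} (hd : ¬ p ∣ d) :
    IsUnit (d : A) := by
  obtain ⟨N, hN⟩ := hA
  have h : IsCoprime ((d : ℤ)) ((p : ℤ) ^ N) :=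
    (Nat.isCoprime_iff_coprime.2
      ((Nat.Prime.coprime_iff_not_dvd Fact.out).2 hd).symm).pow_right
  obtain ⟨a, b, hab⟩ := h
  have := congrArg (Int.cast : ℤ → A) hab
  push_cast at this
  rw [hN, mul_zero, add_zero] at this
  exact IsUnit.of_mul_eq_one (a : A) (by rw [mul_comm]; exact this)

theorem ratCast_mul_den (hA : IsNilpotent (p : A)) {q : ℚ} (hq : ¬ p ∣ q.den) :
    ratCast A q * (q.den : A) = q.num := by
  rw [ratCast, mul_assoc, Ring.inverse_mul_cancel _ (isUnit_natCast_of_isNilpotent hA hq), mul_one]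

/-- `ratCast A q` is characterized by the equations `ratCast A q * d = a` for all fractions
`q = a / d`. -/
theorem ratCast_mul (hA : IsNilpotent (p : A)) {q : ℚ} (hq : ¬ p ∣ q.den) {a : ℤ} {d : ℕ}
    (h : q * d = a) : ratCast A q * d = a := by
  have h1 : (q.num * d : ℤ) = a * q.den := by
    have : (q.num : ℚ) = q * q.den := (Rat.mul_den_eq_num q).symm
    have h2 : (q.num * d : ℚ) = a * q.den := by rw [this, ← h]; ring
    exact_mod_cast h2
  have hu := isUnit_natCast_of_isNilpotent hA hq
  refine hu.mul_right_cancel ?_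
  have h3 := congrArg (Int.cast : ℤ → A) h1
  push_cast at h3
  rw [mul_right_comm, ratCast_mul_den hA hq, h3]

theorem ratCast_unique (hA : IsNilpotent (p : A)) {q : ℚ} (hq : ¬ p ∣ q.den) {x : A}
    (h : x * (q.den : A) = q.num) : ratCast A q = x :=
  (isUnit_natCast_of_isNilpotent hA hq).mul_right_cancel ((ratCast_mul_den hA hq).trans h.symm)

theorem ratCast_natCast (k : ℕ) : ratCast A (k : ℚ) = k := by
  simp [ratCast]

theorem not_dvd_den_mul {q r : ℚ} (hq : ¬ p ∣ q.den) (hr : ¬ p ∣ r.den) : ¬ p ∣ (q * r).den :=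
  fun h => by
    rcases (Nat.Prime.dvd_mul Fact.out).1 (h.trans (Rat.mul_den_dvd q r)) with h | h
    exacts [hq h, hr h]

theorem not_dvd_den_add {q r : ℚ} (hq : ¬ p ∣ q.den) (hr : ¬ p ∣ r.den) : ¬ p ∣ (q + r).den :=
  fun h => by
    rcases (Nat.Prime.dvd_mul Fact.out).1 (h.trans (Rat.add_den_dvd q r)) with h | h
    exacts [hq h, hr h]

theorem not_dvd_den_natCast (k : ℕ) : ¬ p ∣ (k : ℚ).den := by
  simpa using (Fact.out : p.Prime).ne_one

theorem ratCast_mul_ratCast (hA : IsNilpotent (p : A)) {q r : ℚ} (hq : ¬ p ∣ q.den)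
    (hr : ¬ p ∣ r.den) : ratCast A (q * r) = ratCast A q * ratCast A r := by
  have hu := (isUnit_natCast_of_isNilpotent hA hq).mul (isUnit_natCast_of_isNilpotent hA hr)
  refine hu.mul_right_cancel ?_
  have h : ratCast A (q * r) * ((q.den * r.den : ℕ) : A) = ((q.num * r.num : ℤ) : A) := by
    refine ratCast_mul hA (not_dvd_den_mul hq hr) ?_
    push_cast
    rw [← Rat.mul_den_eq_num q, ← Rat.mul_den_eq_num r]
    ring
  push_cast at h
  rw [h, mul_mul_mul_comm, ratCast_mul_den hA hq, ratCast_mul_den hA hr]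

theorem ratCast_add (hA : IsNilpotent (p : A)) {q r : ℚ} (hq : ¬ p ∣ q.den)
    (hr : ¬ p ∣ r.den) : ratCast A (q + r) = ratCast A q + ratCast A r := by
  have hu := (isUnit_natCast_of_isNilpotent hA hq).mul (isUnit_natCast_of_isNilpotent hA hr)
  refine hu.mul_right_cancel ?_
  have h : ratCast A (q + r) * ((q.den * r.den : ℕ) : A) =
      ((q.num * r.den + r.num * q.den : ℤ) : A) := by
    refine ratCast_mul hA (not_dvd_den_add hq hr) ?_
    push_cast
    rw [← Rat.mul_den_eq_num q, ← Rat.mul_den_eq_num r]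
    ring
  push_cast at h
  rw [h, ← ratCast_mul_den hA hq, ← ratCast_mul_den hA hr]
  ring

theorem ratCast_sum (hA : IsNilpotent (p : A)) {ι : Type*} (s : Finset ι) (g : ι → ℚ)
    (hg : ∀ i ∈ s, ¬ p ∣ (g i).den) : ratCast A (∑ i ∈ s, g i) = ∑ i ∈ s, ratCast A (g i) := by
  classical
  have : ratCast A (∑ i ∈ s, g i) = ∑ i ∈ s, ratCast A (g i) ∧ ¬ p ∣ (∑ i ∈ s, g i).den := by
    induction s using Finset.induction_on with
    | empty =>
      simpa using ⟨(ratCast_natCast (A := A) 0).trans Nat.cast_zero, (Fact.out : p.Prime).ne_one⟩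
    | insert i s hi ih =>
      obtain ⟨h1, h2⟩ := ih fun j hj => hg j (Finset.mem_insert_of_mem hj)
      have h3 := hg i (Finset.mem_insert_self i s)
      rw [Finset.sum_insert hi, Finset.sum_insert hi, ratCast_add hA h3 h2, h1]
      exact ⟨rfl, not_dvd_den_add h3 h2⟩
  exact this.1

theorem map_ratCast (hA : IsNilpotent (p : A)) (g : A →+* B) {q : ℚ} (hq : ¬ p ∣ q.den) :
    g (ratCast A q) = ratCast B q := by
  have hB : IsNilpotent (p : B) := by simpa using hA.map g
  refine (ratCast_unique hB hq ?_).symm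
  simpa using congrArg g (ratCast_mul_den hA hq)

/-- Additive maps are linear over rational numbers whose denominator is prime to `p`. -/
theorem map_mul_ratCast (hA : IsNilpotent (p : A)) (g : A →+ A) {q : ℚ} (hq : ¬ p ∣ q.den) (a : A) :
    g (a * ratCast A q) = g a * ratCast A q := by
  refine (isUnit_natCast_of_isNilpotent hA hq).mul_right_cancel ?_
  have h := ratCast_mul_den (A := A) hA hq
  have h1 : g (a * ratCast A q) * (q.den : A) = g ((a * ratCast A q) * (q.den : A)) := by
    rw [mul_comm, ← nsmul_eq_mul, ← map_nsmul, nsmul_eq_mul, mul_comm]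
  rw [h1, mul_assoc, mul_assoc, h, mul_comm a, mul_comm (g a), ← zsmul_eq_mul, ← zsmul_eq_mul,
    map_zsmul]

end PadicCast

section Angle
variable (p m : ℕ)

theorem angle_pos (k l : ℕ) : 0 < angle p m k l := by
  have := Nat.choose_pos (Nat.le_add_right k l)
  rw [angle]
  positivity

theorem angle_mul_factorial (k l : ℕ) :
    angle p m k l * (k.factorial * l.factorial * (floorQuot p m (k + l)).factorial) =
      (k + l).factorial * (floorQuot p m k).factorial * (floorQuot p m l).factorial := by
  have h1 : ((floorQuot p m (k + l)).factorial : ℚ) ≠ 0 := by positivity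
  have h2 : ((k + l).factorial : ℚ) = (k + l).choose k * k.factorial * l.factorial := by
    have := Nat.add_choose_mul_factorial_mul_factorial l k
    rw [add_comm l k] at this
    rw [← this]
    push_cast
    ring
  rw [h2, angle]
  field_simp

theorem angle_zero_left (l : ℕ) : angle p m 0 l = 1 := by
  have h1 : ((floorQuot p m l).factorial : ℚ) ≠ 0 := by positivity
  rw [angle, zero_add, Nat.choose_zero_right, floorQuot, Nat.zero_div]
  simpa using div_self h1

theorem angle_comm (k l : ℕ) : angle p m k l = angle p m l k := by
  rw [angle, angle, add_comm l k, Nat.choose_symm_add]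
  ring

/-- The modified binomial coefficients satisfy the cocycle identity that expresses associativity of
`∂^{⟨a⟩} ∂^{⟨b⟩} ∂^{⟨c⟩}`. -/
theorem angle_mul_angle (a b c : ℕ) :
    angle p m b c * angle p m a (b + c) = angle p m a b * angle p m (a + b) c := by
  have h' : ∀ k l, angle p m k l =
      ((k + l).factorial * (floorQuot p m k).factorial * (floorQuot p m l).factorial : ℚ) /
      (k.factorial * l.factorial * (floorQuot p m (k + l)).factorial : ℚ) := by
    intro k l
    rw [eq_div_iff (by positivity)]
    exact angle_mul_factorial p m k l
  rw [h', h', h', h', add_assoc]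
  have h2 : ∀ x, ((Nat.factorial x : ℕ) : ℚ) ≠ 0 := fun x => by positivity
  have := h2 (a + b + c)
  field_simp [h2]

variable [Fact p.Prime]

/-- Legendre's formula: the terms `⌊k/pⁱ⌋` with `i > m` add up to the valuation of `q_k!`. The
number `b` is a bound beyond which they vanish. -/
theorem padicValNat_factorial_floorQuot (k b : ℕ) (hb : Nat.log p k < b) :
    padicValNat p k.factorial =
      padicValNat p (floorQuot p m k).factorial + ∑ i ∈ Finset.Ico 1 (m + 1), k / p ^ i := by
  have hp : p.Prime := Fact.out
  have h1 : padicValNat p k.factorial = ∑ i ∈ Finset.Ico 1 (m + b + 1), k / p ^ i :=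
    padicValNat_factorial (by omega)
  have h2 : padicValNat p (floorQuot p m k).factorial =
      ∑ i ∈ Finset.Ico 1 (b + 1), floorQuot p m k / p ^ i :=
    padicValNat_factorial (by
      have := Nat.log_mono_right (b := p) (Nat.div_le_self k (p ^ m))
      exact (this.trans_lt hb).trans (Nat.lt_succ_self b))
  -- The terms with `i ≤ m` are split off; `⌊q_k / pⁱ⌋ = ⌊k / p^{m+i}⌋` for the other ones.
  rw [h1, h2, add_comm (∑ i ∈ Finset.Ico 1 (b + 1), _),
    ← Finset.sum_Ico_consecutive _ (by omega : 1 ≤ m + 1) (by omega : m + 1 ≤ m + b + 1)]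
  congr 1
  rw [Finset.sum_Ico_eq_sum_range, Finset.sum_Ico_eq_sum_range,
    show m + b + 1 - (m + 1) = b + 1 - 1 by omega]
  refine Finset.sum_congr rfl fun i _ => ?_
  rw [floorQuot, Nat.div_div_eq_div_mul, ← pow_add]
  congr 2
  omega

/-- The `p`-adic valuation of `⟨k+l; k⟩` is the sum of the carries
`⌊(k+l)/pⁱ⌋ - ⌊k/pⁱ⌋ - ⌊l/pⁱ⌋` for `1 ≤ i ≤ m`. -/
theorem padicValRat_angle (k l : ℕ) :
    padicValRat p (angle p m k l) + (∑ i ∈ Finset.Ico 1 (m + 1), (k / p ^ i + l / p ^ i) : ℕ) =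
      (∑ i ∈ Finset.Ico 1 (m + 1), (k + l) / p ^ i : ℕ) := by
  have h : angle p m k l *
      ((k.factorial * l.factorial * (floorQuot p m (k + l)).factorial : ℕ) : ℚ) =
      (((k + l).factorial * (floorQuot p m k).factorial * (floorQuot p m l).factorial : ℕ) : ℚ) :=
    by
    exact_mod_cast angle_mul_factorial p m k l
  have h2 := congrArg (padicValRat p) h
  have ha := (angle_pos p m k l).ne'
  have hf : ∀ k : ℕ, k.factorial ≠ 0 := Nat.factorial_ne_zero
  rw [padicValRat.mul ha (by exact_mod_cast mul_ne_zero (mul_ne_zero (hf _) (hf _)) (hf _)),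
    padicValRat.of_nat, padicValRat.of_nat, padicValNat.mul (mul_ne_zero (hf _) (hf _)) (hf _),
    padicValNat.mul (hf _) (hf _), padicValNat.mul (mul_ne_zero (hf _) (hf _)) (hf _),
    padicValNat.mul (hf _) (hf _),
    padicValNat_factorial_floorQuot p m k _ (Nat.lt_succ_self _),
    padicValNat_factorial_floorQuot p m l _ (Nat.lt_succ_self _),
    padicValNat_factorial_floorQuot p m (k + l) _ (Nat.lt_succ_self _)] at h2
  rw [Finset.sum_add_distrib]
  push_cast at h2 ⊢
  linarith

theorem not_dvd_den_of_padicValRat {q : ℚ} (h : 0 ≤ padicValRat p q) : ¬ p ∣ q.den := by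
  intro hd
  have hp : p.Prime := Fact.out
  have h1 : padicValNat p q.den ≠ 0 := by
    have := one_le_padicValNat_of_dvd q.den_nz hd
    omega
  have h2 : padicValInt p q.num = 0 := by
    refine padicValInt.eq_zero_of_not_dvd fun h => hp.one_lt.ne' ?_
    have := Nat.dvd_gcd (Int.natCast_dvd.1 h) hd
    rwa [Nat.Coprime.gcd_eq_one q.reduced, Nat.dvd_one] at this
  rw [padicValRat_def, h2] at h
  omega

theorem not_dvd_den_angle (k l : ℕ) : ¬ p ∣ (angle p m k l).den := by
  refine not_dvd_den_of_padicValRat p ?_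
  have h := padicValRat_angle p m k l
  have : ∑ i ∈ Finset.Ico 1 (m + 1), (k / p ^ i + l / p ^ i) ≤
      ∑ i ∈ Finset.Ico 1 (m + 1), (k + l) / p ^ i :=
    Finset.sum_le_sum fun i _ => Nat.div_add_div_le_add_div
  omega

/-- Adding `p ^ m` causes no carries, so `⟨k+p^m; k⟩` is a unit at `p`. -/
theorem not_dvd_den_inv_angle (k : ℕ) : ¬ p ∣ (angle p m k (p ^ m))⁻¹.den := by
  refine not_dvd_den_of_padicValRat p ?_
  have h := padicValRat_angle p m k (p ^ m)
  have : ∑ i ∈ Finset.Ico 1 (m + 1), (k / p ^ i + p ^ m / p ^ i) =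
      ∑ i ∈ Finset.Ico 1 (m + 1), (k + p ^ m) / p ^ i := by
    refine Finset.sum_congr rfl fun i hi => ?_
    rw [Nat.add_div_of_dvd_left]
    exact pow_dvd_pow p (by simp at hi; omega)
  rw [this] at h
  rw [padicValRat.inv]
  omega

end Angle

/-! ### The basis `∂^{⟨k⟩}` of the ring of differential operators -/

section Basis
variable {p : ℕ} (m : ℕ) {X S : Scheme.{u}} {f : X ⟶ S} {n : ℕ} {t : Fin n → Γ(X, ⊤)}
  (ht : IsCoordinates f t)

theorem isNilpotent_sections (f : X ⟶ S) (hp : IsNilpotent (p : Γ(S, ⊤))) (U : X.Opens) :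
    IsNilpotent (p : Γ(X, U)) := by
  simpa using hp.map (f.appLE ⊤ U le_top).hom

/-- `hasse` as an additive map. -/
noncomputable def hasseHom (j : Fin n) (k : ℕ) (U : X.Opens) : Γ(X, U) →+ Γ(X, U) :=
  AddMonoidHom.mk' (hasse ht j k) (hasse_add ht j k)

variable (X n) in
/-- The free module over `Γ(X, U)` with basis `e_k`, `k ∈ ℕⁿ`. The basis element `e_k` stands for
`∂^{⟨k⟩} = ∏_j ∂_j^{⟨k_j⟩}`. -/
abbrev CoeffModule (U : X.Opens) : Type u := (Fin n → ℕ) →₀ Γ(X, U)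

variable (p)

/-- The coefficient `(q_k! / q_r!) ∂_j^{[i]}(a) ⟨l + r; r⟩` of `∂_j^{⟨l + r⟩}` in
`∂_j^{⟨k⟩} a ∂_j^{⟨l⟩}`, where `(i, r) = x` and `i + r = k`. -/
noncomputable def delCoeff (U : X.Opens) (j : Fin n) (k l : ℕ) (x : ℕ × ℕ) : Γ(X, U) →+ Γ(X, U) :=
  (AddMonoidHom.mulRight (ratCast _ (angle p m x.2 l))).comp
    (((floorQuot p m k).factorial / (floorQuot p m x.2).factorial) • hasseHom ht j x.1 U)

theorem delCoeff_apply (U : X.Opens) (j : Fin n) (k l : ℕ) (x : ℕ × ℕ) (a : Γ(X, U)) :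
    delCoeff p m ht U j k l x a = ((floorQuot p m k).factorial / (floorQuot p m x.2).factorial) •
      hasse ht j x.1 a * ratCast _ (angle p m x.2 l) := rfl

/-- Left multiplication by `∂_j^{⟨k⟩}`, on coefficients. -/
noncomputable def delCoeffHom (U : X.Opens) (j : Fin n) (k : ℕ) :
    CoeffModule X n U →+ CoeffModule X n U :=
  Finsupp.liftAddHom fun l => ∑ x ∈ Finset.HasAntidiagonal.antidiagonal k,
    (Finsupp.singleAddHom (l + Pi.single j x.2)).comp (delCoeff p m ht U j k (l j) x)

theorem delCoeffHom_single (U : X.Opens) (j : Fin n) (k : ℕ) (l : Fin n → ℕ) (a : Γ(X, U)) :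
    delCoeffHom p m ht U j k (Finsupp.single l a) =
      ∑ x ∈ Finset.HasAntidiagonal.antidiagonal k,
        Finsupp.single (l + Pi.single j x.2) (delCoeff p m ht U j k (l j) x a) := by
  rw [delCoeffHom, Finsupp.liftAddHom_apply_single, AddMonoidHom.finsetSum_apply]
  rfl

theorem floorQuot_factorial_dvd {k r : ℕ} (h : r ≤ k) :
    (floorQuot p m r).factorial ∣ (floorQuot p m k).factorial :=
  Nat.factorial_dvd_factorial (Nat.div_le_div_right h)

/-- The identity behind `∂^{⟨k⟩} ∂^{⟨l⟩} = ⟨k+l; k⟩ ∂^{⟨k+l⟩}`: after cancelling the factorials of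
the `q`'s, it is Vandermonde's identity for `(I + R).choose k`. The coefficient of `∂^{[I]}(a)
∂^{⟨R⟩}` is compared on both sides. -/
theorem sum_mul_choose_mul_choose (I R k l : ℕ) (hIR : I + R = k + l) :
    (∑ y ∈ Finset.HasAntidiagonal.antidiagonal k, if y.1 ≤ I ∧ y.2 ≤ R then
      ((((floorQuot p m k).factorial / (floorQuot p m y.2).factorial : ℕ) : ℚ) *
        ((floorQuot p m l).factorial / (floorQuot p m (R - y.2)).factorial : ℕ)) *
        (I.choose y.1 * angle p m y.2 (R - y.2)) else 0) =
      angle p m k l * ((floorQuot p m (k + l)).factorial / (floorQuot p m R).factorial : ℕ) := by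
  have hf : ∀ x, ((floorQuot p m x).factorial : ℚ) ≠ 0 := fun x => by positivity
  have h1 : angle p m k l * ((floorQuot p m (k + l)).factorial / (floorQuot p m R).factorial : ℕ) =
      (floorQuot p m k).factorial * (floorQuot p m l).factorial / (floorQuot p m R).factorial *
        (I + R).choose k := by
    rw [Nat.cast_div (floorQuot_factorial_dvd p m (by omega)) (hf _), angle, hIR]
    field_simp [hf]
  rw [h1, Nat.add_choose_eq, Nat.cast_sum, Finset.mul_sum]
  refine Finset.sum_congr rfl fun y hy => ?_
  rw [Finset.HasAntidiagonal.mem_antidiagonal] at hy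
  split_ifs with h
  · rw [Nat.cast_div (floorQuot_factorial_dvd p m (by omega)) (hf _),
      Nat.cast_div (floorQuot_factorial_dvd p m (by omega)) (hf _), angle, Nat.add_sub_cancel' h.2]
    field_simp [hf]
    push_cast
    ring
  · rcases not_and_or.1 h with h | h <;> simp [Nat.choose_eq_zero_of_lt (not_le.1 h)]

theorem delCoeffHom_zero (U : X.Opens) (j : Fin n) :
    delCoeffHom p m ht U j 0 = AddMonoidHom.id _ := by
  refine Finsupp.addHom_ext fun l a => ?_
  rw [delCoeffHom_single]
  have h1 : ratCast Γ(X, U) 1 = 1 := by exact_mod_cast ratCast_natCast (A := Γ(X, U)) 1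
  rw [Finset.HasAntidiagonal.antidiagonal_zero, Finset.sum_singleton, delCoeff_apply,
    hasse_zero_right, angle_zero_left, h1, mul_one, Nat.div_self (Nat.factorial_pos _), one_smul,
    Pi.single_zero, add_zero]
  rfl

/-- The Leibniz relation, on coefficients. -/
theorem delCoeffHom_smul (U : X.Opens) (j : Fin n) (k : ℕ) (a : Γ(X, U)) (v : CoeffModule X n U) :
    delCoeffHom p m ht U j k (a • v) = ∑ x ∈ Finset.HasAntidiagonal.antidiagonal k,
      (((floorQuot p m k).factorial / (floorQuot p m x.2).factorial) • hasse ht j x.1 a) •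
        delCoeffHom p m ht U j x.2 v := by
  induction v using Finsupp.induction_linear with
  | zero => simp
  | add v w hv hw => simp only [smul_add, map_add, hv, hw, Finset.sum_add_distrib]
  | single s b => ?_
  simp only [delCoeffHom_single, Finsupp.smul_single, Finset.smul_sum, smul_eq_mul]
  simp only [delCoeff_apply, hasse_mul, Finset.smul_sum, Finset.sum_mul, Finsupp.single_finsetSum]
  rw [Finset.sum_sigma', Finset.sum_sigma']
  -- The decompositions `k = (i₁ + i₂) + r` and `k = i₁ + (i₂ + r)` are matched.
  refine Finset.sum_bij' (fun x _ => ⟨(x.2.1, x.2.2 + x.1.2), (x.2.2, x.1.2)⟩)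
    (fun x _ => ⟨(x.1.1 + x.2.1, x.2.2), (x.1.1, x.2.1)⟩) ?_ ?_ ?_ ?_ ?_
  · rintro ⟨⟨a, b⟩, ⟨c, d⟩⟩ h
    simp only [Finset.mem_sigma, Finset.HasAntidiagonal.mem_antidiagonal] at h ⊢
    exact ⟨by omega, trivial⟩
  · rintro ⟨⟨a, b⟩, ⟨c, d⟩⟩ h
    simp only [Finset.mem_sigma, Finset.HasAntidiagonal.mem_antidiagonal] at h ⊢
    exact ⟨by omega, trivial⟩
  · rintro ⟨⟨a, b⟩, ⟨c, d⟩⟩ h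
    simp only [Finset.mem_sigma, Finset.HasAntidiagonal.mem_antidiagonal] at h ⊢
    rw [h.2]
  · rintro ⟨⟨a, b⟩, ⟨c, d⟩⟩ h
    simp only [Finset.mem_sigma, Finset.HasAntidiagonal.mem_antidiagonal] at h ⊢
    rw [h.2]
  · rintro ⟨⟨i, r⟩, ⟨i₁, i₂⟩⟩ h
    simp only [Finset.mem_sigma, Finset.HasAntidiagonal.mem_antidiagonal] at h ⊢
    congr 1
    have h1 := Nat.div_mul_div_comm (floorQuot_factorial_dvd p m (show i₂ + r ≤ k by omega))
      (floorQuot_factorial_dvd p m (show r ≤ i₂ + r by omega))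
    rw [mul_comm (floorQuot p m k).factorial, Nat.mul_div_mul_left _ _ (Nat.factorial_pos _)] at h1
    simp only [nsmul_eq_mul]
    rw [← h1]
    push_cast
    ring

variable [Fact p.Prime] {p}

theorem hasse_mul_ratCast (U : X.Opens) (hU : IsNilpotent (p : Γ(X, U))) (j : Fin n) (k : ℕ)
    (a : Γ(X, U)) {q : ℚ} (hq : ¬ p ∣ q.den) :
    hasse ht j k (a * ratCast _ q) = hasse ht j k a * ratCast _ q :=
  map_mul_ratCast hU (hasseHom ht j k U) hq a

/-- The commutation relation, on coefficients. -/
theorem delCoeffHom_comm (U : X.Opens) (hU : IsNilpotent (p : Γ(X, U))) (i j : Fin n) (k l : ℕ) :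
    (delCoeffHom p m ht U i k).comp (delCoeffHom p m ht U j l) =
      (delCoeffHom p m ht U j l).comp (delCoeffHom p m ht U i k) := by
  refine Finsupp.addHom_ext fun s a => ?_
  change delCoeffHom p m ht U i k (delCoeffHom p m ht U j l _) =
    delCoeffHom p m ht U j l (delCoeffHom p m ht U i k _)
  rw [delCoeffHom_single, delCoeffHom_single, map_sum, map_sum]
  simp only [delCoeffHom_single]
  rw [Finset.sum_comm]
  refine Finset.sum_congr rfl fun x _ => Finset.sum_congr rfl fun y _ => ?_
  rw [add_right_comm]
  congr 1
  simp only [delCoeff_apply]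
  rw [hasse_mul_ratCast ht U hU _ _ _ (not_dvd_den_angle p m _ _),
    hasse_mul_ratCast ht U hU _ _ _ (not_dvd_den_angle p m _ _), DiffRing.hasse_nsmul,
    DiffRing.hasse_nsmul, hasse_comm ht i j]
  have h : (ratCast Γ(X, U) (angle p m y.2 (s j)) * ratCast _ (angle p m x.2
        ((s + Pi.single j y.2 : Fin n → ℕ) i)) : Γ(X, U)) =
      ratCast _ (angle p m x.2 (s i)) * ratCast _ (angle p m y.2
        ((s + Pi.single i x.2 : Fin n → ℕ) j)) := by
    by_cases hij : i = j
    · subst hij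
      simp only [Pi.add_apply, Pi.single_eq_same]
      rw [← ratCast_mul_ratCast hU (not_dvd_den_angle p m _ _) (not_dvd_den_angle p m _ _),
        ← ratCast_mul_ratCast hU (not_dvd_den_angle p m _ _) (not_dvd_den_angle p m _ _),
        add_comm (s i), add_comm (s i), angle_mul_angle, angle_comm p m x.2 y.2, add_comm x.2 y.2,
        angle_mul_angle]
    · simp only [Pi.add_apply, Pi.single_eq_of_ne hij, Pi.single_eq_of_ne (Ne.symm hij), add_zero]
      ring
  simp only [nsmul_eq_mul]
  linear_combination ((((floorQuot p m k).factorial / (floorQuot p m x.2).factorial : ℕ) :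
    Γ(X, U)) *
    (((floorQuot p m l).factorial / (floorQuot p m y.2).factorial : ℕ) : Γ(X, U)) *
    hasse ht j y.1 (hasse ht i x.1 a)) * h

/-- The multiplication relation, on coefficients. The coefficients of `∂_j^{[I]}(a) e_{s + R}` are
compared for all `I + R = k + l`. -/
theorem delCoeffHom_mul (U : X.Opens) (hU : IsNilpotent (p : Γ(X, U))) (j : Fin n) (k l : ℕ) :
    (delCoeffHom p m ht U j k).comp (delCoeffHom p m ht U j l) =
      ratCast Γ(X, U) (angle p m k l) • delCoeffHom p m ht U j (k + l) := by
  refine Finsupp.addHom_ext fun s a => ?_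
  change delCoeffHom p m ht U j k (delCoeffHom p m ht U j l _) =
    ratCast Γ(X, U) (angle p m k l) • delCoeffHom p m ht U j (k + l) _
  rw [delCoeffHom_single, delCoeffHom_single, map_sum, Finset.smul_sum]
  simp only [delCoeffHom_single]
  rw [Finset.sum_comm, ← Finset.sum_product']
  rw [← Finset.sum_fiberwise_of_maps_to (t := Finset.HasAntidiagonal.antidiagonal (k + l))
    (g := fun x : (ℕ × ℕ) × (ℕ × ℕ) => (x.1.1 + x.2.1, x.1.2 + x.2.2))]
  -- Here `z = (I, R)`, and the pairs `y = (i, r)` with `i + r = k` correspond to the terms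
  -- `∂_j^{[i]} ∂_j^{[I-i]}(a) e_{s + r + (R - r)}`; those with `i > I` or `r > R` do not
  -- occur.
  · refine Finset.sum_congr rfl fun z hz => ?_
    rw [Finset.HasAntidiagonal.mem_antidiagonal] at hz
    have h1 := congrArg (ratCast Γ(X, U)) (sum_mul_choose_mul_choose p m z.1 z.2 k l hz)
    have h2 : ∀ y : ℕ × ℕ, ¬ p ∣ (if y.1 ≤ z.1 ∧ y.2 ≤ z.2 then
      ((((floorQuot p m k).factorial / (floorQuot p m y.2).factorial : ℕ) : ℚ) *
        ((floorQuot p m l).factorial / (floorQuot p m (z.2 - y.2)).factorial : ℕ)) *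
        (z.1.choose y.1 * angle p m y.2 (z.2 - y.2)) else 0).den := fun y => by
      split_ifs
      · exact not_dvd_den_mul (p := p) (not_dvd_den_mul (not_dvd_den_natCast _)
            (not_dvd_den_natCast _))
          (not_dvd_den_mul (not_dvd_den_natCast _) (not_dvd_den_angle p m _ _))
      · exact_mod_cast not_dvd_den_natCast 0
    rw [ratCast_sum (p := p) hU _ _ fun y _ => h2 y,
        ratCast_mul_ratCast hU (not_dvd_den_angle p m _ _)
      (not_dvd_den_natCast _), ratCast_natCast] at h1
    rw [Finsupp.smul_single, delCoeff_apply, smul_eq_mul, nsmul_eq_mul, mul_assoc, ← mul_assoc,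
      ← h1, Finset.sum_mul, ← Finset.sum_filter_add_sum_filter_not
        (Finset.HasAntidiagonal.antidiagonal k) (fun y => y.1 ≤ z.1 ∧ y.2 ≤ z.2),
      Finset.sum_eq_zero (s := Finset.filter (fun x => ¬ _) _), add_zero, Finsupp.single_finsetSum]
    · symm
      refine Finset.sum_bij' (fun y _ => (y, (z.1 - y.1, z.2 - y.2)))
        (fun x _ => x.1) ?_ ?_ ?_ ?_ ?_
      · intro y hy
        simp only [Finset.mem_filter, Finset.HasAntidiagonal.mem_antidiagonal,
            Finset.mem_product] at hy ⊢
        refine ⟨⟨hy.1, by omega⟩, ?_⟩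
        ext <;> simp <;> omega
      · rintro ⟨⟨a, b⟩, ⟨c, d⟩⟩ hx
        simp only [Finset.mem_filter, Finset.HasAntidiagonal.mem_antidiagonal,
            Finset.mem_product] at hx ⊢
        rw [← hx.2]
        exact ⟨hx.1.1, by simp, by simp⟩
      · intro y hy
        rfl
      · rintro ⟨⟨a, b⟩, ⟨c, d⟩⟩ hx
        simp only [Finset.mem_filter, Finset.HasAntidiagonal.mem_antidiagonal,
            Finset.mem_product] at hx ⊢
        rw [← hx.2]
        simp
      · intro y hy
        simp only [Finset.mem_filter, Finset.HasAntidiagonal.mem_antidiagonal] at hy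
        dsimp only
        rw [if_pos hy.2, add_assoc, ← Pi.single_add, Nat.sub_add_cancel hy.2.2]
        congr 1
        rw [delCoeff_apply, delCoeff_apply, hasse_mul_ratCast ht U hU _ _ _
            (not_dvd_den_angle p m _ _),
          DiffRing.hasse_nsmul, hasse_hasse, Nat.add_sub_cancel' hy.2.1]
        have h3 := angle_mul_angle p m y.2 (z.2 - y.2) (s j)
        rw [Nat.add_sub_cancel' hy.2.2] at h3
        have h4 := congrArg (ratCast Γ(X, U)) h3
        rw [ratCast_mul_ratCast hU (not_dvd_den_angle p m _ _) (not_dvd_den_angle p m _ _),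
          ratCast_mul_ratCast hU (not_dvd_den_angle p m _ _) (not_dvd_den_angle p m _ _)] at h4
        have h5 : ((s + Pi.single j (z.2 - y.2) : Fin n → ℕ)) j = z.2 - y.2 + s j := by
          simp [add_comm]
        rw [h5, ratCast_mul_ratCast hU (not_dvd_den_mul (not_dvd_den_natCast _)
            (not_dvd_den_natCast _))
          (not_dvd_den_mul (not_dvd_den_natCast _) (not_dvd_den_angle p m _ _)),
          ratCast_mul_ratCast hU (not_dvd_den_natCast _) (not_dvd_den_natCast _),
          ratCast_mul_ratCast hU (not_dvd_den_natCast _) (not_dvd_den_angle p m _ _),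
          ratCast_natCast, ratCast_natCast, ratCast_natCast]
        simp only [nsmul_eq_mul]
        linear_combination -(((floorQuot p m k).factorial / (floorQuot p m y.2).factorial : ℕ) *
          ((floorQuot p m l).factorial / (floorQuot p m (z.2 - y.2)).factorial : ℕ) *
          (z.1.choose y.1 : Γ(X, U)) * hasse ht j z.1 a) * h4
    · intro y hy
      rw [if_neg (Finset.mem_filter.1 hy).2]
      simp [ratCast]
  · intro x hx
    simp only [Finset.HasAntidiagonal.mem_antidiagonal, Finset.mem_product] at hx ⊢
    omega

end Basis

section Basis
variable {p : ℕ} (m : ℕ) {X S : Scheme.{u}} {f : X ⟶ S} {n : ℕ} {t : Fin n → Γ(X, ⊤)}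
  (ht : IsCoordinates f t)

variable (p) in
theorem del_pairwise (U : X.Opens) (s : Finset (Fin n)) (k : Fin n → ℕ) :
    (s : Set (Fin n)).Pairwise (Function.onFun Commute fun j => DiffRing.del p m ht U j (k j)) :=
  fun _ _ _ _ _ => DiffRing.del_comm p m ht U _ _ _ _

variable (p) in
/-- The product `∂^{⟨k⟩} = ∏_j ∂_j^{⟨k_j⟩}`. -/
noncomputable def delBasis (U : X.Opens) (k : Fin n → ℕ) : DiffRing p m ht U :=
  Finset.univ.noncommProd (fun j => DiffRing.del p m ht U j (k j))
    (del_pairwise p m ht U _ k)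

theorem delBasis_zero (U : X.Opens) : delBasis p m ht U 0 = 1 := by
  rw [delBasis, Finset.noncommProd_eq_pow_card _ _ _ 1
      (by exact fun j _ => DiffRing.del_zero p m ht U j),
    one_pow]

theorem del_commute_delBasis (U : X.Opens) (j : Fin n) (r : ℕ) (k : Fin n → ℕ) :
    Commute (DiffRing.del p m ht U j r) (delBasis p m ht U k) :=
  Finset.noncommProd_commute _ _ _ _ fun _ _ => DiffRing.del_comm p m ht U _ _ _ _

/-- The additive map `∑ a_k e_k ↦ ∑ a_k ∂^{⟨k⟩}`. -/
noncomputable def ofCoeff (U : X.Opens) : CoeffModule X n U →+ DiffRing p m ht U :=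
  Finsupp.liftAddHom fun k =>
    (AddMonoidHom.mulRight (delBasis p m ht U k)).comp (DiffRing.fn p m ht U).toAddMonoidHom

theorem ofCoeff_single (U : X.Opens) (k : Fin n → ℕ) (a : Γ(X, U)) :
    ofCoeff m ht U (Finsupp.single k a) = DiffRing.fn p m ht U a * delBasis p m ht U k := by
  rw [ofCoeff, Finsupp.liftAddHom_apply_single]
  rfl

theorem ofCoeff_smul (U : X.Opens) (a : Γ(X, U)) (v : CoeffModule X n U) :
    ofCoeff m ht U (a • v) = DiffRing.fn p m ht U a * ofCoeff m ht U v := by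
  induction v using Finsupp.induction_linear with
  | zero => simp
  | add v w hv hw => rw [smul_add, map_add, map_add, hv, hw, mul_add]
  | single k b =>
    rw [Finsupp.smul_single, ofCoeff_single, ofCoeff_single, smul_eq_mul, map_mul, mul_assoc]

theorem hasse_one (U : X.Opens) (j : Fin n) (k : ℕ) :
    hasse ht j k (1 : Γ(X, U)) = if k = 0 then 1 else 0 := by
  have := hasse_appLE ht j k (U := U) (V := ⊤) le_top 1
  simpa using this

theorem delCoeffHom_single_one (U : X.Opens) (j : Fin n) (k : ℕ) (l : Fin n → ℕ) (hl : l j = 0) :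
    delCoeffHom p m ht U j k (Finsupp.single l 1) = Finsupp.single (l + Pi.single j k) 1 := by
  have h1 : ratCast Γ(X, U) 1 = 1 := by exact_mod_cast ratCast_natCast (A := Γ(X, U)) 1
  rw [delCoeffHom_single, Finset.sum_eq_single (0, k)]
  · rw [delCoeff_apply, hasse_zero_right, Nat.div_self (Nat.factorial_pos _), one_smul, one_mul, hl,
      angle_comm, angle_zero_left, h1]
  · rintro ⟨a, b⟩ hab h
    have : a ≠ 0 := by
      rintro rfl
      rw [Finset.HasAntidiagonal.mem_antidiagonal] at hab
      simp_all
    rw [delCoeff_apply, hasse_one ht, if_neg this, smul_zero, zero_mul, Finsupp.single_zero]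
  · intro h
    simp [Finset.HasAntidiagonal.mem_antidiagonal] at h

variable [Fact p.Prime]

/-- The defining relation between `∂_j^{⟨k⟩}` and `∂_j^{⟨l⟩}`, with the denominator of `⟨k+l; k⟩`
inverted. -/
theorem del_mul_del (U : X.Opens) (hU : IsNilpotent (p : Γ(X, U))) (j : Fin n) (k l : ℕ) :
    DiffRing.del p m ht U j k * DiffRing.del p m ht U j l =
      DiffRing.fn p m ht U (ratCast _ (angle p m k l)) * DiffRing.del p m ht U j (k + l) := by
  have h := not_dvd_den_angle p m k l
  have hu := (isUnit_natCast_of_isNilpotent hU h).map (DiffRing.fn p m ht U)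
  rw [map_natCast] at hu
  refine hu.mul_left_cancel ?_
  rw [← nsmul_eq_mul, DiffRing.del_mul, ← mul_assoc, zsmul_eq_mul,
    ← map_natCast (DiffRing.fn p m ht U), ← map_mul, mul_comm, ratCast_mul_den hU h, map_intCast]

theorem del_mul_delBasis (U : X.Opens) (hU : IsNilpotent (p : Γ(X, U))) (j : Fin n) (r : ℕ)
    (l : Fin n → ℕ) : DiffRing.del p m ht U j r * delBasis p m ht U l =
      DiffRing.fn p m ht U (ratCast _ (angle p m r (l j))) *
        delBasis p m ht U (l + Pi.single j r) := by
  classical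
  rw [delBasis, delBasis, ← Finset.mul_noncommProd_erase Finset.univ (Finset.mem_univ j),
    ← Finset.mul_noncommProd_erase Finset.univ (Finset.mem_univ j), ← mul_assoc, ← mul_assoc,
    del_mul_del m ht U hU]
  refine congrArg₂ (· * ·) (congrArg (_ * ·) ?_) ?_
  · simp [add_comm]
  · refine Finset.noncommProd_congr rfl (fun i (hi : i ∈ Finset.univ.erase j) => ?_)
      ((del_pairwise p m ht U Finset.univ l).mono (Finset.coe_subset.2 (Finset.erase_subset _ _)))
    rw [Pi.add_apply, Pi.single_eq_of_ne (Finset.ne_of_mem_erase hi), add_zero]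

theorem ofCoeff_delCoeffHom (U : X.Opens) (hU : IsNilpotent (p : Γ(X, U))) (j : Fin n) (k : ℕ)
    (v : CoeffModule X n U) : ofCoeff m ht U (delCoeffHom p m ht U j k v) =
      DiffRing.del p m ht U j k * ofCoeff m ht U v := by
  induction v using Finsupp.induction_linear with
  | zero => simp
  | add v w hv hw => rw [map_add, map_add, map_add, hv, hw, mul_add]
  | single l a =>
    rw [delCoeffHom_single, map_sum, ofCoeff_single, ← mul_assoc, DiffRing.leibniz, Finset.sum_mul]
    refine Finset.sum_congr rfl fun x _ => ?_
    rw [ofCoeff_single, delCoeff_apply, mul_assoc, del_mul_delBasis m ht U hU, ← mul_assoc, map_mul]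

/-- The left regular representation of the ring of differential operators, on coefficients. -/
noncomputable def coeffRep (U : X.Opens) (hU : IsNilpotent (p : Γ(X, U))) :
    DiffRing p m ht U →+* AddMonoid.End (CoeffModule X n U) :=
  DiffRing.lift (A := AddMonoid.End (CoeffModule X n U)) p m ht
    (Module.toAddMonoidEnd Γ(X, U) (CoeffModule X n U)) (delCoeffHom p m ht U)
    (fun j => delCoeffHom_zero p m ht U j)
    (fun i j k l => delCoeffHom_comm m ht U hU i j k l)
    (fun j k l => AddMonoidHom.ext fun v => by
      have h := DFunLike.congr_fun (delCoeffHom_mul m ht U hU j k l) v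
      change (angle p m k l).den • (delCoeffHom p m ht U j k (delCoeffHom p m ht U j l v)) =
        (angle p m k l).num • delCoeffHom p m ht U j (k + l) v
      change delCoeffHom p m ht U j k (delCoeffHom p m ht U j l v) =
        ratCast Γ(X, U) (angle p m k l) • delCoeffHom p m ht U j (k + l) v at h
      have h' : ((angle p m k l).den : Γ(X, U)) * ratCast _ (angle p m k l) =
          ((angle p m k l).num : Γ(X, U)) :=
        (mul_comm _ _).trans (ratCast_mul_den hU (not_dvd_den_angle p m k l))
      have h'' : _ • delCoeffHom p m ht U j (k + l) v = _ • delCoeffHom p m ht U j (k + l) v :=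
        congrArg (· • delCoeffHom p m ht U j (k + l) v) h'
      rw [mul_smul, Nat.cast_smul_eq_nsmul, Int.cast_smul_eq_zsmul] at h''
      rw [h, h''])
    (fun j k a => AddMonoidHom.ext fun v => by
      refine Eq.trans ?_ (AddMonoidHom.finsetSum_apply (M := CoeffModule X n U)
          (N := CoeffModule X n U) _ _ _).symm
      exact delCoeffHom_smul p m ht U j k a v)

theorem coeffRep_fn (U : X.Opens) (hU : IsNilpotent (p : Γ(X, U))) (a : Γ(X, U))
    (v : CoeffModule X n U) : coeffRep m ht U hU (DiffRing.fn p m ht U a) v = a • v :=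
  DFunLike.congr_fun (DiffRing.lift_fn ..) v

theorem coeffRep_del (U : X.Opens) (hU : IsNilpotent (p : Γ(X, U))) (j : Fin n) (k : ℕ)
    (v : CoeffModule X n U) :
    coeffRep m ht U hU (DiffRing.del p m ht U j k) v = delCoeffHom p m ht U j k v :=
  DFunLike.congr_fun (DiffRing.lift_del ..) v

theorem ofCoeff_coeffRep (U : X.Opens) (hU : IsNilpotent (p : Γ(X, U))) (P : DiffRing p m ht U)
    (v : CoeffModule X n U) :
    ofCoeff m ht U (coeffRep m ht U hU P v) = P * ofCoeff m ht U v := by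
  induction P using DiffRing.induction generalizing v with
  | h1 a => rw [coeffRep_fn, ofCoeff_smul]
  | h2 j k => rw [coeffRep_del, ofCoeff_delCoeffHom m ht U hU]
  | h3 x y hx hy =>
    rw [map_add, add_mul, ← hx, ← hy]
    exact map_add (ofCoeff m ht U) _ _
  | h4 x y hx hy =>
    rw [map_mul, mul_assoc, ← hy, ← hx]
    rfl

/-- Applied to `e_0`, the regular representation recovers the coefficients of an operator. This is
why the `∂^{⟨k⟩}` are linearly independent. -/
theorem coeffRep_delBasis (U : X.Opens) (hU : IsNilpotent (p : Γ(X, U))) (k : Fin n → ℕ) :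
    coeffRep m ht U hU (delBasis p m ht U k) (Finsupp.single 0 1) = Finsupp.single k 1 := by
  classical
  have h : ∀ s : Finset (Fin n), coeffRep m ht U hU (s.noncommProd
      (fun j => DiffRing.del p m ht U j (k j)) (del_pairwise p m ht U s k))
        (Finsupp.single 0 1) = Finsupp.single (fun j => if j ∈ s then k j else 0) 1 := by
    intro s
    induction s using Finset.induction_on with
    | empty => rw [Finset.noncommProd_empty, map_one]; simp; rfl
    | insert i s hi ih =>
      rw [Finset.noncommProd_insert_of_notMem _ _ _ _ hi, map_mul]
      refine (congrArg (coeffRep m ht U hU (DiffRing.del p m ht U i (k i))) ih).trans ?_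
      rw [coeffRep_del, delCoeffHom_single_one m ht U i _ _ (if_neg hi)]
      congr 1
      funext j
      by_cases hj : j = i
      · subst hj
        simp [hi]
      · simp [hj]
  have := h Finset.univ
  simp only [Finset.mem_univ, if_true] at this
  exact this

/-- The coefficients of a differential operator in the basis `∂^{⟨k⟩}`. -/
noncomputable def toCoeff (U : X.Opens) (hU : IsNilpotent (p : Γ(X, U))) :
    DiffRing p m ht U →+ CoeffModule X n U :=
  AddMonoidHom.mk' (fun P => coeffRep m ht U hU P (Finsupp.single 0 1)) fun P Q => by
    rw [map_add]
    rfl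

theorem ofCoeff_toCoeff (U : X.Opens) (hU : IsNilpotent (p : Γ(X, U))) (P : DiffRing p m ht U) :
    ofCoeff m ht U (toCoeff m ht U hU P) = P := by
  change ofCoeff m ht U (coeffRep m ht U hU P (Finsupp.single 0 1)) = P
  rw [ofCoeff_coeffRep, ofCoeff_single, map_one, delBasis_zero, mul_one, mul_one]

theorem toCoeff_ofCoeff (U : X.Opens) (hU : IsNilpotent (p : Γ(X, U))) (v : CoeffModule X n U) :
    toCoeff m ht U hU (ofCoeff m ht U v) = v := by
  induction v using Finsupp.induction_linear with
  | zero => simp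
  | add v w hv hw => rw [map_add, map_add, hv, hw]
  | single k a =>
    rw [ofCoeff_single]
    change coeffRep m ht U hU _ (Finsupp.single 0 1) = _
    rw [map_mul]
    refine (congrArg (coeffRep m ht U hU (DiffRing.fn p m ht U a))
        (coeffRep_delBasis m ht U hU k)).trans ?_
    rw [coeffRep_fn, Finsupp.smul_single, smul_eq_mul, mul_one]

end Basis

/-! ### Division by `∂_j^{⟨p^m⟩}` on the right -/

section Division
variable (p m : ℕ) {X S : Scheme.{u}} {f : X ⟶ S} {n : ℕ} {t : Fin n → Γ(X, ⊤)}
  (ht : IsCoordinates f t)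

/-- Right multiplication by `∂_j^{⟨p^m⟩}`, on coefficients. -/
noncomputable def mulCoeff (U : X.Opens) (j : Fin n) : CoeffModule X n U →+ CoeffModule X n U :=
  Finsupp.liftAddHom fun l => (Finsupp.singleAddHom (l + Pi.single j (p ^ m))).comp
    (AddMonoidHom.mulRight (ratCast _ (angle p m (l j) (p ^ m))))

/-- The left inverse of `mulCoeff` that kills the `e_l` with `l_j < p^m`. -/
noncomputable def divCoeff (U : X.Opens) (j : Fin n) : CoeffModule X n U →+ CoeffModule X n U :=
  Finsupp.liftAddHom fun l => if p ^ m ≤ l j then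
    (Finsupp.singleAddHom (l - Pi.single j (p ^ m))).comp
      (AddMonoidHom.mulRight (ratCast _ (angle p m (l j - p ^ m) (p ^ m))⁻¹)) else 0

theorem mulCoeff_single (U : X.Opens) (j : Fin n) (l : Fin n → ℕ) (a : Γ(X, U)) :
    mulCoeff p m U j (Finsupp.single l a) =
      Finsupp.single (l + Pi.single j (p ^ m)) (a * ratCast _ (angle p m (l j) (p ^ m))) := by
  rw [mulCoeff, Finsupp.liftAddHom_apply_single]
  rfl

theorem divCoeff_single (U : X.Opens) (j : Fin n) (l : Fin n → ℕ) (a : Γ(X, U)) :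
    divCoeff p m U j (Finsupp.single l a) = if p ^ m ≤ l j then
      Finsupp.single (l - Pi.single j (p ^ m)) (a * ratCast _ (angle p m (l j - p ^ m) (p ^ m))⁻¹)
        else 0 := by
  rw [divCoeff, Finsupp.liftAddHom_apply_single]
  split_ifs <;> rfl

theorem divCoeff_mulCoeff_of_ne (U : X.Opens) {i j : Fin n} (hij : i ≠ j)
    (v : CoeffModule X n U) :
    divCoeff p m U i (mulCoeff p m U j v) = mulCoeff p m U j (divCoeff p m U i v) := by
  induction v using Finsupp.induction_linear with
  | zero => simp
  | add v w hv hw => simp only [map_add, hv, hw]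
  | single l a =>
    have h1 : (l + Pi.single j (p ^ m) : Fin n → ℕ) i = l i := by simp [hij]
    have h2 : (l - Pi.single i (p ^ m) : Fin n → ℕ) j = l j := by simp [hij.symm]
    have h3 : l + Pi.single j (p ^ m) - Pi.single i (p ^ m) =
        l - Pi.single i (p ^ m) + Pi.single j (p ^ m) := by
      funext k
      by_cases hk : k = i
      · subst hk
        simp [hij]
      · simp [hk]
    rw [mulCoeff_single, divCoeff_single, divCoeff_single, h1, h3]
    split_ifs
    · rw [mulCoeff_single, h2, mul_right_comm]
    · rw [map_zero]

theorem res_delBasis {U W : X.Opens} (h : W ≤ U) (k : Fin n → ℕ) :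
    DiffRing.res p m ht h (delBasis p m ht U k) = delBasis p m ht W k := by
  rw [delBasis, Finset.map_noncommProd]
  simp only [DiffRing.res_del]
  rfl

/-- Restriction of coefficients. -/
noncomputable def coeffRes {U W : X.Opens} (h : W ≤ U) : CoeffModule X n U →+ CoeffModule X n W :=
  Finsupp.mapRange.addMonoidHom (res h).toAddMonoidHom

theorem coeffRes_single {U W : X.Opens} (h : W ≤ U) (l : Fin n → ℕ) (a : Γ(X, U)) :
    coeffRes h (Finsupp.single l a) = Finsupp.single l (res h a) :=
  Finsupp.mapRange_single (hf := map_zero _)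

theorem res_ofCoeff {U W : X.Opens} (h : W ≤ U) (v : CoeffModule X n U) :
    DiffRing.res p m ht h (ofCoeff m ht U v) = ofCoeff m ht W (coeffRes h v) := by
  induction v using Finsupp.induction_linear with
  | zero => simp
  | add v w hv hw => simp only [map_add, hv, hw]
  | single l a =>
    rw [coeffRes_single, ofCoeff_single, ofCoeff_single, map_mul, DiffRing.res_fn,
        res_delBasis p m ht]

variable {p} [Fact p.Prime]

theorem ratCast_angle_mul_inv {A : Type*} [CommRing A] (hA : IsNilpotent (p : A)) (k : ℕ) :
    ratCast A (angle p m k (p ^ m)) * ratCast A (angle p m k (p ^ m))⁻¹ = 1 := by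
  rw [← ratCast_mul_ratCast hA (not_dvd_den_angle p m _ _) (not_dvd_den_inv_angle p m _),
    mul_inv_cancel₀ (angle_pos p m _ _).ne']
  exact_mod_cast ratCast_natCast (A := A) 1

theorem divCoeff_mulCoeff (U : X.Opens) (hU : IsNilpotent (p : Γ(X, U))) (j : Fin n)
    (v : CoeffModule X n U) : divCoeff p m U j (mulCoeff p m U j v) = v := by
  induction v using Finsupp.induction_linear with
  | zero => simp
  | add v w hv hw => rw [map_add, map_add, hv, hw]
  | single l a =>
    have h : (l + Pi.single j (p ^ m) : Fin n → ℕ) j = l j + p ^ m := by simp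
    rw [mulCoeff_single, divCoeff_single, h, if_pos (Nat.le_add_left _ _), add_tsub_cancel_right,
      Nat.add_sub_cancel, mul_assoc, ratCast_angle_mul_inv m hU, mul_one]

theorem mulCoeff_divCoeff_single (U : X.Opens) (hU : IsNilpotent (p : Γ(X, U))) (j : Fin n)
    (l : Fin n → ℕ) (a : Γ(X, U)) :
    mulCoeff p m U j (divCoeff p m U j (Finsupp.single l a)) =
      if p ^ m ≤ l j then Finsupp.single l a else 0 := by
  rw [divCoeff_single]
  split_ifs with h
  · have h1 : (l - Pi.single j (p ^ m) : Fin n → ℕ) j = l j - p ^ m := by simp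
    have h2 : l - Pi.single j (p ^ m) + Pi.single j (p ^ m) = l := tsub_add_cancel_of_le <| by
      intro i
      by_cases hi : i = j
      · subst hi
        simpa using h
      · simp [hi]
    rw [mulCoeff_single, h1, h2, mul_assoc, mul_comm (ratCast _ _), ratCast_angle_mul_inv m hU,
      mul_one]
  · rw [map_zero]

theorem ofCoeff_mulCoeff (U : X.Opens) (hU : IsNilpotent (p : Γ(X, U))) (j : Fin n)
    (v : CoeffModule X n U) : ofCoeff m ht U (mulCoeff p m U j v) =
      ofCoeff m ht U v * DiffRing.del p m ht U j (p ^ m) := by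
  induction v using Finsupp.induction_linear with
  | zero => simp
  | add v w hv hw => simp only [map_add, add_mul, hv, hw]
  | single l a =>
    rw [mulCoeff_single, ofCoeff_single, ofCoeff_single, mul_assoc,
      ← (del_commute_delBasis m ht U j (p ^ m) l).eq, del_mul_delBasis m ht U hU, angle_comm,
      ← mul_assoc, map_mul]

/-- Division by `∂_j^{⟨p^m⟩}` on the right: the coefficients of the `∂^{⟨l⟩}` with `l_j < p^m` are
dropped. -/
noncomputable def divDel (U : X.Opens) (hU : IsNilpotent (p : Γ(X, U))) (j : Fin n) :
    DiffRing p m ht U →+ DiffRing p m ht U :=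
  ((ofCoeff m ht U).comp (divCoeff p m U j)).comp (toCoeff m ht U hU)

theorem divDel_ofCoeff (U : X.Opens) (hU : IsNilpotent (p : Γ(X, U))) (j : Fin n)
    (v : CoeffModule X n U) :
    divDel m ht U hU j (ofCoeff m ht U v) = ofCoeff m ht U (divCoeff p m U j v) := by
  change ofCoeff m ht U (divCoeff p m U j (toCoeff m ht U hU _)) = _
  rw [toCoeff_ofCoeff]

theorem divDel_mul (U : X.Opens) (hU : IsNilpotent (p : Γ(X, U))) (j : Fin n)
    (P : DiffRing p m ht U) : divDel m ht U hU j (P * DiffRing.del p m ht U j (p ^ m)) = P := by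
  rw [← ofCoeff_toCoeff m ht U hU P, ← ofCoeff_mulCoeff m ht U hU, divDel_ofCoeff,
    divCoeff_mulCoeff m U hU]

theorem divDel_mul_of_ne (U : X.Opens) (hU : IsNilpotent (p : Γ(X, U))) {i j : Fin n} (hij : i ≠ j)
    (P : DiffRing p m ht U) : divDel m ht U hU i (P * DiffRing.del p m ht U j (p ^ m)) =
      divDel m ht U hU i P * DiffRing.del p m ht U j (p ^ m) := by
  rw [← ofCoeff_toCoeff m ht U hU P, ← ofCoeff_mulCoeff m ht U hU, divDel_ofCoeff, divDel_ofCoeff,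
    divCoeff_mulCoeff_of_ne p m U hij, ofCoeff_mulCoeff m ht U hU]

/-- The remainder after division by `∂_j^{⟨p^m⟩}` is the sum of the terms with `l_j < p^m`. -/
theorem sub_divDel_mul (U : X.Opens) (hU : IsNilpotent (p : Γ(X, U))) (j : Fin n)
    (v : CoeffModule X n U) : ofCoeff m ht U v - divDel m ht U hU j (ofCoeff m ht U v) *
      DiffRing.del p m ht U j (p ^ m) = ofCoeff m ht U (v.filter fun l => l j < p ^ m) := by
  rw [divDel_ofCoeff, ← ofCoeff_mulCoeff m ht U hU, ← map_sub]
  congr 1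
  induction v using Finsupp.induction_linear with
  | zero => rw [map_zero, map_zero, sub_zero, Finsupp.filter_zero]
  | add v w hv hw => rw [map_add, map_add, Finsupp.filter_add, ← hv, ← hw]; abel
  | single l a =>
    rw [mulCoeff_divCoeff_single m U hU]
    split_ifs with h
    · rw [sub_self, Finsupp.filter_single_of_neg (fun l : Fin n → ℕ => l j < p ^ m) (not_lt.2 h)]
    · rw [sub_zero, Finsupp.filter_single_of_pos (fun l : Fin n → ℕ => l j < p ^ m) (not_le.1 h)]

theorem coeffRes_divCoeff {U W : X.Opens} (hU : IsNilpotent (p : Γ(X, U))) (h : W ≤ U) (j : Fin n)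
    (v : CoeffModule X n U) :
    coeffRes h (divCoeff p m U j v) = divCoeff p m W j (coeffRes h v) := by
  induction v using Finsupp.induction_linear with
  | zero => simp
  | add v w hv hw => simp only [map_add, hv, hw]
  | single l a =>
    rw [coeffRes_single, divCoeff_single, divCoeff_single]
    split_ifs
    · rw [coeffRes_single, map_mul, map_ratCast hU _ (not_dvd_den_inv_angle p m _)]
    · rw [map_zero]

theorem res_divDel {U W : X.Opens} (hU : IsNilpotent (p : Γ(X, U)))
    (hW : IsNilpotent (p : Γ(X, W))) (h : W ≤ U) (j : Fin n) (P : DiffRing p m ht U) :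
    DiffRing.res p m ht h (divDel m ht U hU j P) =
      divDel m ht W hW j (DiffRing.res p m ht h P) := by
  rw [← ofCoeff_toCoeff m ht U hU P, divDel_ofCoeff, res_ofCoeff p m ht, res_ofCoeff p m ht,
    divDel_ofCoeff, coeffRes_divCoeff m hU]

end Division

/-! ### The action on monomials in the coordinates -/

section Monomials
variable (p m : ℕ) {X S : Scheme.{u}} {f : X ⟶ S} {n : ℕ} {t : Fin n → Γ(X, ⊤)}
  (ht : IsCoordinates f t)

variable (t) in
/-- The monomial `t^i = ∏_j t_j^{i_j}` on `U`. -/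
noncomputable def monomial (U : X.Opens) (i : Fin n → ℕ) : Γ(X, U) :=
  ∏ j, res le_top (t j) ^ i j

theorem res_monomial {U W : X.Opens} (h : W ≤ U) (i : Fin n → ℕ) :
    res h (monomial t U i) = monomial t W i := by
  simp only [monomial, map_prod, map_pow, res_res]

theorem coeff_C_add_X_pow {A : Type*} [CommRing A] (a : A) (e k : ℕ) :
    PowerSeries.coeff k ((PowerSeries.C a + PowerSeries.X) ^ e) = e.choose k * a ^ (e - k) := by
  have h : ((Polynomial.X + Polynomial.C a) ^ e : Polynomial A).toPowerSeries =
      (PowerSeries.C a + PowerSeries.X) ^ e := by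
    simp [add_comm]
  rw [← h, Polynomial.coeff_coe, Polynomial.coeff_X_add_C_pow, mul_comm]

theorem hasse_monomial (U : X.Opens) (j : Fin n) (k : ℕ) (i : Fin n → ℕ) :
    hasse ht j k (monomial t U i) = (i j).choose k • monomial t U (i - Pi.single j k) := by
  classical
  refine hasse_ext (f := f) fun c hc => ?_
  rw [res_hasse_chart, map_nsmul, res_monomial, res_monomial, Chart.taylor]
  have h : ∀ l, HigherDeRham.taylor (polyMap f t c.le) (c.formallyEtale ht) ⟨j⟩ (res le_top (t l)) =
      PowerSeries.C (res le_top (t l)) + if l = j then PowerSeries.X else 0 := by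
    intro l
    have h1 : polyMap f t c.le (MvPolynomial.X ⟨l⟩) = res le_top (t l) := by
      simp [polyMap, res]
    have := taylor_X (polyMap f t c.le) (c.formallyEtale ht) ⟨l⟩ ⟨j⟩
    rw [h1] at this
    rw [this]
    simp
  simp only [monomial, map_prod, map_pow, h]
  rw [← Finset.mul_prod_erase _ _ (Finset.mem_univ j),
    ← Finset.mul_prod_erase _ _ (Finset.mem_univ j), if_pos rfl]
  have h2 : ∏ l ∈ Finset.univ.erase j, (PowerSeries.C (res (le_top : c.W ≤ ⊤) (t l)) +
      if l = j then PowerSeries.X else 0) ^ i l =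
        PowerSeries.C (∏ l ∈ Finset.univ.erase j, res (le_top : c.W ≤ ⊤) (t l) ^ i l) := by
    rw [map_prod]
    refine Finset.prod_congr rfl fun l hl => ?_
    rw [if_neg (Finset.ne_of_mem_erase hl), add_zero, map_pow]
  have h3 : ∏ l ∈ Finset.univ.erase j, res (le_top : c.W ≤ ⊤) (t l) ^
      (i - Pi.single j k : Fin n → ℕ) l =
      ∏ l ∈ Finset.univ.erase j, res (le_top : c.W ≤ ⊤) (t l) ^ i l :=
    Finset.prod_congr rfl fun l hl => by
      rw [Pi.sub_apply, Pi.single_eq_of_ne (Finset.ne_of_mem_erase hl), Nat.sub_zero]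
  rw [h2, h3, PowerSeries.coeff_mul_C, coeff_C_add_X_pow, Pi.sub_apply, Pi.single_eq_same,
    nsmul_eq_mul, mul_assoc]

theorem toEnd_delBasis_monomial (U : X.Opens) (k i : Fin n → ℕ) :
    DiffRing.toEnd p m ht U (delBasis p m ht U k) (monomial t U i) =
      (∏ j, (floorQuot p m (k j)).factorial * (i j).choose (k j)) • monomial t U (i - k) := by
  classical
  have h : ∀ s : Finset (Fin n), DiffRing.toEnd p m ht U (s.noncommProd
      (fun j => DiffRing.del p m ht U j (k j)) (del_pairwise p m ht U s k)) (monomial t U i) =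
      (∏ j ∈ s, (floorQuot p m (k j)).factorial * (i j).choose (k j)) •
        monomial t U (fun j => if j ∈ s then i j - k j else i j) := by
    intro s
    induction s using Finset.induction_on with
    | empty => rw [Finset.noncommProd_empty, map_one]; simp
    | insert a s ha ih =>
      rw [Finset.noncommProd_insert_of_notMem _ _ _ _ ha, map_mul]
      refine (congrArg (DiffRing.toEnd p m ht U (DiffRing.del p m ht U a (k a))) ih).trans ?_
      rw [DiffRing.toEnd_del, DiffRing.hasse_nsmul, hasse_monomial, if_neg ha,
        Finset.prod_insert ha, smul_smul, smul_smul]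
      congr 1
      · ring
      · congr 1
        funext j
        by_cases hj : j = a
        · subst hj
          simp [ha]
        · simp [hj]
  have := h Finset.univ
  simp only [Finset.mem_univ, if_true] at this
  exact this

/-- The exponents `i` with `0 ≤ i_j < p^m`. -/
abbrev SmallExp (p m n : ℕ) : Type := Fin n → Fin (p ^ m)

/-- The matrix of `∂^{⟨k⟩}(t^i)` for `0 ≤ k_j, i_j < p^m`. -/
noncomputable def monomialMatrix {A : Type*} [CommRing A] (x : Fin n → A) :
    Matrix (SmallExp p m n) (SmallExp p m n) A :=
  fun k i => ∏ j, ((i j : ℕ).choose (k j) * x j ^ ((i j : ℕ) - k j))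

/-- The coefficients of the Taylor shifts by `x` and by `-x` form inverse matrices. -/
theorem sum_choose_mul_choose {A : Type*} [CommRing A] (x : A) (N : ℕ) (k r : Fin N) :
    ∑ i : Fin N, ((i : ℕ).choose k * x ^ ((i : ℕ) - k)) *
      ((r : ℕ).choose i * (-x) ^ ((r : ℕ) - i)) =
      if k = r then 1 else 0 := by
  rw [Fin.sum_univ_eq_sum_range (fun i => ((i.choose k * x ^ (i - k)) *
    ((r : ℕ).choose i * (-x) ^ ((r : ℕ) - i)) : A)) N]
  by_cases hkr : (k : ℕ) ≤ r
  · have h1 : ∑ i ∈ Finset.range N, ((i.choose k * x ^ (i - k)) *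
        ((r : ℕ).choose i * (-x) ^ ((r : ℕ) - i)) : A) =
        ∑ i ∈ Finset.Ico (k : ℕ) (r + 1), ((i.choose k * x ^ (i - k)) *
        ((r : ℕ).choose i * (-x) ^ ((r : ℕ) - i)) : A) := by
      symm
      refine Finset.sum_subset (fun i hi => ?_) fun i _ hi => ?_
      · simp only [Finset.mem_Ico, Finset.mem_range] at hi ⊢
        omega
      · simp only [Finset.mem_Ico, not_and_or, not_le, not_lt] at hi
        rcases hi with h | h
        · simp [Nat.choose_eq_zero_of_lt h]
        · simp [Nat.choose_eq_zero_of_lt (show (r : ℕ) < i by omega)]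
    -- The sum over `k ≤ i ≤ r` is `(r choose k)` times the binomial expansion of `(x + (-x)) ^
    -- (r - k)`.
    rw [h1, Finset.sum_Ico_eq_sum_range]
    have h2 : ∀ i ∈ Finset.range ((r : ℕ) + 1 - k),
        ((((k + i).choose k : ℕ) * x ^ (k + i - k : ℕ)) *
        ((r : ℕ).choose (k + i) * (-x) ^ ((r : ℕ) - (k + i))) : A) =
        (r : ℕ).choose k * (x ^ i * (-x) ^ ((r - k : ℕ) - i) * ((r - k : ℕ).choose i)) := by
      intro i hi
      rw [Finset.mem_range] at hi
      have h3 := Nat.choose_mul (n := r) (k := k + i) (s := k) (Nat.le_add_right _ _)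
      have h4 := congrArg (Nat.cast : ℕ → A) h3
      push_cast at h4
      rw [Nat.add_sub_cancel_left] at h4 ⊢
      rw [← Nat.sub_sub]
      linear_combination (x ^ i * (-x) ^ ((r : ℕ) - k - i)) * h4
    rw [Finset.sum_congr rfl h2, ← Finset.mul_sum, Nat.succ_sub hkr, ← add_pow, add_neg_cancel]
    by_cases h : k = r
    · simp [h]
    · have : (r : ℕ) - k ≠ 0 := fun h' => h (Fin.ext (by omega))
      rw [zero_pow this, mul_zero, if_neg h]
  · rw [if_neg (fun h => hkr (by rw [h]))]
    refine Finset.sum_eq_zero fun i _ => ?_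
    rcases lt_or_ge i (k : ℕ) with h | h
    · simp [Nat.choose_eq_zero_of_lt h]
    · simp [Nat.choose_eq_zero_of_lt (show (r : ℕ) < i by omega)]

/-- In particular `monomialMatrix` is invertible: it is the tensor product over the variables of the
matrices of the Taylor shifts by `x_j`, and its inverse is the one of the shifts by `-x_j`. -/
theorem monomialMatrix_mul_neg {A : Type*} [CommRing A] (x : Fin n → A) :
    monomialMatrix p m x * monomialMatrix p m (-x) = 1 := by
  classical
  ext k r
  rw [Matrix.mul_apply]
  simp only [monomialMatrix, ← Finset.prod_mul_distrib, Pi.neg_apply]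
  rw [← Fintype.prod_sum (fun (j : Fin n) (i : Fin (p ^ m)) =>
    ((i : ℕ).choose (k j) * x j ^ ((i : ℕ) - k j)) *
      ((r j : ℕ).choose i * (-x j) ^ ((r j : ℕ) - i)))]
  simp only [sum_choose_mul_choose]
  rw [Matrix.one_apply]
  split_ifs with h
  · subst h
    simp
  · obtain ⟨j, hj⟩ := Function.ne_iff.1 h
    exact Finset.prod_eq_zero (Finset.mem_univ j) (if_neg hj)

end Monomials

section Evaluation
variable (p m : ℕ) {X S : Scheme.{u}} {f : X ⟶ S} {n : ℕ} {t : Fin n → Γ(X, ⊤)}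
  (ht : IsCoordinates f t)

/-- The exponent vector underlying an element of `SmallExp p m n`. -/
def SmallExp.toExp {p m n : ℕ} (i : SmallExp p m n) : Fin n → ℕ := fun j => i j

/-- The values of a differential operator on the monomials `t^i`, `0 ≤ i_j < p^m`. -/
noncomputable def evalMonomials (U : X.Opens) :
    DiffRing p m ht U →+ (SmallExp p m n → Γ(X, U)) where
  toFun P i := DiffRing.toEnd p m ht U P (monomial t U i.toExp)
  map_zero' := by
    funext i
    rw [map_zero]
    rfl
  map_add' P Q := by
    funext i
    rw [map_add]
    rfl

theorem toEnd_del_monomial (U : X.Opens) (j : Fin n) (i : SmallExp p m n) :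
    DiffRing.toEnd p m ht U (DiffRing.del p m ht U j (p ^ m)) (monomial t U i.toExp) = 0 := by
  have h : (i.toExp j).choose (p ^ m) = 0 := Nat.choose_eq_zero_of_lt (i j).2
  rw [DiffRing.toEnd_del, hasse_monomial, h, zero_smul, smul_zero]

theorem evalMonomials_mul_del (U : X.Opens) (j : Fin n) (P : DiffRing p m ht U) :
    evalMonomials p m ht U (P * DiffRing.del p m ht U j (p ^ m)) = 0 := by
  funext i
  change DiffRing.toEnd p m ht U (P * DiffRing.del p m ht U j (p ^ m)) (monomial t U i.toExp) = 0
  rw [map_mul]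
  exact (congrArg (DiffRing.toEnd p m ht U P) (toEnd_del_monomial p m ht U j i)).trans (map_zero _)

/-- On the operators `∂^{⟨k⟩}`, `0 ≤ k_j < p^m`, evaluation on monomials is given by
`monomialMatrix`. -/
theorem evalMonomials_ofCoeff_single (U : X.Opens) (k i : SmallExp p m n) (a : Γ(X, U)) :
    evalMonomials p m ht U (ofCoeff m ht U (Finsupp.single k.toExp a)) i =
      a * monomialMatrix p m (fun j => res le_top (t j)) k i := by
  change DiffRing.toEnd p m ht U _ (monomial t U i.toExp) = _
  rw [ofCoeff_single, map_mul]
  refine (congrArg (DiffRing.toEnd p m ht U (DiffRing.fn p m ht U a))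
    (toEnd_delBasis_monomial p m ht U k.toExp i.toExp)).trans ?_
  rw [DiffRing.toEnd_fn, monomialMatrix, monomial, nsmul_eq_mul, Nat.cast_prod,
    ← Finset.prod_mul_distrib]
  congr 1
  refine Finset.prod_congr rfl fun j _ => ?_
  -- The factors `q_{k_j}!` are `1`, as `k_j < p^m`.
  have h : floorQuot p m (k.toExp j) = 0 := Nat.div_eq_of_lt (k j).2
  rw [h, Nat.factorial_zero, one_mul]
  rfl

theorem evalMonomials_ofCoeff_single_of_le (U : X.Opens) {k : Fin n → ℕ} {j : Fin n}
    (h : p ^ m ≤ k j) (a : Γ(X, U)) :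
    evalMonomials p m ht U (ofCoeff m ht U (Finsupp.single k a)) = 0 := by
  funext i
  change DiffRing.toEnd p m ht U _ (monomial t U i.toExp) = 0
  rw [ofCoeff_single, map_mul]
  refine (congrArg (DiffRing.toEnd p m ht U (DiffRing.fn p m ht U a))
    (toEnd_delBasis_monomial p m ht U k i.toExp)).trans ?_
  rw [DiffRing.toEnd_fn, Finset.prod_eq_zero (Finset.mem_univ j), zero_smul, mul_zero]
  have h' : (i.toExp j).choose (k j) = 0 := Nat.choose_eq_zero_of_lt ((i j).2.trans_le h)
  rw [h', mul_zero]

/-- The operator of order `< p^m` in each variable with prescribed values on the monomials. -/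
noncomputable def interpolate (U : X.Opens) : (SmallExp p m n → Γ(X, U)) →+ DiffRing p m ht U where
  toFun v := ofCoeff m ht U (∑ r : SmallExp p m n, Finsupp.single r.toExp
    (∑ i, v i * monomialMatrix p m (-fun j => res le_top (t j)) i r))
  map_zero' := by simp
  map_add' v w := by
    rw [← map_add, ← Finset.sum_add_distrib]
    simp only [← Finsupp.single_add, ← Finset.sum_add_distrib, Pi.add_apply, add_mul]

theorem interpolate_apply (U : X.Opens) (v : SmallExp p m n → Γ(X, U)) :
    interpolate p m ht U v = ofCoeff m ht U (∑ r : SmallExp p m n, Finsupp.single r.toExp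
      (∑ i, v i * monomialMatrix p m (-fun j => res le_top (t j)) i r)) := rfl

theorem evalMonomials_interpolate (U : X.Opens) (v : SmallExp p m n → Γ(X, U)) :
    evalMonomials p m ht U (interpolate p m ht U v) = v := by
  classical
  -- The inverse matrix is needed on the other side than in `monomialMatrix_mul_neg`.
  have h1 := mul_eq_one_comm.1
    (monomialMatrix_mul_neg p m (fun j => res (le_top : U ≤ ⊤) (t j)))
  funext r
  rw [interpolate_apply, map_sum, map_sum, Finset.sum_apply]
  simp only [evalMonomials_ofCoeff_single, Finset.sum_mul, mul_assoc]
  rw [Finset.sum_comm]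
  simp only [← Finset.mul_sum, ← Matrix.mul_apply]
  rw [h1]
  simp [Matrix.one_apply]

/-- Interpolating the values of an operator on the monomials `t^i`, `0 ≤ i_j < p^m`, keeps its terms
of order `< p^m` in each variable and drops all other ones. -/
theorem interpolate_evalMonomials (U : X.Opens) (v : CoeffModule X n U) :
    interpolate p m ht U (evalMonomials p m ht U (ofCoeff m ht U v)) =
      ofCoeff m ht U (v.filter fun l => ∀ j, l j < p ^ m) := by
  classical
  induction v using Finsupp.induction_linear with
  | zero => simp only [map_zero, Finsupp.filter_zero]
  | add v w hv hw => rw [map_add, map_add, map_add, hv, hw, ← map_add, Finsupp.filter_add]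
  | single l a =>
    by_cases h : ∀ j, l j < p ^ m
    · obtain ⟨k, rfl⟩ : ∃ k : SmallExp p m n, l = k.toExp := ⟨fun j => ⟨l j, h j⟩, rfl⟩
      rw [Finsupp.filter_single_of_pos (fun l : Fin n → ℕ => ∀ j, l j < p ^ m) h, interpolate_apply]
      congr 1
      simp only [evalMonomials_ofCoeff_single, mul_assoc]
      simp only [← Finset.mul_sum, ← Matrix.mul_apply, monomialMatrix_mul_neg]
      rw [Finset.sum_eq_single k]
      · simp
      · intro r _ hr
        rw [Matrix.one_apply_ne hr.symm, mul_zero, Finsupp.single_zero]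
      · simp
    · rw [Finsupp.filter_single_of_neg (fun l : Fin n → ℕ => ∀ j, l j < p ^ m) h, map_zero]
      obtain ⟨j, hj⟩ := not_forall.1 h
      rw [evalMonomials_ofCoeff_single_of_le p m ht U (not_lt.1 hj), map_zero]

theorem res_monomialMatrix {U W : X.Opens} (h : W ≤ U) (k i : SmallExp p m n) :
    res h (monomialMatrix p m (-fun j => res (le_top : U ≤ ⊤) (t j)) k i) =
      monomialMatrix p m (-fun j => res (le_top : W ≤ ⊤) (t j)) k i := by
  simp only [monomialMatrix, map_prod, map_mul, map_natCast, map_pow, Pi.neg_apply, map_neg,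
    res_res]

theorem res_interpolate {U W : X.Opens} (h : W ≤ U) (v : SmallExp p m n → Γ(X, U)) :
    DiffRing.res p m ht h (interpolate p m ht U v) = interpolate p m ht W fun i => res h (v i) := by
  rw [interpolate_apply, interpolate_apply, res_ofCoeff]
  congr 1
  simp only [map_sum, coeffRes_single, map_mul, res_monomialMatrix]

end Evaluation

/-! ### Contracting a Koszul complex -/

section ContractionRing
variable {n : ℕ} {E : Type*} [Ring E]

theorem koszulSign_mul_self (j : Fin n) (s : Finset (Fin n)) :
    koszulSign j s * koszulSign j s = 1 := by
  rw [koszulSign, ← mul_pow, neg_one_mul, neg_neg, one_pow]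

theorem koszulSign_swap {i j : Fin n} {s : Finset (Fin n)} (hi : i ∉ s) (hj : j ∉ s) (h : i ≠ j) :
    koszulSign j s * koszulSign i s =
      -(koszulSign j (insert i s) * koszulSign i (insert j s)) := by
  have h1 : koszulSign j s * koszulSign i (insert j s) =
      -(koszulSign i s * koszulSign j (insert i s)) := by
    rcases lt_or_gt_of_ne h with h | h
    · rw [koszulSign_mul hi h, neg_neg]
    · exact koszulSign_mul hj h
  have h2 := koszulSign_mul_self i s
  have h3 := koszulSign_mul_self i (insert j s)
  linear_combination (koszulSign i s * koszulSign i (insert j s)) * h1 -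
    koszulSign j s * koszulSign i s * h3 -
    koszulSign j (insert i s) * koszulSign i (insert j s) * h2

/-- The matrix entries of `x τ_s ↦ σ(x) τ_j ∧ τ_s`. -/
def wedgeEntry (j : Fin n) (σ : E) (s s' : Finset (Fin n)) : E :=
  if j ∉ s ∧ s' = insert j s then koszulSign j s • σ else 0

theorem wedgeEntry_eq_zero (j : Fin n) (σ : E) {s s' : Finset (Fin n)}
    (h : s'.card ≠ s.card + 1) : wedgeEntry j σ s s' = 0 :=
  if_neg fun hj => h (by rw [hj.2, Finset.card_insert_of_notMem hj.1])

theorem koszulEntry_insert (x : Fin n → E) {i : Fin n} {u : Finset (Fin n)} (h : i ∉ u) :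
    koszulEntry x u (insert i u) = koszulSign i u • x i := by
  rw [koszulEntry, Finset.sum_eq_single i, if_pos ⟨h, rfl⟩]
  · intro k _ hk
    refine if_neg fun h' => hk ?_
    have : k ∈ insert i u := h'.2 ▸ Finset.mem_insert_self k u
    exact (Finset.mem_insert.1 this).resolve_right h'.1
  · simp

theorem exists_of_koszulEntry_ne_zero {x : Fin n → E} {u v : Finset (Fin n)}
    (h : koszulEntry x u v ≠ 0) : ∃ i, i ∉ u ∧ v = insert i u := by
  by_contra hc
  exact h (Finset.sum_eq_zero fun i _ => if_neg fun hi => hc ⟨i, hi⟩)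

/-- If `σ` is a left inverse of `x_j` and commutes with the other `x_i`, then the Koszul
differential and `x τ_s ↦ σ(x) τ_j ∧ τ_s` anticommute up to a diagonal matrix. -/
theorem wedgeEntry_koszulEntry (x : Fin n → E) (j : Fin n) (σ : E) (hσ : σ * x j = 1)
    (hx : ∀ i, i ≠ j → σ * x i = x i * σ) (s s'' : Finset (Fin n)) :
    ∑ s', wedgeEntry j σ s' s'' * koszulEntry x s' s +
      ∑ s', koszulEntry x s'' s' * wedgeEntry j σ s s' =
        if s = s'' then (if j ∈ s then 1 else x j * σ) else 0 := by
  have h1 : ∑ s', koszulEntry x s'' s' * wedgeEntry j σ s s' =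
      if j ∉ s then koszulSign j s • (koszulEntry x s'' (insert j s) * σ) else 0 := by
    rw [Finset.sum_eq_single (insert j s)]
    · by_cases h : j ∈ s <;> simp [wedgeEntry, h, -zsmul_eq_mul]
    · intro s' _ hs'
      rw [wedgeEntry, if_neg (fun h => hs' h.2), mul_zero]
    · simp
  have h2 : ∑ s', wedgeEntry j σ s' s'' * koszulEntry x s' s =
      if j ∈ s'' then koszulSign j (s''.erase j) • (σ * koszulEntry x (s''.erase j) s) else 0 := by
    rw [Finset.sum_eq_single (s''.erase j)]
    · by_cases h : j ∈ s''
      · simp [wedgeEntry, h, -zsmul_eq_mul]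
      · rw [wedgeEntry, if_neg, if_neg h, zero_mul]
        rintro ⟨-, h'⟩
        exact h (h' ▸ Finset.mem_insert_self _ _)
    · intro s' _ hs'
      rw [wedgeEntry, if_neg, zero_mul]
      rintro ⟨h, rfl⟩
      exact hs' (Finset.erase_insert h).symm
    · simp
  rw [h1, h2]
  by_cases hs : j ∈ s <;> by_cases hs'' : j ∈ s''
  -- `j ∈ s` and `j ∈ s''`: only the first sum contributes, and only if `s = s''`.
  · rw [if_pos hs'', if_neg (not_not.2 hs), add_zero, if_pos hs]
    by_cases h : s = s''
    · subst h
      have h' : koszulEntry x (s.erase j) s = koszulSign j (s.erase j) • x j := by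
        conv_lhs => rw [← Finset.insert_erase hs]
        rw [Finset.erase_insert (Finset.notMem_erase _ _),
          koszulEntry_insert x (Finset.notMem_erase _ _)]
      rw [if_pos rfl, h', mul_smul_comm, smul_smul, koszulSign_mul_self, one_smul, hσ]
    · rw [if_neg h]
      by_contra hc
      have h' : koszulEntry x (s''.erase j) s ≠ 0 := fun h0 => hc (by rw [h0, mul_zero, smul_zero])
      obtain ⟨i, hi, rfl⟩ := exists_of_koszulEntry_ne_zero h'
      have : j = i := (Finset.mem_insert.1 hs).resolve_right (Finset.notMem_erase _ _)
      subst this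
      exact h (Finset.insert_erase hs'')
  -- `j ∈ s` and `j ∉ s''`: both sums vanish.
  · rw [if_neg hs'', if_neg (not_not.2 hs), add_zero, if_neg (fun h : s = s'' => hs'' (h ▸ hs))]
  -- `j ∉ s` and `j ∈ s''`: the terms for `s = insert i u`, `s'' = insert j u` cancel.
  · rw [if_pos hs'', if_pos hs, if_neg (fun h : s = s'' => hs (h.symm ▸ hs''))]
    obtain ⟨u, hu, rfl⟩ : ∃ u, j ∉ u ∧ s'' = insert j u :=
      ⟨s''.erase j, Finset.notMem_erase _ _, (Finset.insert_erase hs'').symm⟩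
    rw [Finset.erase_insert hu]
    by_cases h : ∃ i, i ∉ u ∧ s = insert i u
    · obtain ⟨i, hi, rfl⟩ := h
      have hij : i ≠ j := by
        rintro rfl
        exact hs (Finset.mem_insert_self _ _)
      have hi' : i ∉ insert j u := by simp [hij, hi]
      rw [koszulEntry_insert x hi, Finset.insert_comm, koszulEntry_insert x hi', mul_smul_comm,
        smul_mul_assoc, smul_smul, smul_smul, hx i hij, ← add_smul, koszulSign_swap hi hu hij,
        neg_add_cancel, zero_smul]
    · have h3 : koszulEntry x u s = 0 := by
        by_contra hc
        exact h (exists_of_koszulEntry_ne_zero hc)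
      have h4 : koszulEntry x (insert j u) (insert j s) = 0 := by
        by_contra hc
        obtain ⟨i, hi, hi'⟩ := exists_of_koszulEntry_ne_zero hc
        refine h ⟨i, fun h' => hi (Finset.mem_insert_of_mem h'), ?_⟩
        have hij : j ≠ i := by
          rintro rfl
          exact hi (Finset.mem_insert_self _ _)
        rw [← Finset.erase_insert hs, hi', Finset.insert_comm, Finset.erase_insert]
        simp [hij, hu]
      rw [h3, h4, mul_zero, zero_mul, smul_zero, smul_zero, add_zero]
  -- `j ∉ s` and `j ∉ s''`: only the second sum contributes, and only if `s = s''`.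
  · rw [if_neg hs'', if_pos hs, zero_add, if_neg hs]
    by_cases h : s = s''
    · subst h
      rw [if_pos rfl, koszulEntry_insert x hs, smul_mul_assoc, smul_smul, koszulSign_mul_self,
        one_smul]
    · rw [if_neg h]
      by_contra hc
      have h' : koszulEntry x s'' (insert j s) ≠ 0 := fun h0 => hc (by rw [h0, zero_mul, smul_zero])
      obtain ⟨i, hi, hi'⟩ := exists_of_koszulEntry_ne_zero h'
      have : j = i := (Finset.mem_insert.1 (hi' ▸ Finset.mem_insert_self j s)).resolve_right hs''
      subst this
      exact h (by rw [← Finset.erase_insert hs, hi', Finset.erase_insert hs''])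

end ContractionRing

section Contraction
variable {n : ℕ} {C C' : Type*} [Category C] [Category C'] [Preadditive C] [Preadditive C']
  (F : C ⥤ C')

theorem map_koszulHom [F.Additive] (M : C) (δ : Fin n → End M) (s s' : Finset (Fin n)) :
    F.map (koszulHom M δ s s') =
    koszulEntry (E := End (F.obj M)) (fun j => F.map (δ j)) s s' := by
  have h : koszulHom M δ s s' =
      ∑ j, if j ∉ s ∧ s' = insert j s then koszulSign j s • (show M ⟶ M from δ j) else 0 := rfl
  rw [h, F.map_sum]
  refine Finset.sum_congr rfl fun j _ => ?_
  split_ifs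
  · rw [F.map_zsmul]
  · rw [F.map_zero]

variable [HasFiniteBiproducts C]

/-- The morphism `F(⨁_ι M) ⟶ F(⨁_κ M)` with matrix entries `a i k : F(M) ⟶ F(M)`. -/
noncomputable def mapMatrix {ι κ : Type} [Fintype ι] [Fintype κ] {M : C}
    (a : ι → κ → (F.obj M ⟶ F.obj M)) : F.obj (⨁ fun _ : ι => M) ⟶ F.obj (⨁ fun _ : κ => M) :=
  ∑ i, ∑ k, F.map (biproduct.π (fun _ : ι => M) i) ≫ a i k ≫ F.map (biproduct.ι (fun _ : κ => M) k)

theorem mapMatrix_add {ι κ : Type} [Fintype ι] [Fintype κ] {M : C}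
    (a b : ι → κ → (F.obj M ⟶ F.obj M)) :
    mapMatrix F a + mapMatrix F b = mapMatrix F fun i k => a i k + b i k := by
  simp only [mapMatrix, Preadditive.add_comp, Preadditive.comp_add, Finset.sum_add_distrib]

theorem mapMatrix_sub {ι κ : Type} [Fintype ι] [Fintype κ] {M : C}
    (a b : ι → κ → (F.obj M ⟶ F.obj M)) :
    mapMatrix F a - mapMatrix F b = mapMatrix F fun i k => a i k - b i k := by
  simp only [mapMatrix, Preadditive.sub_comp, Preadditive.comp_sub, Finset.sum_sub_distrib]

variable [F.Additive]

/-- Morphisms between the images of finite direct sums are determined by their matrix entries. -/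
theorem map_biproduct_hom_ext {ι κ : Type} [Fintype ι] [Fintype κ] {M N : C}
    {g h : F.obj (⨁ fun _ : ι => M) ⟶ F.obj (⨁ fun _ : κ => N)}
    (H : ∀ i k, F.map (biproduct.ι (fun _ : ι => M) i) ≫ g ≫
        F.map (biproduct.π (fun _ : κ => N) k) =
      F.map (biproduct.ι (fun _ : ι => M) i) ≫ h ≫ F.map (biproduct.π (fun _ : κ => N) k)) :
    g = h := by
  have total : ∀ {ι : Type} [Fintype ι] (M : C), 𝟙 (F.obj (⨁ fun _ : ι => M)) =
      ∑ i, F.map (biproduct.π (fun _ : ι => M) i) ≫ F.map (biproduct.ι (fun _ : ι => M) i) := by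
    intro ι _ M
    simp only [← F.map_comp, ← F.map_sum]
    rw [biproduct.total, F.map_id]
  have key : ∀ g : F.obj (⨁ fun _ : ι => M) ⟶ F.obj (⨁ fun _ : κ => N), g = ∑ i, ∑ k,
      F.map (biproduct.π (fun _ : ι => M) i) ≫ (F.map (biproduct.ι (fun _ : ι => M) i) ≫ g ≫
        F.map (biproduct.π (fun _ : κ => N) k)) ≫ F.map (biproduct.ι (fun _ : κ => N) k) := by
    intro g
    conv_lhs => rw [← Category.id_comp g, ← Category.comp_id g, total, total]
    simp only [Preadditive.sum_comp, Preadditive.comp_sum, Category.assoc]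
    rw [Finset.sum_comm]
  rw [key g, key h]
  simp only [H]

theorem map_ι_map_π {ι : Type} [Fintype ι] [DecidableEq ι] (M : C) (i k : ι) :
    F.map (biproduct.ι (fun _ : ι => M) i) ≫ F.map (biproduct.π (fun _ : ι => M) k) =
      if i = k then 𝟙 _ else 0 := by
  rw [← F.map_comp]
  split_ifs with h
  · subst h
    rw [biproduct.ι_π_self, F.map_id]
  · rw [biproduct.ι_π_ne _ h, F.map_zero]

theorem ι_mapMatrix {ι κ : Type} [Fintype ι] [Fintype κ] {M : C}
    (a : ι → κ → (F.obj M ⟶ F.obj M)) (i : ι) :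
    F.map (biproduct.ι (fun _ : ι => M) i) ≫ mapMatrix F a =
      ∑ k, a i k ≫ F.map (biproduct.ι (fun _ : κ => M) k) := by
  classical
  simp only [mapMatrix, Preadditive.comp_sum, ← Category.assoc, map_ι_map_π]
  rw [Finset.sum_eq_single i]
  · simp
  · intro k _ hk
    simp [hk.symm]
  · simp

theorem ι_mapMatrix_π {ι κ : Type} [Fintype ι] [Fintype κ] {M : C}
    (a : ι → κ → (F.obj M ⟶ F.obj M)) (i : ι) (k : κ) :
    F.map (biproduct.ι (fun _ : ι => M) i) ≫ mapMatrix F a ≫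
        F.map (biproduct.π (fun _ : κ => M) k) =
      a i k := by
  classical
  rw [← Category.assoc, ι_mapMatrix, Preadditive.sum_comp, Finset.sum_eq_single k]
  · rw [Category.assoc, map_ι_map_π, if_pos rfl, Category.comp_id]
  · intro k' _ hk
    rw [Category.assoc, map_ι_map_π, if_neg hk, comp_zero]
  · simp

theorem mapMatrix_comp {ι κ μ : Type} [Fintype ι] [Fintype κ] [Fintype μ] {M : C}
    (a : ι → κ → (F.obj M ⟶ F.obj M)) (b : κ → μ → (F.obj M ⟶ F.obj M)) :
    mapMatrix F a ≫ mapMatrix F b = mapMatrix F fun i k => ∑ j, a i j ≫ b j k := by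
  refine map_biproduct_hom_ext F fun i k => ?_
  rw [ι_mapMatrix_π, Category.assoc, ← Category.assoc _ (mapMatrix F a), ι_mapMatrix,
    Preadditive.sum_comp]
  refine Finset.sum_congr rfl fun j _ => ?_
  rw [Category.assoc, ι_mapMatrix_π]

theorem map_matrix {ι κ : Type} [Fintype ι] [Fintype κ] {M : C} (a : ι → κ → (M ⟶ M)) :
    F.map (biproduct.matrix a : (⨁ fun _ => M) ⟶ ⨁ fun _ => M) =
      mapMatrix F fun i k => F.map (a i k) := by
  refine map_biproduct_hom_ext F fun i k => ?_
  rw [ι_mapMatrix_π, ← F.map_comp, ← F.map_comp, biproduct.matrix_π, biproduct.ι_desc]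

theorem mapMatrix_one {ι : Type} [Fintype ι] [DecidableEq ι] {M : C} :
    mapMatrix F (fun i k : ι => if i = k then 𝟙 (F.obj M) else 0) = 𝟙 _ := by
  refine map_biproduct_hom_ext F fun i k => ?_
  rw [ι_mapMatrix_π, Category.id_comp, map_ι_map_π]

variable (M : C) (δ : Fin n → End M) (hδ : ∀ i j, Commute (δ i) (δ j))

/-- The image under `F` of the Koszul complex. -/
noncomputable abbrev mapKoszul : CochainComplex C' ℤ :=
  (F.mapHomologicalComplex _).obj (koszulChainComplex M δ hδ)

variable {M δ} (σ : Fin n → End (F.obj M))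

/-- The homotopy operator `x τ_s^∨ ↦ σ_j(x) τ_j^∨ ∧ τ_s^∨`. -/
noncomputable def contraction (j : Fin n) (r r' : ℤ) :
    (mapKoszul F M δ hδ).X r ⟶ (mapKoszul F M δ hδ).X r' :=
  mapMatrix F fun (s : Subsets n (-r)) (s' : Subsets n (-r')) =>
    wedgeEntry (E := End (F.obj M)) j (σ j) s.1 s'.1

theorem contraction_eq_zero (j : Fin n) (r r' : ℤ) (h : ¬ (ComplexShape.up ℤ).Rel r' r) :
    contraction F hδ σ j r r' = 0 := by
  refine map_biproduct_hom_ext F fun s s' => ?_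
  refine (ι_mapMatrix_π F _ s s').trans (Eq.trans ?_
    (show 0 = F.map _ ≫ (0 : F.obj (⨁ fun _ => M) ⟶ F.obj (⨁ fun _ => M)) ≫ F.map _ by
      rw [zero_comp, comp_zero]))
  refine wedgeEntry_eq_zero (E := End (F.obj M)) j _ fun hs => h ?_
  have h1 := s.2
  have h2 := s'.2
  rw [ComplexShape.up_Rel]
  omega

variable (δ) in
/-- Multiplication by `1 - δ_j σ_j` on the components `τ_s^∨` with `j ∉ s`, and `0` on the other
ones. -/
noncomputable def remainderEntry (j : Fin n) (s s' : Finset (Fin n)) : F.obj M ⟶ F.obj M :=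
  if s = s' then (if j ∈ s then 0 else 𝟙 _ - σ j ≫ F.map (δ j)) else 0

/-- The endomorphism `1 - (d h + h d)` of the Koszul complex, where `h` is the homotopy operator
`contraction F hδ σ j`. -/
noncomputable def remainderMap (j : Fin n) : mapKoszul F M δ hδ ⟶ mapKoszul F M δ hδ :=
  𝟙 _ - Homotopy.nullHomotopicMap (contraction F hδ σ j)

/-- `remainderMap` is homotopic to the identity. -/
noncomputable def homotopyRemainderMap (j : Fin n) :
    Homotopy (𝟙 (mapKoszul F M δ hδ)) (remainderMap F hδ σ j) :=
  Homotopy.equivSubZero.symm ((Homotopy.ofEq (by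
    rw [remainderMap, sub_sub_cancel])).trans
      (Homotopy.nullHomotopy _ (contraction_eq_zero F hδ σ j)))

variable (hσ : ∀ j, F.map (δ j) ≫ σ j = 𝟙 _)
  (hσ' : ∀ i j, i ≠ j → F.map (δ i) ≫ σ j = σ j ≫ F.map (δ i))

theorem mapKoszul_d (r r' : ℤ) : (mapKoszul F M δ hδ).d r r' = mapMatrix F
    fun (s : Subsets n (-r)) (s' : Subsets n (-r')) =>
      koszulEntry (E := End (F.obj M)) (fun j => F.map (δ j)) s'.1 s.1 := by
  refine (map_matrix F _).trans ?_
  simp only [map_koszulHom]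

theorem mapKoszul_d_comp_contraction (j : Fin n) (r r' r'' : ℤ) (h : r + 1 = r') :
    (mapKoszul F M δ hδ).d r r' ≫ contraction F hδ σ j r' r'' = mapMatrix F
      fun (s : Subsets n (-r)) (s'' : Subsets n (-r'')) => show End (F.obj M) from
        ∑ s', wedgeEntry (E := End (F.obj M)) j (σ j) s' s''.1 *
          koszulEntry (E := End (F.obj M)) (fun j => F.map (δ j)) s' s.1 := by
  rw [mapKoszul_d]
  refine (mapMatrix_comp F _ _).trans ?_
  congr 1
  funext s s''
  refine sum_subsets (-r') (fun s' => wedgeEntry (E := End (F.obj M)) j (σ j) s' s''.1 *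
    koszulEntry (E := End (F.obj M)) (fun j => F.map (δ j)) s' s.1) fun s' hs' => ?_
  by_contra hc
  refine hs' ?_
  rw [koszulEntry_eq_zero, mul_zero]
  have := s.2
  omega

theorem contraction_comp_mapKoszul_d (j : Fin n) (r r' r'' : ℤ) (h : r' + 1 = r) :
    contraction F hδ σ j r r' ≫ (mapKoszul F M δ hδ).d r' r'' = mapMatrix F
      fun (s : Subsets n (-r)) (s'' : Subsets n (-r'')) => show End (F.obj M) from
        ∑ s', koszulEntry (E := End (F.obj M)) (fun j => F.map (δ j)) s''.1 s' *
          wedgeEntry (E := End (F.obj M)) j (σ j) s.1 s' := by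
  rw [mapKoszul_d]
  refine (mapMatrix_comp F _ _).trans ?_
  congr 1
  funext s s''
  refine sum_subsets (-r') (fun s' => koszulEntry (E := End (F.obj M))
      (fun j => F.map (δ j)) s''.1 s' *
    wedgeEntry (E := End (F.obj M)) j (σ j) s.1 s') fun s' hs' => ?_
  by_contra hc
  refine hs' ?_
  rw [wedgeEntry_eq_zero, mul_zero]
  have := s.2
  omega

include hσ hσ' in
/-- By `wedgeEntry_koszulEntry`, the matrix of `remainderMap` is diagonal. -/
theorem remainderMap_f (j : Fin n) (r : ℤ) : (remainderMap F hδ σ j).f r =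
    mapMatrix F fun (s s' : Subsets n (-r)) => remainderEntry F δ σ j s.1 s'.1 := by
  classical
  rw [remainderMap, HomologicalComplex.sub_f_apply, Homotopy.nullHomotopicMap_f
    (k₂ := r - 1) (k₁ := r) (k₀ := r + 1) (by simp) (by simp),
    mapKoszul_d_comp_contraction _ _ _ _ _ _ _ rfl,
    contraction_comp_mapKoszul_d _ _ _ _ _ _ _ (by omega)]
  refine (congrArg₂ (· - ·) (mapMatrix_one F).symm (mapMatrix_add F _ _)).trans
    ((mapMatrix_sub F _ _).trans ?_)
  congr 1
  funext s s'
  have h1 := wedgeEntry_koszulEntry (E := End (F.obj M)) (fun i => F.map (δ i)) j (σ j) (hσ j)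
    (fun i hi => hσ' i j hi) s.1 s'.1
  refine (congrArg ((if s = s' then 𝟙 (F.obj M) else 0) - ·) h1).trans ?_
  rw [remainderEntry]
  by_cases h : s = s'
  · subst h
    rw [if_pos rfl, if_pos rfl, if_pos rfl]
    split_ifs
    · exact sub_self _
    · rfl
  · rw [if_neg h, if_neg (fun h' => h (Subtype.ext h')), if_neg (fun h' => h (Subtype.ext h')),
      sub_zero]

/-- The composite of the `remainderMap F hδ σ j` for `j` in a list. -/
noncomputable def remainderList : List (Fin n) → (mapKoszul F M δ hδ ⟶ mapKoszul F M δ hδ)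
  | [] => 𝟙 _
  | j :: L => remainderMap F hδ σ j ≫ remainderList L

/-- `remainderList` is homotopic to the identity. -/
noncomputable def homotopyRemainderList :
    (L : List (Fin n)) → Homotopy (𝟙 (mapKoszul F M δ hδ)) (remainderList F hδ σ L)
  | [] => Homotopy.refl _
  | j :: L => (homotopyRemainderMap F hδ σ j).trans
      ((Homotopy.ofEq (Category.comp_id _).symm).trans
        ((homotopyRemainderList L).compLeft (remainderMap F hδ σ j)))

variable (δ) in
/-- The composite of the `1 - δ_j σ_j` for `j` in a list. -/
noncomputable def remainderHom : List (Fin n) → (F.obj M ⟶ F.obj M)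
  | [] => 𝟙 _
  | j :: L => (𝟙 _ - σ j ≫ F.map (δ j)) ≫ remainderHom L

include hσ hσ' in
/-- Composing the `remainderMap` over `j ∈ L` kills all components `τ_s^∨` for which `s` meets `L`.
So for the list of all indices only the component with `s = ∅` survives. -/
theorem remainderList_f (L : List (Fin n)) (r : ℤ) : (remainderList F hδ σ L).f r =
    mapMatrix F fun (s s' : Subsets n (-r)) =>
      if s = s' then (if ∃ j ∈ L, j ∈ s.1 then 0 else remainderHom F δ σ L) else 0 := by
  classical
  induction L with
  | nil =>
    refine (mapMatrix_one F).symm.trans ?_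
    congr 1
    funext s s'
    simp [remainderHom]
  | cons j L ih =>
    rw [remainderList, HomologicalComplex.comp_f, remainderMap_f F hδ σ hσ hσ', ih]
    refine (mapMatrix_comp F _ _).trans ?_
    congr 1
    funext s s''
    rw [Finset.sum_eq_single s]
    · rw [remainderEntry, if_pos rfl]
      by_cases h : s = s''
      · rw [if_pos h, if_pos h]
        by_cases hj : j ∈ s.1
        · simp [hj]
        · by_cases hL : ∃ i ∈ L, i ∈ s.1
          · have hL' : ∃ i ∈ j :: L, i ∈ s.1 :=
              hL.imp fun i hi => ⟨List.mem_cons_of_mem _ hi.1, hi.2⟩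
            rw [if_pos hL, if_pos hL', comp_zero]
          · rw [if_neg hL, if_neg hj, if_neg, remainderHom]
            rintro ⟨i, hi, hi'⟩
            rcases List.mem_cons.1 hi with rfl | hi
            · exact hj hi'
            · exact hL ⟨i, hi, hi'⟩
      · rw [if_neg h, if_neg h, comp_zero]
    · intro s' _ hs'
      rw [remainderEntry, if_neg (fun h => hs' (Subtype.ext h.symm)), zero_comp]
    · simp

/-- The empty set, as an index of the degree `0` term of the complex `koszulChainComplex`. -/
def emptySubset (n : ℕ) : Subsets n (-0) := ⟨∅, by simp⟩

theorem eq_emptySubset (s : Subsets n (-0)) : s = emptySubset n :=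
  Subtype.ext (Finset.card_eq_zero.1 (by have := s.2; omega))

include hσ hσ' in
theorem remainderList_finRange_f_of_ne (r : ℤ) (hr : r ≠ 0) :
    (remainderList F hδ σ (List.finRange n)).f r = 0 := by
  refine (remainderList_f F hδ σ hσ hσ' _ r).trans (map_biproduct_hom_ext F fun s s' => ?_)
  have h : ∃ j ∈ List.finRange n, j ∈ s.1 := by
    obtain ⟨j, hj⟩ := Finset.card_pos.1 (show 0 < s.1.card by have := s.2; omega)
    exact ⟨j, List.mem_finRange j, hj⟩
  rw [ι_mapMatrix_π, if_pos h, ite_self]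
  exact (show F.map _ ≫ (0 : F.obj (⨁ fun _ => M) ⟶ F.obj (⨁ fun _ => M)) ≫ F.map _ = 0 by
    rw [zero_comp, comp_zero]).symm

variable [HasZeroObject C] [HasZeroObject C'] {Y : C}
  (π : koszulChainComplex M δ hδ ⟶ (HomologicalComplex.single C (ComplexShape.up ℤ) 0).obj Y)

/-- The degree `0` component `M ⟶ Y` of a morphism to a complex in degree `0`. -/
noncomputable def augmentation : M ⟶ Y :=
  biproduct.ι (fun _ : Subsets n (-0) => M) (emptySubset n) ≫ π.f 0 ≫
    (HomologicalComplex.singleObjXSelf (ComplexShape.up ℤ) 0 Y).hom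

/-- The morphism of complexes given by a morphism from `F(Y)` to the degree `0` term. -/
noncomputable def sectionMap (l : F.obj Y ⟶ F.obj M) :
    (F.mapHomologicalComplex _).obj ((HomologicalComplex.single C (ComplexShape.up ℤ) 0).obj Y) ⟶
      mapKoszul F M δ hδ :=
  (HomologicalComplex.singleMapHomologicalComplex F (ComplexShape.up ℤ) 0).hom.app Y ≫
    HomologicalComplex.mkHomFromSingle
      (l ≫ F.map (biproduct.ι (fun _ : Subsets n (-0) => M) (emptySubset n))) fun r hr => by
        refine IsZero.eq_of_tgt (F.map_isZero ?_) _ _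
        rw [IsZero.iff_id_eq_zero]
        refine biproduct.hom_ext' _ _ fun s => ?_
        have := s.2
        have h : (0 : ℤ) + 1 = r := hr
        omega

theorem sectionMap_f_zero (l : F.obj Y ⟶ F.obj M) : (sectionMap F hδ l).f 0 =
    F.map (HomologicalComplex.singleObjXSelf (ComplexShape.up ℤ) 0 Y).hom ≫ l ≫
      F.map (biproduct.ι (fun _ : Subsets n (-0) => M) (emptySubset n)) := by
  rw [sectionMap, HomologicalComplex.comp_f,
    HomologicalComplex.singleMapHomologicalComplex_hom_app_self]
  refine (congrArg (_ ≫ ·) (HomologicalComplex.mkHomFromSingle_f _ _)).trans ?_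
  exact (Category.assoc _ _ _).trans (congrArg (_ ≫ ·) (Iso.inv_hom_id_assoc _ _))

include hσ hσ' in
/-- If moreover the degree `0` part of a morphism `π` to a complex concentrated in degree `0` has,
after application of `F`, a section `l` such that `π l` is the composite of the `1 - δ_j σ_j`, then
`F(π)` is a homotopy equivalence. -/
theorem exists_homotopyEquiv_of_contraction (l : F.obj Y ⟶ F.obj M)
    (h1 : l ≫ F.map (augmentation hδ π) = 𝟙 _)
    (h2 : F.map (augmentation hδ π) ≫ l = remainderHom F δ σ (List.finRange n)) :
    ∃ e : HomotopyEquiv (mapKoszul F M δ hδ) ((F.mapHomologicalComplex _).obj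
      ((HomologicalComplex.single C (ComplexShape.up ℤ) 0).obj Y)),
        e.hom = (F.mapHomologicalComplex _).map π := by
  have zero : ∀ r : ℤ, r ≠ 0 → IsZero (((F.mapHomologicalComplex (ComplexShape.up ℤ)).obj
      ((HomologicalComplex.single C (ComplexShape.up ℤ) 0).obj Y)).X r) := fun r hr =>
    F.map_isZero (HomologicalComplex.isZero_single_obj_X _ _ _ _ hr)
  have hπ : F.map (biproduct.ι (fun _ : Subsets n (-0) => M) (emptySubset n)) ≫ F.map (π.f 0) =
      F.map (augmentation hδ π) ≫
        F.map (HomologicalComplex.singleObjXSelf (ComplexShape.up ℤ) 0 Y).inv := by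
    have key : ∀ i : M ⟶ (koszulChainComplex M δ hδ).X 0, F.map i ≫ F.map (π.f 0) =
        F.map (i ≫ π.f 0 ≫ (HomologicalComplex.singleObjXSelf (ComplexShape.up ℤ) 0 Y).hom) ≫
          F.map (HomologicalComplex.singleObjXSelf (ComplexShape.up ℤ) 0 Y).inv := by
      intro i
      rw [← F.map_comp, ← F.map_comp, Category.assoc, Category.assoc, Iso.hom_inv_id,
        Category.comp_id]
    exact key _
  have assoc₁ : ∀ {A₁ A₂ A₃ A₄ A₅ A₆ A₇ : C'} (a : A₁ ⟶ A₂) (b : A₂ ⟶ A₃) (c : A₃ ⟶ A₄)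
      (d : A₄ ⟶ A₅) (e : A₅ ⟶ A₆) (g : A₆ ⟶ A₇),
      a ≫ (b ≫ c ≫ d ≫ e) ≫ g = ((a ≫ b) ≫ c) ≫ d ≫ e ≫ g := by
    intros
    simp only [Category.assoc]
  have assoc₂ : ∀ {A₁ A₂ A₃ A₄ A₅ : C'} (a : A₁ ⟶ A₂) (b : A₂ ⟶ A₃) (c : A₃ ⟶ A₄)
      (d : A₄ ⟶ A₅), (a ≫ b ≫ c) ≫ d = a ≫ b ≫ c ≫ d := by
    intros
    simp only [Category.assoc]
  refine ⟨⟨(F.mapHomologicalComplex _).map π, sectionMap F hδ l, ?_, ?_⟩, rfl⟩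
  · refine (Homotopy.ofEq ?_).trans (homotopyRemainderList F hδ σ (List.finRange n)).symm
    ext r
    by_cases hr : r = 0
    · subst hr
      rw [remainderList_f F hδ σ hσ hσ', HomologicalComplex.comp_f, sectionMap_f_zero]
      refine map_biproduct_hom_ext F fun s s' => ?_
      rw [ι_mapMatrix_π, eq_emptySubset s, eq_emptySubset s', if_pos rfl,
        if_neg (by simp [emptySubset]), ← h2]
      refine (assoc₁ _ (F.map (π.f 0)) _ _ _ _).trans ?_
      refine (congrArg (fun x => (x ≫ F.map (HomologicalComplex.singleObjXSelf _ 0 Y).hom) ≫ l ≫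
        F.map (biproduct.ι (fun _ : Subsets n (-0) => M) (emptySubset n)) ≫
          F.map (biproduct.π (fun _ : Subsets n (-0) => M) (emptySubset n))) hπ).trans ?_
      rw [map_ι_map_π, if_pos rfl, Category.comp_id, Category.assoc, Category.assoc,
        Iso.map_inv_hom_id_assoc]
    · rw [remainderList_finRange_f_of_ne F hδ σ hσ hσ' r hr, HomologicalComplex.comp_f,
        (zero r hr).eq_of_src ((sectionMap F hδ l).f r) 0, comp_zero]
  · refine Homotopy.ofEq ?_
    ext r
    by_cases hr : r = 0
    · subst hr
      rw [HomologicalComplex.comp_f, sectionMap_f_zero]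
      refine (assoc₂ _ _ _ (F.map (π.f 0))).trans ?_
      refine (congrArg (fun x => F.map (HomologicalComplex.singleObjXSelf _ 0 Y).hom ≫ l ≫ x)
        hπ).trans ?_
      rw [reassoc_of% h1, ← F.map_comp, Iso.hom_inv_id]
      exact F.map_id _
    · exact (zero r hr).eq_of_src _ _

end Contraction

/-! ### Exactness of sequences of sheaves of modules -/

section ToSheaf
variable {X : Type u} [TopologicalSpace X] (D : Sheaf (Opens.grothendieckTopology X) RingCat.{u})

/-- An epimorphism of sheaves of modules is an epimorphism of sheaves of abelian groups: the
presheaf cokernel has zero associated sheaf of modules, hence zero associated sheaf. -/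
instance : (SheafOfModules.toSheaf.{u} D).PreservesEpimorphisms where
  preserves {A B} e he := by
    let adj := PresheafOfModules.sheafificationAdjunction (𝟙 D.obj)
    let L := PresheafOfModules.sheafification (𝟙 D.obj)
    let G := SheafOfModules.forget D ⋙ PresheafOfModules.restrictScalars (𝟙 D.obj)
    have : G.Full := inferInstance
    have : G.Faithful := inferInstance
    have hL : Epi (L.map (G.map e)) := by
      have h : L.map (G.map e) ≫ adj.counit.app B = adj.counit.app A ≫ e := adj.counit.naturality e
      have : L.map (G.map e) = adj.counit.app A ≫ e ≫ inv (adj.counit.app B) := by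
        rw [← reassoc_of% h, IsIso.hom_inv_id, Category.comp_id]
      rw [this]
      infer_instance
    have : L.IsLeftAdjoint := adj.isLeftAdjoint
    have : L.Additive := Functor.additive_of_preserves_binary_products L
    have hQ : IsZero (L.obj (cokernel (G.map e))) :=
      (isZero_cokernel_of_epi (L.map (G.map e))).of_iso (PreservesCokernel.iso L (G.map e))
    let E := PresheafOfModules.toPresheaf D.obj ⋙
      presheafToSheaf (Opens.grothendieckTopology X) AddCommGrpCat.{u}
    have hE : IsZero (E.obj (cokernel (G.map e))) := (SheafOfModules.toSheaf.{u} D).map_isZero hQ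
    have : PreservesFiniteColimits E := inferInstance
    have h1 : Epi (E.map (G.map e)) :=
      Preadditive.epi_of_isZero_cokernel _ (hE.of_iso (PreservesCokernel.iso E (G.map e)).symm)
    have h2 : Epi ((SheafOfModules.toSheaf.{u} D).map (L.map (G.map e))) := h1
    have h : (SheafOfModules.toSheaf.{u} D).map e = (SheafOfModules.toSheaf.{u} D).map
        (inv (adj.counit.app A)) ≫ (SheafOfModules.toSheaf.{u} D).map (L.map (G.map e)) ≫
          (SheafOfModules.toSheaf.{u} D).map (adj.counit.app B) := by
      have h : L.map (G.map e) ≫ adj.counit.app B = adj.counit.app A ≫ e := adj.counit.naturality e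
      rw [← Functor.map_comp, h, ← Functor.map_comp, IsIso.inv_hom_id_assoc]
    rw [h]
    infer_instance

instance : (SheafOfModules.toSheaf.{u} D).PreservesHomology :=
  Functor.preservesHomology_of_preservesEpis_and_kernels (SheafOfModules.toSheaf.{u} D)

end ToSheaf

/-! ### The augmentation of the Spencer complex -/

section Extend
variable (p m : ℕ) {X S : Scheme.{u}} {f : X ⟶ S} {n : ℕ} {t : Fin n → Γ(X, ⊤)}
  (ht : IsCoordinates f t)

/-- The presheaf of differential operators, as a presheaf of abelian groups. -/
noncomputable abbrev diffAddPresheaf : (Opens X)ᵒᵖ ⥤ AddCommGrpCat.{u} :=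
  diffPresheaf p m ht ⋙ forget₂ RingCat.{u} AddCommGrpCat.{u}

/-- The additive functor that forgets the module structure. -/
noncomputable abbrev toAddSheaf :
    SheafOfModules.{u} (diffSheaf p m ht) ⥤
      Sheaf (Opens.grothendieckTopology X) AddCommGrpCat.{u} :=
  SheafOfModules.toSheaf (diffSheaf p m ht)

/-- The morphism `toDiffSheaf` of the underlying presheaves of abelian groups. -/
noncomputable def toDiffAddSheaf : diffAddPresheaf p m ht ⟶
    ((toAddSheaf p m ht).obj (SheafOfModules.unit (diffSheaf p m ht))).obj :=
  Functor.whiskerRight (toDiffSheaf p m ht) (forget₂ RingCat.{u} AddCommGrpCat.{u})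

instance : Presheaf.IsLocallyInjective (Opens.grothendieckTopology X) (toDiffAddSheaf p m ht) :=
  ⟨fun x y h => Presheaf.equalizerSieve_mem (Opens.grothendieckTopology X)
      (toDiffSheaf p m ht) x y h⟩

instance : Presheaf.IsLocallySurjective (Opens.grothendieckTopology X) (toDiffAddSheaf p m ht) :=
  ⟨fun x => Presheaf.imageSieve_mem (Opens.grothendieckTopology X) (toDiffSheaf p m ht) x⟩

variable {A : Sheaf (Opens.grothendieckTopology X) AddCommGrpCat.{u}}

/-- The morphism from the presheaf of differential operators to the associated sheaf becomes
invertible after sheafification; hence additive morphisms from the sheaf to a sheaf may be defined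
and compared on the presheaf. -/
theorem toDiffAddSheaf_W : (Opens.grothendieckTopology X).W (toDiffAddSheaf p m ht) :=
  GrothendieckTopology.W_of_isLocallyBijective _ _

/-- The homomorphism from the presheaf of differential operators to the associated sheaf, on
sections. -/
noncomputable def toDiff (U : X.Opens) :
    DiffRing p m ht U →+* (diffSheaf p m ht).obj.obj (op U) :=
  ((toDiffSheaf p m ht).app (op U)).hom

/-- The extension of a morphism from the presheaf of differential operators to a sheaf. -/
noncomputable def extendHom (g : diffAddPresheaf p m ht ⟶ A.obj) :
    (toAddSheaf p m ht).obj (SheafOfModules.unit (diffSheaf p m ht)) ⟶ A :=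
  ⟨((toDiffAddSheaf_W p m ht).homEquiv A.obj A.property).symm g⟩

theorem toDiffAddSheaf_extendHom (g : diffAddPresheaf p m ht ⟶ A.obj) :
    toDiffAddSheaf p m ht ≫ (extendHom p m ht g).hom = g :=
  ((toDiffAddSheaf_W p m ht).homEquiv A.obj A.property).apply_symm_apply g

theorem hom_ext_of_toDiffAddSheaf
    {a b : (toAddSheaf p m ht).obj (SheafOfModules.unit (diffSheaf p m ht)) ⟶ A}
    (h : toDiffAddSheaf p m ht ≫ a.hom = toDiffAddSheaf p m ht ≫ b.hom) : a = b :=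
  Sheaf.hom_ext (((toDiffAddSheaf_W p m ht).homEquiv A.obj A.property).injective h)

/-- Functions, as sections of `structModule`. -/
noncomputable def structSec (U : X.Opens) : Γ(X, U) ≃+ Sec (structModule p m ht) U :=
  AddEquiv.refl _

theorem toDiffSheaf_smul (U : X.Opens) (P : DiffRing p m ht U) (a : Γ(X, U)) :
    toDiff p m ht U P • structSec p m ht U a =
      structSec p m ht U (DiffRing.toEnd p m ht U P a) := by
  have h := PresheafOfModules.Sheafify.map_smul_eq (toDiffSheaf p m ht) (structPresheafHom p m ht)
    (toDiff p m ht U P) a (𝟙 (op U)) P (by simp; rfl) a (by simp; rfl)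
  rw [CategoryTheory.Functor.map_id] at h
  exact h

/-- The restriction of the global section `∂_j^{⟨p^m⟩}`. -/
theorem ringRes_delTop (U : X.Opens) (j : Fin n) :
    ringRes (diffSheaf p m ht) (le_top : U ≤ ⊤) (delTop p m ht j) =
      toDiff p m ht U (DiffRing.del p m ht U j (p ^ m)) := by
  rw [← DiffRing.res_del p m ht (le_top : U ≤ ⊤)]
  exact (ConcreteCategory.congr_hom ((toDiffSheaf p m ht).naturality (homOfLE le_top).op)
    (DiffRing.del p m ht ⊤ j (p ^ m))).symm

/-- The morphism `D → O_X`, `P ↦ P(t^i)`. -/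
noncomputable def evalHom (i : SmallExp p m n) :
    SheafOfModules.unit (diffSheaf p m ht) ⟶ structModule p m ht :=
  (structModule p m ht).unitHomEquiv.symm (PresheafOfModules.sectionsMk
    (fun U => structSec p m ht U.unop (monomial t U.unop i.toExp)) fun _ V g =>
      congrArg (structSec p m ht V.unop) (res_monomial g.unop.le i.toExp))

theorem homSec_evalHom_one (i : SmallExp p m n) (U : X.Opens) :
    homSec (evalHom p m ht i) U (1 : (diffSheaf p m ht).obj.obj (op U)) =
      structSec p m ht U (monomial t U i.toExp) := by
  refine ((structModule p m ht).unitHomEquiv_apply_coe (evalHom p m ht i) (op U)).symm.trans ?_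
  rw [evalHom, Equiv.apply_symm_apply]
  rfl

theorem homSec_evalHom (i : SmallExp p m n) (U : X.Opens) (P : DiffRing p m ht U) :
    homSec (evalHom p m ht i) U (toDiff p m ht U P) =
      structSec p m ht U (evalMonomials p m ht U P i) := by
  have h := homSec_smul (evalHom p m ht i) U (toDiff p m ht U P)
    (1 : (diffSheaf p m ht).obj.obj (op U))
  rw [homSec_evalHom_one, toDiffSheaf_smul] at h
  rw [← mul_one (toDiff p m ht U P)]
  exact h

/-- The endomorphism `P ↦ P ∂_j^{⟨p^m⟩}` of `D`. -/
noncomputable abbrev mulDel (j : Fin n) :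
    SheafOfModules.unit (diffSheaf p m ht) ⟶ SheafOfModules.unit (diffSheaf p m ht) :=
  rightMulEnd (delTop p m ht j)

theorem homSec_mulDel (j : Fin n) (U : X.Opens) (P : DiffRing p m ht U) :
    homSec (mulDel p m ht j) U
      (toDiff p m ht U P) =
        toDiff p m ht U (P * DiffRing.del p m ht U j (p ^ m)) := by
  rw [RingHom.map_mul, ← ringRes_delTop]
  rfl

theorem toAddSheaf_hom_ext {M : SheafOfModules.{u} (diffSheaf p m ht)}
    {a b : (toAddSheaf p m ht).obj (SheafOfModules.unit (diffSheaf p m ht)) ⟶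
      (toAddSheaf p m ht).obj M}
    (h : ∀ (U : X.Opens) (P : DiffRing p m ht U),
      (a.hom.app (op U)).hom (toDiff p m ht U P) =
        (b.hom.app (op U)).hom (toDiff p m ht U P)) : a = b :=
  hom_ext_of_toDiffAddSheaf p m ht (NatTrans.ext (funext fun U =>
    AddCommGrpCat.hom_ext (AddMonoidHom.ext fun P => h U.unop P)))

theorem mulDel_comp_evalHom (j : Fin n) (i : SmallExp p m n) :
    mulDel p m ht j ≫ evalHom p m ht i = 0 := by
  refine (toAddSheaf p m ht).map_injective (toAddSheaf_hom_ext p m ht fun U P => ?_)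
  refine (congrArg (homSec (evalHom p m ht i) U) (homSec_mulDel p m ht j U P)).trans ?_
  rw [homSec_evalHom, evalMonomials_mul_del]
  rfl

/-- The `i`-th component of `interpolate`, as a morphism of sheaves. -/
noncomputable def interpolateHom (i : SmallExp p m n) :
    (toAddSheaf p m ht).obj (structModule p m ht) ⟶
      (toAddSheaf p m ht).obj (SheafOfModules.unit (diffSheaf p m ht)) :=
  ⟨(show (addSheaf X).obj ⟶ diffAddPresheaf p m ht from
    { app := fun U => AddCommGrpCat.ofHom ((interpolate p m ht U.unop).comp
        (AddMonoidHom.single (fun _ : SmallExp p m n => Γ(X, U.unop)) i))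
      naturality := fun U V g => AddCommGrpCat.hom_ext (AddMonoidHom.ext fun a => by
        refine Eq.trans ?_ (res_interpolate p m ht g.unop.le (Pi.single i a)).symm
        refine congrArg (interpolate p m ht V.unop) (funext fun r => ?_)
        exact (Pi.apply_single (fun _ => res g.unop.le) (fun _ => map_zero _) i a r).symm) }) ≫
    toDiffAddSheaf p m ht⟩

variable {p} [Fact p.Prime] (hU : ∀ U : X.Opens, IsNilpotent (p : Γ(X, U)))

/-- Division by `∂_j^{⟨p^m⟩}` on the right, on the sheaf of differential operators. -/
noncomputable def divDelHom (j : Fin n) :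
    End ((toAddSheaf p m ht).obj (SheafOfModules.unit (diffSheaf p m ht))) :=
  extendHom p m ht ((show diffAddPresheaf p m ht ⟶ diffAddPresheaf p m ht from
    { app := fun U => AddCommGrpCat.ofHom (divDel m ht U.unop (hU U.unop) j)
      naturality := fun U V g => AddCommGrpCat.hom_ext (AddMonoidHom.ext fun P =>
        (res_divDel m ht (hU U.unop) (hU V.unop) g.unop.le j P).symm) }) ≫ toDiffAddSheaf p m ht)

theorem divDelHom_app (j : Fin n) (U : X.Opens) (P : DiffRing p m ht U) :
    ((divDelHom m ht hU j).hom.app (op U)).hom (toDiff p m ht U P) =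
      toDiff p m ht U (divDel m ht U (hU U) j P) :=
  ConcreteCategory.congr_hom (NatTrans.congr_app (toDiffAddSheaf_extendHom p m ht _) (op U)) P

end Extend

section Augmentation
variable (p m : ℕ) {X S : Scheme.{u}} {f : X ⟶ S} {n : ℕ} {t : Fin n → Γ(X, ⊤)}
  (ht : IsCoordinates f t)

/-- An enumeration of the exponents `i` with `0 ≤ i_j < p^m`. -/
noncomputable def smallExpEquiv : Fin (p ^ (m * n)) ≃ SmallExp p m n :=
  (Fintype.equivFinOfCardEq (by rw [Fintype.card_fun, Fintype.card_fin, Fintype.card_fin,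
      pow_mul])).symm

/-- The morphism `D → O_X^{p^{mn}}`, `P ↦ (P(t^i))_i`. -/
noncomputable def evalCopies : SheafOfModules.unit (diffSheaf p m ht) ⟶
    (copies (p ^ (m * n))).obj (structModule p m ht) :=
  biproduct.lift fun k => evalHom p m ht (smallExpEquiv p m k)

theorem koszulHom_comp_eq_zero {C : Type*} [Category C] [Preadditive C] {M N : C}
    (δ : Fin n → End M) (g : M ⟶ N) (h : ∀ j, (show M ⟶ M from δ j) ≫ g = 0)
    (s s' : Finset (Fin n)) :
    koszulHom M δ s s' ≫ g = 0 := by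
  have h' : koszulHom M δ s s' =
      ∑ j, if j ∉ s ∧ s' = insert j s then koszulSign j s • (show M ⟶ M from δ j) else 0 := rfl
  rw [h', Preadditive.sum_comp]
  refine Finset.sum_eq_zero fun j _ => ?_
  split_ifs
  · rw [Preadditive.zsmul_comp, h, smul_zero]
  · rw [zero_comp]

theorem mulDel_comp_evalCopies (j : Fin n) :
    mulDel p m ht j ≫ evalCopies p m ht = 0 := by
  refine biproduct.hom_ext _ _ fun k => ?_
  refine (Category.assoc _ _ _).trans
    ((congrArg (mulDel p m ht j ≫ ·) (biproduct.lift_π _ _)).trans ?_)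
  exact (mulDel_comp_evalHom p m ht j _).trans zero_comp.symm

/-- The augmentation of the Spencer complex. -/
noncomputable def spencerAugmentation : spencer p m ht ⟶
    (CochainComplex.singleFunctor _ 0).obj ((copies (p ^ (m * n))).obj (structModule p m ht)) :=
  HomologicalComplex.mkHomToSingle
    (biproduct.desc fun _ : Subsets n (-0) => evalCopies p m ht) fun r _ => by
      refine biproduct.hom_ext' _ _ fun s => ?_
      refine (biproduct.ι_matrix_assoc _ _ _).trans ?_
      refine biproduct.lift_desc.trans (Eq.trans ?_ comp_zero.symm)
      exact Finset.sum_eq_zero fun s' _ =>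
        koszulHom_comp_eq_zero _ _ (mulDel_comp_evalCopies p m ht) _ _

theorem spencerAugmentation_f_zero : (spencerAugmentation p m ht).f 0 ≫
    (HomologicalComplex.singleObjXSelf (ComplexShape.up ℤ) 0 _).hom =
      biproduct.desc fun _ : Subsets n (-0) => evalCopies p m ht := by
  refine (congrArg (· ≫ _) (HomologicalComplex.mkHomToSingle_f _ _)).trans ?_
  exact (Category.assoc _ _ _).trans ((congrArg (_ ≫ ·) (Iso.inv_hom_id _)).trans
      (Category.comp_id _))

theorem augmentation_spencerAugmentation : augmentation
    (fun i j => rightMulEnd_commute (delTop_commute p m ht i j)) (spencerAugmentation p m ht) =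
      evalCopies p m ht := by
  refine (congrArg (_ ≫ ·) (spencerAugmentation_f_zero p m ht)).trans ?_
  exact biproduct.ι_desc _ _

/-- The section of `evalCopies` given by interpolation. -/
noncomputable def interpolateCopies :
    (toAddSheaf p m ht).obj ((copies (p ^ (m * n))).obj (structModule p m ht)) ⟶
      (toAddSheaf p m ht).obj (SheafOfModules.unit (diffSheaf p m ht)) :=
  ∑ k, (toAddSheaf p m ht).map (copiesπ _ k (structModule p m ht)) ≫
    interpolateHom p m ht (smallExpEquiv p m k)

theorem evalCopies_comp_π (k : Fin (p ^ (m * n))) :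
    evalCopies p m ht ≫ copiesπ _ k (structModule p m ht) =
      evalHom p m ht (smallExpEquiv p m k) :=
  biproduct.lift_π _ _

theorem ι_comp_interpolateCopies (k : Fin (p ^ (m * n))) :
    (toAddSheaf p m ht).map (copiesι _ k (structModule p m ht)) ≫
      interpolateCopies p m ht = interpolateHom p m ht (smallExpEquiv p m k) := by
  rw [interpolateCopies, Preadditive.comp_sum, Finset.sum_eq_single k]
  · refine (Category.assoc _ _ _).symm.trans ((congrArg (· ≫ _) ?_).trans (Category.id_comp _))
    exact (map_ι_map_π (toAddSheaf p m ht) (structModule p m ht) k k).trans (if_pos rfl)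
  · intro k' _ hk
    refine (Category.assoc _ _ _).symm.trans ((congrArg (· ≫ _) ?_).trans zero_comp)
    exact (map_ι_map_π (toAddSheaf p m ht) (structModule p m ht) k k').trans (if_neg hk.symm)
  · simp

theorem interpolateCopies_comp_evalCopies :
    interpolateCopies p m ht ≫ (toAddSheaf p m ht).map (evalCopies p m ht) = 𝟙 _ := by
  refine map_biproduct_hom_ext (toAddSheaf p m ht) fun i k => ?_
  have h : ∀ {A B C D : Sheaf (Opens.grothendieckTopology X) AddCommGrpCat.{u}} {E : _}
      (a : A ⟶ B) (b : B ⟶ C) (c : C ⟶ D) (d : D ⟶ E), a ≫ (b ≫ c) ≫ d = (a ≫ b) ≫ c ≫ d := by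
    intros
    simp only [Category.assoc]
  refine (h _ _ _ _).trans ?_
  refine (congrArg (· ≫ _) (ι_comp_interpolateCopies p m ht i)).trans ?_
  refine (congrArg (_ ≫ ·) ((Functor.map_comp _ _ _).symm.trans
    (congrArg (toAddSheaf p m ht).map (evalCopies_comp_π p m ht k)))).trans ?_
  refine Eq.trans ?_ ((congrArg (_ ≫ ·) (Category.id_comp _)).trans
    (map_ι_map_π (toAddSheaf p m ht) (structModule p m ht) i k)).symm
  refine Sheaf.hom_ext (NatTrans.ext (funext fun U => AddCommGrpCat.hom_ext
    (AddMonoidHom.ext fun a => ?_)))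
  refine (homSec_evalHom p m ht (smallExpEquiv p m k) U.unop (interpolate p m ht U.unop
    (Pi.single (smallExpEquiv p m i) a))).trans ?_
  rw [evalMonomials_interpolate]
  split_ifs with hik
  · subst hik
    exact congrArg (structSec p m ht U.unop)
      (Pi.single_eq_same (M := fun _ : SmallExp p m n => Γ(X, U.unop)) (smallExpEquiv p m i) a)
  · exact congrArg (structSec p m ht U.unop)
      (Pi.single_eq_of_ne (M := fun _ : SmallExp p m n => Γ(X, U.unop))
        (fun h' => hik ((smallExpEquiv p m).injective h').symm) a)

variable {p} [Fact p.Prime] (hU : ∀ U : X.Opens, IsNilpotent (p : Γ(X, U)))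

/-- Successive division by the `∂_j^{⟨p^m⟩}`, `j ∈ L`, leaves the terms of order `< p^m` in the
variables indexed by `L`. -/
theorem remainderHom_app (L : List (Fin n)) (U : X.Opens) (v : CoeffModule X n U) :
    ((remainderHom (toAddSheaf p m ht) (fun j => rightMulEnd (delTop p m ht j))
      (divDelHom m ht hU) L).hom.app (op U)).hom (toDiff p m ht U (ofCoeff m ht U v)) =
        toDiff p m ht U (ofCoeff m ht U (v.filter fun l => ∀ j ∈ L, l j < p ^ m)) := by
  classical
  induction L generalizing v with
  | nil =>
    refine congrArg (fun v => toDiff p m ht U (ofCoeff m ht U v)) ?_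
    exact (Finsupp.filter_eq_self_iff _ _).2 (by simp) |>.symm
  | cons j L ih =>
    have h : toDiff p m ht U (ofCoeff m ht U v) - (show (diffSheaf p m ht).obj.obj (op U) from
        homSec (mulDel p m ht j) U (((divDelHom m ht hU j).hom.app (op U)).hom
          (toDiff p m ht U (ofCoeff m ht U v)))) =
            toDiff p m ht U (ofCoeff m ht U (v.filter fun l => l j < p ^ m)) := by
      refine (congrArg (toDiff p m ht U (ofCoeff m ht U v) - ·)
        ((congrArg (homSec (mulDel p m ht j) U) (divDelHom_app m ht hU j U _)).trans
          (homSec_mulDel p m ht j U _))).trans ?_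
      exact (map_sub (toDiff p m ht U) _ _).symm.trans
        (congrArg _ (sub_divDel_mul m ht U (hU U) j v))
    refine (congrArg ((remainderHom (toAddSheaf p m ht) (fun j => rightMulEnd (delTop p m ht j))
      (divDelHom m ht hU) L).hom.app (op U)).hom h).trans ((ih _).trans ?_)
    refine congrArg (fun v => toDiff p m ht U (ofCoeff m ht U v)) ?_
    ext l
    simp only [Finsupp.filter_apply, List.forall_mem_cons]
    split_ifs <;> simp_all

theorem map_mulDel_comp_divDelHom (j : Fin n) :
    (toAddSheaf p m ht).map (mulDel p m ht j) ≫ divDelHom m ht hU j = 𝟙 _ := by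
  refine toAddSheaf_hom_ext p m ht fun U P => ?_
  refine (congrArg ((divDelHom m ht hU j).hom.app (op U)).hom (homSec_mulDel p m ht j U P)).trans ?_
  rw [divDelHom_app, divDel_mul]
  rfl

theorem map_mulDel_comp_divDelHom_of_ne {i j : Fin n} (h : i ≠ j) :
    (toAddSheaf p m ht).map (mulDel p m ht i) ≫ divDelHom m ht hU j =
      divDelHom m ht hU j ≫ (toAddSheaf p m ht).map (mulDel p m ht i) := by
  refine toAddSheaf_hom_ext p m ht fun U P => ?_
  refine (congrArg ((divDelHom m ht hU j).hom.app (op U)).hom (homSec_mulDel p m ht i U P)).trans ?_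
  rw [divDelHom_app, divDel_mul_of_ne m ht U (hU U) h.symm]
  exact ((congrArg (homSec (mulDel p m ht i) U) (divDelHom_app m ht hU j U P)).trans
    (homSec_mulDel p m ht i U _)).symm

variable (p)

/-- The operators of order `< p^m` in each variable are what remains both after interpolating the
values on monomials and after dividing by all `∂_j^{⟨p^m⟩}`. -/
theorem evalCopies_comp_interpolateCopies :
    (toAddSheaf p m ht).map (evalCopies p m ht) ≫ interpolateCopies p m ht =
      remainderHom (toAddSheaf p m ht) (fun j => rightMulEnd (delTop p m ht j))
        (divDelHom m ht hU) (List.finRange n) := by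
  refine toAddSheaf_hom_ext p m ht fun U P => ?_
  have h : (toAddSheaf p m ht).map (evalCopies p m ht) ≫ interpolateCopies p m ht =
      ∑ k, (toAddSheaf p m ht).map (evalHom p m ht (smallExpEquiv p m k)) ≫
        interpolateHom p m ht (smallExpEquiv p m k) := by
    rw [interpolateCopies, Preadditive.comp_sum]
    refine Finset.sum_congr rfl fun k _ => ?_
    rw [← evalCopies_comp_π, Functor.map_comp]
    exact (Category.assoc _ _ _).symm
  have h' : ∀ (s : Finset (Fin (p ^ (m * n)))), ((∑ k ∈ s, (toAddSheaf p m ht).map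
      (evalHom p m ht (smallExpEquiv p m k)) ≫ interpolateHom p m ht
        (smallExpEquiv p m k)).hom.app (op U)).hom (toDiff p m ht U P) =
      ∑ k ∈ s, toDiff p m ht U (interpolate p m ht U (Pi.single (smallExpEquiv p m k)
        (evalMonomials p m ht U P (smallExpEquiv p m k)))) := by
    intro s
    classical
    induction s using Finset.induction_on with
    | empty => rfl
    | insert k s hk ih =>
      rw [Finset.sum_insert hk, Finset.sum_insert hk, ← ih]
      exact congrArg₂ (· + ·) (congrArg ((interpolateHom p m ht (smallExpEquiv p m k)).hom.app
        (op U)).hom (homSec_evalHom p m ht (smallExpEquiv p m k) U P)) rfl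
  rw [h]
  refine (h' _).trans ?_
  rw [← map_sum, ← map_sum, Equiv.sum_comp (smallExpEquiv p m) (fun i => (Pi.single i
    (evalMonomials p m ht U P i) : SmallExp p m n → Γ(X, U))), Finset.univ_sum_single]
  conv_rhs => rw [← ofCoeff_toCoeff m ht U (hU U) P, remainderHom_app]
  conv_lhs => rw [← ofCoeff_toCoeff m ht U (hU U) P, interpolate_evalMonomials]
  simp only [List.mem_finRange, true_implies]
  congr!

include hU in
/-- The Spencer complex is a resolution of `O_X^{p^{mn}}`. -/
theorem quasiIso_spencerAugmentation : QuasiIso (spencerAugmentation p m ht) := by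
  obtain ⟨e, he⟩ := exists_homotopyEquiv_of_contraction (toAddSheaf p m ht)
    (fun i j => rightMulEnd_commute (delTop_commute p m ht i j)) (divDelHom m ht hU)
    (map_mulDel_comp_divDelHom m ht hU) (fun i j h => map_mulDel_comp_divDelHom_of_ne m ht hU h)
    (spencerAugmentation p m ht) (interpolateCopies p m ht)
    (by
      rw [augmentation_spencerAugmentation]
      exact interpolateCopies_comp_evalCopies p m ht)
    (by
      rw [augmentation_spencerAugmentation]
      exact evalCopies_comp_interpolateCopies p m ht hU)
  refine (HomologicalComplex.quasiIso_map_iff_of_preservesHomology _ (toAddSheaf p m ht)).1 ?_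
  have : QuasiIso e.hom := inferInstance
  rw [he] at this
  exact this

end Augmentation

/-! ### The higher de Rham complex as a complex of homomorphisms out of the Spencer complex -/

section Dual
variable {C B : Type*} [Category C] [Preadditive C] [Category B] [Preadditive B]
  (H : Cᵒᵖ ⥤ B) [H.Additive] {n : ℕ} {M : C} {N : B}

theorem map_koszulHom_op (δ : Fin n → End M) (δ' : Fin n → End N) (ev : H.obj (op M) ≅ N)
    (hev : ∀ i, H.map (δ i : M ⟶ M).op ≫ ev.hom = ev.hom ≫ (δ' i : N ⟶ N)) (s s' : Finset (Fin n)) :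
    H.map (koszulHom M δ s s').op ≫ ev.hom = ev.hom ≫ koszulHom N δ' s s' := by
  have h : koszulHom M δ s s' =
      ∑ j, if j ∉ s ∧ s' = insert j s then koszulSign j s • (δ j : M ⟶ M) else 0 := rfl
  have h' : koszulHom N δ' s s' =
      ∑ j, if j ∉ s ∧ s' = insert j s then koszulSign j s • (δ' j : N ⟶ N) else 0 := rfl
  rw [h, h', op_sum, H.map_sum, Preadditive.sum_comp, Preadditive.comp_sum]
  refine Finset.sum_congr rfl fun j _ => ?_
  split_ifs
  · rw [op_zsmul, H.map_zsmul, Preadditive.zsmul_comp, Preadditive.comp_zsmul, hev]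
  · rw [op_zero, H.map_zero, zero_comp, comp_zero]

variable [HasFiniteBiproducts C] [HasFiniteBiproducts B]

/-- A subset with `r` elements as a subset with `-(-r)` elements. -/
def negNegSubset {r : ℤ} (s : Subsets n r) : Subsets n (-(-r)) := ⟨s.1, s.2.trans (neg_neg r).symm⟩

theorem negNegSubset_bijective (r : ℤ) : Function.Bijective (negNegSubset (n := n) (r := r)) :=
  ⟨fun s s' h => by
    obtain ⟨s, hs⟩ := s
    obtain ⟨s', hs'⟩ := s'
    have : s = s' := congrArg (fun x : Subsets n (-(-r)) => x.1) h
    subst this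
    rfl, fun s => ⟨⟨s.1, s.2.trans (neg_neg r)⟩, rfl⟩⟩

/-- A contravariant functor that sends `M` to `N` sends a direct sum of copies of `M` to the direct
sum of the same number of copies of `N`. -/
noncomputable def dualIso (ev : H.obj (op M) ≅ N) (r : ℤ) :
    H.obj (op (⨁ fun _ : Subsets n (-(-r)) => M)) ≅ ⨁ fun _ : Subsets n r => N where
  hom := biproduct.lift fun s =>
    H.map (biproduct.ι (fun _ : Subsets n (-(-r)) => M) (negNegSubset s)).op ≫ ev.hom
  inv := biproduct.desc fun s => ev.inv ≫
    H.map (biproduct.π (fun _ : Subsets n (-(-r)) => M) (negNegSubset s)).op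
  hom_inv_id := by
    have h1 : ∑ s : Subsets n r, biproduct.π (fun _ : Subsets n (-(-r)) => M) (negNegSubset s) ≫
        biproduct.ι (fun _ : Subsets n (-(-r)) => M) (negNegSubset s) = 𝟙 _ := by
      rw [← biproduct.total]
      exact (negNegSubset_bijective r).sum_comp
        (fun s => biproduct.π (fun _ : Subsets n (-(-r)) => M) s ≫
          biproduct.ι (fun _ : Subsets n (-(-r)) => M) s)
    rw [biproduct.lift_desc, ← H.map_id, ← op_id, ← h1, op_sum, H.map_sum]
    refine Finset.sum_congr rfl fun s _ => ?_
    rw [Category.assoc, ev.hom_inv_id_assoc, ← H.map_comp, ← op_comp]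
  inv_hom_id := by
    classical
    refine biproduct.hom_ext' _ _ fun s => biproduct.hom_ext _ _ fun s' => ?_
    rw [Category.assoc, Category.assoc, biproduct.ι_desc_assoc, biproduct.lift_π, Category.comp_id,
      Category.assoc, ← H.map_comp_assoc, ← op_comp, biproduct.ι_π, biproduct.ι_π]
    by_cases h : s = s'
    · subst h
      simp
    · have h' : negNegSubset s' ≠ negNegSubset s := fun h' =>
        h ((negNegSubset_bijective r).1 h'.symm)
      rw [dif_neg h, dif_neg h', op_zero, H.map_zero, zero_comp, comp_zero]

theorem dualIso_hom_π (ev : H.obj (op M) ≅ N) (r : ℤ) (s : Subsets n r) :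
    (dualIso H ev r).hom ≫ biproduct.π (fun _ : Subsets n r => N) s =
      H.map (biproduct.ι (fun _ : Subsets n (-(-r)) => M) (negNegSubset s)).op ≫ ev.hom :=
  biproduct.lift_π _ _

/-- Dualizing turns the transpose of the matrix of a Koszul differential into this matrix. -/
theorem dualIso_hom_comp_matrix (δ : Fin n → End M) (δ' : Fin n → End N) (ev : H.obj (op M) ≅ N)
    (hev : ∀ i, H.map (δ i : M ⟶ M).op ≫ ev.hom = ev.hom ≫ (δ' i : N ⟶ N)) (r r' : ℤ) :
    (dualIso H ev r).hom ≫ (biproduct.matrix fun (s : Subsets n r) (s' : Subsets n r') =>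
        koszulHom N δ' s.1 s'.1 : (⨁ fun _ => N) ⟶ ⨁ fun _ => N) =
      H.map (biproduct.matrix fun (s' : Subsets n (-(-r'))) (s : Subsets n (-(-r))) =>
        koszulHom M δ s.1 s'.1 : (⨁ fun _ => M) ⟶ ⨁ fun _ => M).op ≫ (dualIso H ev r').hom := by
  classical
  refine biproduct.hom_ext _ _ fun s' => ?_
  rw [Category.assoc, Category.assoc, biproduct.matrix_π, dualIso_hom_π, ← H.map_comp_assoc,
    ← op_comp, biproduct.ι_matrix]
  rw [dualIso, biproduct.lift_desc]
  have h1 : biproduct.lift (fun s : Subsets n (-(-r)) => koszulHom M δ s.1 (negNegSubset s').1) =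
      ∑ s : Subsets n r, koszulHom M δ s.1 s'.1 ≫
        biproduct.ι (fun _ : Subsets n (-(-r)) => M) (negNegSubset s) := by
    rw [biproduct.lift_eq]
    exact ((negNegSubset_bijective r).sum_comp
        (fun s => koszulHom M δ s.1 s'.1 ≫
          biproduct.ι (fun _ : Subsets n (-(-r)) => M) s)).symm
  rw [h1, op_sum, H.map_sum, Preadditive.sum_comp]
  refine Finset.sum_congr rfl fun s _ => ?_
  rw [op_comp, H.map_comp, Category.assoc, Category.assoc, map_koszulHom_op H δ δ' ev hev]

end Dual

section Dual
variable {X : Type u} [TopologicalSpace X] {D K : Sheaf (Opens.grothendieckTopology X) RingCat.{u}}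
  {c : K ⟶ D} (hc : IsCentral c)

/-- The contravariant functor `M ↦ Hom_D(M, F)`. -/
noncomputable def sheafHomInto (F : SheafOfModules.{u} D) :
    (SheafOfModules.{u} D)ᵒᵖ ⥤ SheafOfModules.{u} K where
  obj M := sheafHom M.unop F hc
  map g := sheafHomMap hc g.unop (𝟙 F)
  map_id _ := rfl
  map_comp _ _ := rfl

instance (F : SheafOfModules.{u} D) : (sheafHomInto hc F).Additive where
  map_add {M N g h} := by
    refine SheafOfModules.hom_ext (PresheafOfModules.hom_ext fun U => ModuleCat.hom_ext
      (LinearMap.ext fun (φ : homOn M.unop F U.unop) => homOn_ext fun V x => ?_))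
    exact map_add (φ.1 V) _ _

/-- A `D`-linear homomorphism out of `D` is determined by its value at `1`. -/
theorem homOn_unit_apply {F : SheafOfModules.{u} D} {U : Opens X}
    (φ : homOn (SheafOfModules.unit D) F U) (V : { V : Opens X // V ≤ U })
    (P : D.obj.obj (op V.1)) : φ.1 V P =
      P • secRes F V.2 (φ.1 ⟨U, le_rfl⟩ (1 : D.obj.obj (op U))) := by
  have h1 := φ.2.2 ⟨U, le_rfl⟩ V V.2 (1 : D.obj.obj (op U))
  have h2 : secRes (SheafOfModules.unit D) V.2 (1 : D.obj.obj (op U)) =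
      (1 : D.obj.obj (op V.1)) := map_one (ringRes D V.2)
  have h3 := φ.2.1 V P (1 : D.obj.obj (op V.1))
  rw [← h1]
  refine Eq.trans ?_ (h3.trans (congrArg (fun x => P • φ.1 V x) h2.symm))
  exact congrArg (φ.1 V) (mul_one P).symm

/-- Evaluation at `1` is an isomorphism `Hom_D(D, F) ≅ F`. -/
noncomputable def evalOne (F : SheafOfModules.{u} D) :
    sheafHom (SheafOfModules.unit D) F hc ≅ (SheafOfModules.restrictScalars c).obj F where
  hom.val := PresheafOfModules.homMk
    { app := fun U => AddCommGrpCat.ofHom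
        { toFun := fun φ : homOn (SheafOfModules.unit D) F U.unop =>
            (φ.1 ⟨U.unop, le_rfl⟩ (1 : D.obj.obj U) : Sec F U.unop)
          map_zero' := rfl
          map_add' := fun _ _ => rfl }
      naturality := fun U V i => by
        refine AddCommGrpCat.hom_ext (AddMonoidHom.ext
          fun (φ : homOn (SheafOfModules.unit D) F U.unop) => ?_)
        change φ.1 ⟨V.unop, i.unop.le⟩ (1 : D.obj.obj V) =
          secRes F i.unop.le (φ.1 ⟨U.unop, le_rfl⟩ (1 : D.obj.obj U))
        exact (homOn_unit_apply φ ⟨V.unop, i.unop.le⟩ (1 : D.obj.obj V)).trans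
          (one_smul (D.obj.obj V) (secRes F i.unop.le (φ.1 ⟨U.unop, le_rfl⟩ (1 : D.obj.obj U)))) }
    fun U a (φ : homOn (SheafOfModules.unit D) F U.unop) => by
      change (c.hom.app U).hom (ringRes K le_rfl a) • φ.1 ⟨U.unop, le_rfl⟩ (1 : D.obj.obj U) =
        (c.hom.app U).hom a • φ.1 ⟨U.unop, le_rfl⟩ (1 : D.obj.obj U)
      have : ringRes K (le_refl U.unop) a = a :=
        ConcreteCategory.congr_hom (K.obj.map_id U) a
      rw [this]
  inv.val := PresheafOfModules.homMk
    { app := fun U => AddCommGrpCat.ofHom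
        { toFun := fun x : Sec F U.unop =>
            (⟨fun V => (smulAddHom (D.obj.obj (op V.1)) (Sec F V.1)).flip (secRes F V.2 x),
              fun V P (Q : D.obj.obj (op V.1)) => mul_smul P Q (secRes F V.2 x),
              fun V W h (Q : D.obj.obj (op V.1)) => by
                change ringRes D h Q • secRes F W.2 x = secRes F h (Q • secRes F V.2 x)
                rw [secRes_smul, secRes_secRes]⟩ : homOn (SheafOfModules.unit D) F U.unop)
          map_zero' := homOn_ext fun V (Q : D.obj.obj (op V.1)) => by
            change Q • secRes F V.2 0 = 0
            rw [map_zero, smul_zero]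
          map_add' := fun (x y : Sec F U.unop) => homOn_ext fun V (Q : D.obj.obj (op V.1)) => by
            change Q • secRes F V.2 (x + y) = Q • secRes F V.2 x + Q • secRes F V.2 y
            rw [map_add, smul_add] }
      naturality := fun U V i => by
        refine AddCommGrpCat.hom_ext (AddMonoidHom.ext fun (x : Sec F U.unop) =>
          homOn_ext fun W (Q : D.obj.obj (op W.1)) => ?_)
        change Q • secRes F W.2 (secRes F i.unop.le x) = Q • secRes F _ x
        rw [secRes_secRes] }
    fun U a (x : Sec F U.unop) => homOn_ext fun V (Q : D.obj.obj (op V.1)) => by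
      change Q • secRes F V.2 ((c.hom.app (op U.unop)).hom a • x) =
        (c.hom.app (op V.1)).hom (ringRes K V.2 a) • Q • secRes F V.2 x
      rw [secRes_smul, ← ringRes_app, smul_smul, smul_smul, (hc _ _ _).eq]
  hom_inv_id := by
    refine SheafOfModules.hom_ext (PresheafOfModules.hom_ext fun U => ModuleCat.hom_ext
      (LinearMap.ext fun (φ : homOn (SheafOfModules.unit D) F U.unop) => homOn_ext fun V Q => ?_))
    exact (homOn_unit_apply φ V Q).symm
  inv_hom_id := by
    refine SheafOfModules.hom_ext (PresheafOfModules.hom_ext fun U => ModuleCat.hom_ext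
      (LinearMap.ext fun (x : Sec F U.unop) => ?_))
    exact (one_smul (D.obj.obj U) (secRes F (le_refl U.unop) x)).trans (secRes_rfl F x)

/-- Under `Hom_D(D, F) ≅ F`, right multiplication on `D` becomes left multiplication on `F`. -/
theorem sheafHomMap_rightMulEnd_comp_evalOne (F : SheafOfModules.{u} D) (P : D.obj.obj (op ⊤)) :
    sheafHomMap hc (rightMulEnd P : SheafOfModules.unit D ⟶ _) (𝟙 F) ≫ (evalOne hc F).hom =
      (evalOne hc F).hom ≫ mulEnd hc P F := by
  refine SheafOfModules.hom_ext (PresheafOfModules.hom_ext fun U => ModuleCat.hom_ext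
    (LinearMap.ext fun (φ : homOn (SheafOfModules.unit D) F U.unop) => ?_))
  change φ.1 ⟨U.unop, le_rfl⟩ ((1 : D.obj.obj U) * ringRes D (le_top : U.unop ≤ ⊤) P) =
    ringRes D (le_top : U.unop ≤ ⊤) P • φ.1 ⟨U.unop, le_rfl⟩ (1 : D.obj.obj U)
  refine Eq.trans ?_ (φ.2.1 ⟨U.unop, le_rfl⟩ (ringRes D (le_top : U.unop ≤ ⊤) P)
      (1 : D.obj.obj U))
  exact congrArg (φ.1 ⟨U.unop, le_rfl⟩) ((one_mul (ringRes D (le_top : U.unop ≤ ⊤) P)).trans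
    (mul_one (ringRes D (le_top : U.unop ≤ ⊤) P)).symm)

end Dual

section Main
variable (p m : ℕ) {X S : Scheme.{u}} {f : X ⟶ S} {n : ℕ} {t : Fin n → Γ(X, ⊤)}
  (ht : IsCoordinates f t)

/-- The higher de Rham complex of `F` is `Hom_D(Sp, F)`, naturally in `F`. -/
noncomputable def homSpencerIso :
    homComplexFunctor (isCentral_constToDiff p m ht) (spencer p m ht) ≅
      higherDeRham p m ht :=
  NatIso.ofComponents
    (fun F => HomologicalComplex.Hom.isoOfComponents
      (fun r => dualIso (sheafHomInto (isCentral_constToDiff p m ht) F)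
        (evalOne (isCentral_constToDiff p m ht) F) r)
      fun r r' _ => dualIso_hom_comp_matrix (sheafHomInto (isCentral_constToDiff p m ht) F) _ _ _
        (fun _ => sheafHomMap_rightMulEnd_comp_evalOne _ F _) r r')
    fun {F G} g => by
      refine HomologicalComplex.hom_ext _ _ fun r => biproduct.hom_ext _ _ fun s => ?_
      refine (Category.assoc _ _ _).trans ?_
      refine (congrArg (fun x => sheafHomMap (isCentral_constToDiff p m ht) (𝟙 _) g ≫ x)
        (dualIso_hom_π (sheafHomInto (isCentral_constToDiff p m ht) G)
          (evalOne (isCentral_constToDiff p m ht) G) r s)).trans ?_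
      refine Eq.trans ?_ (Category.assoc _ _ _).symm
      refine Eq.trans ?_ (congrArg (fun x => (dualIso (sheafHomInto
        (isCentral_constToDiff p m ht) F) (evalOne (isCentral_constToDiff p m ht) F) r).hom ≫ x)
        (biproduct.map_π (fun _ : Subsets n r => (SheafOfModules.restrictScalars
          (constToDiff p m ht)).map g) s).symm)
      refine Eq.trans ?_ ((congrArg (fun x => x ≫ (SheafOfModules.restrictScalars
        (constToDiff p m ht)).map g) (dualIso_hom_π (sheafHomInto
        (isCentral_constToDiff p m ht) F) (evalOne (isCentral_constToDiff p m ht) F)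
        r s)).symm.trans (Category.assoc _ _ _))
      rfl

end Main

/-! ### Local exactness, and homomorphisms into injective modules -/

section Local
variable {X : Type u} [TopologicalSpace X]

theorem exact_iff_locally_exact_of_addCommGrp
    (T : ShortComplex (TopCat.Sheaf AddCommGrpCat.{u} (TopCat.of X))) :
    T.Exact ↔ ∀ (U : Opens X) (x : T.X₂.obj.obj (op U)), (T.g.hom.app (op U)).hom x = 0 →
      ∀ q ∈ U, ∃ (V : Opens X) (hV : V ≤ U), q ∈ V ∧ ∃ y : T.X₁.obj.obj (op V),
        (T.f.hom.app (op V)).hom y = (T.X₂.obj.map (homOfLE hV).op).hom x := by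
  rw [T.exact_iff_epi_kernel_lift, ← TopCat.Sheaf.isLocallySurjective_iff_epi,
    TopCat.Presheaf.isLocallySurjective_iff]
  have hk : ∀ (V : Opens X) (y : T.X₁.obj.obj (op V)),
      ((kernel.ι T.g).hom.app (op V)).hom (((kernel.lift T.g T.f T.zero).hom.app (op V)).hom y) =
        (T.f.hom.app (op V)).hom y := fun V y =>
    congr(($(kernel.lift_ι T.g T.f T.zero).hom.app (op V)).hom y)
  have hn : ∀ (U V : Opens X) (hV : V ≤ U) (k : (kernel T.g).obj.obj (op U)),
      ((kernel.ι T.g).hom.app (op V)).hom (((kernel T.g).obj.map (homOfLE hV).op).hom k) =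
        (T.X₂.obj.map (homOfLE hV).op).hom (((kernel.ι T.g).hom.app (op U)).hom k) :=
    fun U V hV k => ConcreteCategory.congr_hom ((kernel.ι T.g).hom.naturality (homOfLE hV).op) k
  constructor
  · intro h U x hx q hq
    obtain ⟨k, hk'⟩ := TopCat.Sheaf.sections_exact_of_left_exact
      (S := ShortComplex.mk (kernel.ι T.g) T.g (kernel.condition _))
      (ShortComplex.exact_kernel T.g) inferInstance x hx
    obtain ⟨V, hV, ⟨y, hy⟩, hqV⟩ := h U k q hq
    refine ⟨V, hV, hqV, y, ?_⟩
    rw [← hk]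
    refine (congrArg ((kernel.ι T.g).hom.app (op V)).hom hy).trans ((hn U V hV k).trans ?_)
    exact congrArg (T.X₂.obj.map (homOfLE hV).op).hom hk'
  · intro h U k q hq
    have h0 : (T.g.hom.app (op U)).hom (((kernel.ι T.g).hom.app (op U)).hom k) = 0 :=
      congr(($(kernel.condition T.g).hom.app (op U)).hom k)
    obtain ⟨V, hV, hqV, y, hy⟩ := h U _ h0 q hq
    refine ⟨V, hV, ⟨y, ?_⟩, hqV⟩
    have hinj : Function.Injective ((kernel.ι T.g).hom.app (op V)).hom := by
      have h1 : Mono ((TopCat.Sheaf.forget AddCommGrpCat.{u} (TopCat.of X)).map (kernel.ι T.g)) :=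
        inferInstance
      exact (AddCommGrpCat.mono_iff_injective _).1 ((NatTrans.mono_iff_mono_app _).1 h1 (op V))
    exact hinj ((hk V y).trans (hy.trans (hn U V hV k).symm))

variable {D : Sheaf (Opens.grothendieckTopology X) RingCat.{u}}

/-- A sequence of sheaves of modules is exact if and only if it is locally exact on sections. -/
theorem exact_iff_locally_exact (T : ShortComplex (SheafOfModules.{u} D)) :
    T.Exact ↔ ∀ (U : Opens X) (x : Sec T.X₂ U), homSec T.g U x = 0 →
      ∀ q ∈ U, ∃ (V : Opens X) (hV : V ≤ U), q ∈ V ∧ ∃ y : Sec T.X₁ V,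
        homSec T.f V y = secRes T.X₂ hV x := by
  rw [← ShortComplex.exact_map_iff_of_faithful T (SheafOfModules.toSheaf.{u} D)]
  exact exact_iff_locally_exact_of_addCommGrp _

end Local

section Hom
variable {X : Type u} [TopologicalSpace X] {D K : Sheaf (Opens.grothendieckTopology X) RingCat.{u}}
  {c : K ⟶ D} (hc : IsCentral c)

instance : (SheafOfModules.restrictScalars.{u} c).Additive where
  map_add := rfl

/-- Exactness is a condition on sections, so it does not depend on the ring. -/
theorem restrictScalars_exact {T : ShortComplex (SheafOfModules.{u} D)} (hT : T.Exact) :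
    (T.map (SheafOfModules.restrictScalars c)).Exact := by
  rw [exact_iff_locally_exact] at hT ⊢
  exact hT

/-- The forgetful functor to presheaves of modules is right adjoint to sheafification, which is
exact. -/
instance (I : SheafOfModules.{u} D) [Injective I] : Injective I.val := by
  let adj := PresheafOfModules.sheafificationAdjunction (𝟙 D.obj)
  have : (PresheafOfModules.sheafification (𝟙 D.obj)).PreservesMonomorphisms := inferInstance
  exact Injective.injective_of_adjoint adj I

/-- The extension by zero, as a presheaf, of the restriction of `M` to an open set `U`. -/
def extendZero (M : SheafOfModules.{u} D) (U : Opens X) : PresheafOfModules.Submodule M.val where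
  obj V :=
    { carrier := {x | V.unop ≤ U ∨ x = 0}
      add_mem' := by
        rintro x y (h | rfl) (h' | rfl)
        · exact Or.inl h
        · exact Or.inl h
        · exact Or.inl h'
        · exact Or.inr (add_zero _)
      zero_mem' := Or.inr rfl
      smul_mem' := by
        rintro P x (h | rfl)
        · exact Or.inl h
        · exact Or.inr (smul_zero _) }
  map {V W} i := by
    rintro x (h | rfl)
    · exact Or.inl (i.unop.le.trans h)
    · exact Or.inr (map_zero (M.val.restrictₛₗ i))

theorem eq_zero_of_mem_extendZero {M : SheafOfModules.{u} D} {U V : Opens X} (h : ¬ V ≤ U)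
    (x : (extendZero M U).obj (op V)) : x = 0 :=
  Subtype.ext (x.2.resolve_left h)

open Classical in
/-- The map on sections over `V` of a homomorphism over `U` extended by zero: it is the given one if
`V ⊆ U`, and zero otherwise. -/
noncomputable def extendZeroFun {M I : SheafOfModules.{u} D} {U : Opens X} (φ : homOn M I U)
    (V : Opens X) : (extendZero M U).obj (op V) →+ Sec I V :=
  if h : V ≤ U then
    { toFun := fun x => φ.1 ⟨V, h⟩ x.1
      map_zero' := map_zero (φ.1 ⟨V, h⟩)
      map_add' := fun x y => map_add (φ.1 ⟨V, h⟩) x.1 y.1 } else 0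

theorem extendZeroFun_of_le {M I : SheafOfModules.{u} D} {U V : Opens X} (φ : homOn M I U)
    (h : V ≤ U) (x : (extendZero M U).obj (op V)) : extendZeroFun φ V x = φ.1 ⟨V, h⟩ x.1 := by
  rw [extendZeroFun, dif_pos h]
  rfl

/-- A homomorphism over an open set `U`, extended by zero. -/
noncomputable def extendZeroHom {M I : SheafOfModules.{u} D} {U : Opens X} (φ : homOn M I U) :
    (extendZero M U).toPresheafOfModules ⟶ I.val :=
  PresheafOfModules.homMk
    { app := fun V => AddCommGrpCat.ofHom (extendZeroFun φ V.unop)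
      naturality := fun V W i => by
        refine AddCommGrpCat.hom_ext (AddMonoidHom.ext fun (x : (extendZero M U).obj V) => ?_)
        by_cases h : V.unop ≤ U
        · have h' : W.unop ≤ U := i.unop.le.trans h
          refine (extendZeroFun_of_le φ h' _).trans (Eq.trans ?_
            (congrArg (secRes I i.unop.le) (extendZeroFun_of_le φ h x).symm))
          exact φ.2.2 ⟨V.unop, h⟩ ⟨W.unop, h'⟩ i.unop.le x.1
        · rw [eq_zero_of_mem_extendZero h x]
          exact (map_zero _).trans (map_zero _).symm } fun V P (x : (extendZero M U).obj V) => by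
      by_cases h : V.unop ≤ U
      · exact (extendZeroFun_of_le φ h (P • x)).trans ((φ.2.1 ⟨V.unop, h⟩ P x.1).trans
          (congrArg (P • ·) (extendZeroFun_of_le φ h x).symm))
      · have h1 : ∀ y, extendZeroFun φ V.unop y = 0 := fun y =>
          (congrArg _ (eq_zero_of_mem_extendZero h y)).trans (map_zero _)
        exact (h1 (P • x)).trans ((smul_zero P).symm.trans (congrArg (P • ·) (h1 x).symm))

theorem extendZeroHom_app {M I : SheafOfModules.{u} D} {U V : Opens X} (φ : homOn M I U)
    (h : V ≤ U) (x : (extendZero M U).obj (op V)) :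
    ((extendZeroHom φ).app (op V)).hom x = φ.1 ⟨V, h⟩ x.1 :=
  extendZeroFun_of_le φ h x

/-- Homomorphisms over an open set `U` that vanish on the kernel of `g` extend along `g`, if their
target is injective. -/
theorem exists_extension_of_injective {M N I : SheafOfModules.{u} D} [Injective I] (g : M ⟶ N)
    {U : Opens X} (φ : homOn M I U) (hφ : ∀ V x, homSec g V.1 x = 0 → φ.1 V x = 0) :
    ∃ ψ : N ⟶ I, ∀ V x, φ.1 V x = homSec ψ V.1 (homSec g V.1 x) := by
  -- Extended by zero, `φ` is a morphism of presheaves of modules. It vanishes on the kernel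
  -- of `γ`, so it extends along `γ`, because `I` is injective among presheaves of modules,
  -- too.
  let γ : (extendZero M U).toPresheafOfModules ⟶ N.val := (extendZero M U).ι ≫ g.val
  have h0 : kernel.ι γ ≫ extendZeroHom φ = 0 := by
    refine PresheafOfModules.hom_ext fun V => ModuleCat.hom_ext (LinearMap.ext fun k => ?_)
    have h1 : ((kernel.ι γ).app V ≫ γ.app V).hom k = 0 :=
      congr(($(kernel.condition γ).app V).hom k)
    change ((extendZeroHom φ).app V).hom (((kernel.ι γ).app V).hom k) = 0
    by_cases h : V.unop ≤ U
    · exact (extendZeroHom_app φ h _).trans (hφ ⟨V.unop, h⟩ _ h1)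
    · exact (congrArg _ (eq_zero_of_mem_extendZero h _)).trans (map_zero _)
  obtain ⟨ψ, hψ⟩ : ∃ ψ : N.val ⟶ I.val, γ ≫ ψ = extendZeroHom φ :=
    ⟨(ShortComplex.exact_kernel γ).descToInjective _ h0,
        (ShortComplex.exact_kernel γ).comp_descToInjective _ h0⟩
  refine ⟨⟨ψ⟩, fun V x => ?_⟩
  rw [← extendZeroHom_app φ V.2 ⟨x, Or.inl V.2⟩, ← hψ]
  rfl

theorem sheafHomMap_comp_zero {M N L : SheafOfModules.{u} D} (I : SheafOfModules.{u} D) (g : M ⟶ N)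
    (h : N ⟶ L) (w : g ≫ h = 0) : sheafHomMap hc h (𝟙 I) ≫ sheafHomMap hc g (𝟙 I) = 0 := by
  rw [← sheafHomMap_comp, w, sheafHomMap_zero]

/-- For an injective module `I`, the functor `Hom_D(-, I)` is exact. -/
theorem sheafHom_exact_of_injective {T : ShortComplex (SheafOfModules.{u} D)} (hT : T.Exact)
    (I : SheafOfModules.{u} D) [Injective I] :
    (ShortComplex.mk (sheafHomMap hc T.g (𝟙 I)) (sheafHomMap hc T.f (𝟙 I))
      (sheafHomMap_comp_zero hc I _ _ T.zero)).Exact := by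
  rw [exact_iff_locally_exact] at hT ⊢
  intro U (φ : homOn T.X₂ I U) hφ q hq
  obtain ⟨ψ, hψ⟩ := exists_extension_of_injective T.g φ fun V x hx => by
    -- If `g(x) = 0`, then `x` comes locally from `T.X₁`, where `φ` vanishes by hypothesis. So
    -- `φ(x) = 0`, and `φ` factors through the image of `g`.
    choose W hW hqW y hy using fun q : V.1 => hT V.1 x hx q.1 q.2
    refine sec_ext I (ι := V.1) W (fun q hq => Opens.mem_iSup.2 ⟨⟨q, hq⟩, hqW _⟩) fun i => ?_
    have h1 : φ.1 ⟨W i, (hW i).trans V.2⟩ (homSec T.f (W i) (y i)) = 0 :=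
      congr($(hφ).1 ⟨W i, (hW i).trans V.2⟩ (y i))
    rw [hy, φ.2.2 V ⟨W i, _⟩ (hW i)] at h1
    have h2 := congrArg (secRes I (inf_le_right : V.1 ⊓ W i ≤ W i)) h1
    rw [secRes_secRes, map_zero] at h2
    rw [map_zero]
    exact h2
  refine ⟨U, le_rfl, hq, (⟨fun V => homSec ψ V.1, fun V P x => homSec_smul ψ V.1 P x,
    fun V W h x => homSec_secRes ψ h x⟩ : homOn T.X₃ I U), ?_⟩
  refine Eq.trans ?_ (secRes_rfl (sheafHom T.X₂ I hc) φ).symm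
  exact homOn_ext fun V x => (hψ V x).symm

open scoped ZeroObject in
theorem mono_sheafHomMap_of_epi {M N : SheafOfModules.{u} D} (g : M ⟶ N) [Epi g]
    (I : SheafOfModules.{u} D) [Injective I] : Mono (sheafHomMap hc g (𝟙 I)) := by
  have h0 : (ShortComplex.mk g (0 : N ⟶ 0) comp_zero).Exact :=
    (ShortComplex.exact_iff_epi _ rfl).2 inferInstance
  exact (ShortComplex.exact_iff_mono _ (sheafHomMap_zero hc)).1
      (sheafHom_exact_of_injective hc h0 I)

end Hom

section Sum
variable {C : Type*} [Category C] [Preadditive C] [HasFiniteBiproducts C] (J : Type) [Fintype J]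

/-- The functor that sends an object to the direct sum of copies of it, indexed by `J`. -/
noncomputable def sumFunctor : C ⥤ C where
  obj Y := ⨁ fun _ : J => Y
  map g := biproduct.map fun _ => g

instance : (sumFunctor (C := C) J).Additive where
  map_add {Y Z g h} := by
    refine biproduct.hom_ext _ _ fun j => ?_
    refine (biproduct.map_π (fun _ : J => g + h) j).trans ?_
    refine Eq.trans ?_ (Preadditive.add_comp _ _ _ (biproduct.map fun _ : J => g)
      (biproduct.map fun _ : J => h) (biproduct.π _ j)).symm
    rw [biproduct.map_π, biproduct.map_π, Preadditive.comp_add]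

/-- Morphisms from a direct sum of copies of `Y` to `Z`, and morphisms from `Y` to a direct sum of
copies of `Z`, are both families of morphisms from `Y` to `Z`. -/
noncomputable def sumHomEquiv (Y Z : C) : ((⨁ fun _ : J => Y) ⟶ Z) ≃ (Y ⟶ ⨁ fun _ : J => Z) where
  toFun g := biproduct.lift fun j => biproduct.ι (fun _ : J => Y) j ≫ g
  invFun g := biproduct.desc fun j => g ≫ biproduct.π (fun _ : J => Z) j
  left_inv g := biproduct.hom_ext' _ _ fun j => by
    dsimp only
    rw [biproduct.ι_desc, biproduct.lift_π]
  right_inv g := biproduct.hom_ext _ _ fun j => by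
    dsimp only
    rw [biproduct.lift_π, biproduct.ι_desc]

/-- The direct sum of copies is a left and right adjoint of itself. -/
noncomputable def sumFunctorAdj : sumFunctor (C := C) J ⊣ sumFunctor J :=
  Adjunction.mkOfHomEquiv
    { homEquiv := sumHomEquiv J
      homEquiv_naturality_left_symm := fun {Y' Y Z} g h => biproduct.hom_ext' _ _ fun j => by
        refine (biproduct.ι_desc _ _).trans (Eq.trans ?_
          ((biproduct.ι_map_assoc (fun _ : J => g) j _).trans
            (congrArg (g ≫ ·) (biproduct.ι_desc _ _))).symm)
        exact Category.assoc _ _ _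
      homEquiv_naturality_right := fun {Y Z Z'} g h => biproduct.hom_ext _ _ fun j => by
        refine (biproduct.lift_π _ _).trans (Eq.trans ?_
          ((Category.assoc _ _ _).trans
            ((congrArg (_ ≫ ·) (biproduct.map_π (fun _ : J => h) j)).trans
            ((Category.assoc _ _ _).symm.trans (congrArg (· ≫ h) (biproduct.lift_π _ _))))).symm)
        exact (Category.assoc _ _ _).symm }

end Sum

section Sum
variable {C : Type*} [Category C] [Abelian C] [HasFiniteBiproducts C] (J : Type) [Fintype J]

theorem sumFunctor_exact {T : ShortComplex C} (hT : T.Exact) : (T.map (sumFunctor J)).Exact := by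
  have := (sumFunctorAdj (C := C) J).leftAdjoint_preservesColimits
  have := (sumFunctorAdj (C := C) J).rightAdjoint_preservesLimits
  exact hT.map _

end Sum

section Main
variable (p m : ℕ) {X S : Scheme.{u}} {f : X ⟶ S} {n : ℕ} {t : Fin n → Γ(X, ⊤)}
  (ht : IsCoordinates f t)

instance {X : Type u} [TopologicalSpace X] {D K : Sheaf (Opens.grothendieckTopology X) RingCat.{u}}
    {c : K ⟶ D} (hc : IsCentral c) (L : CochainComplex (SheafOfModules.{u} D) ℤ) :
    (homComplexFunctor hc L).Additive where
  map_add := rfl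

/-- The terms of the higher de Rham complex are exact functors of the module. -/
theorem homComplex_spencer_exact {T : ShortComplex (SheafOfModules.{u} (diffSheaf p m ht))}
    (hT : T.Exact) (r : ℤ) :
    (T.map (homComplexFunctor (isCentral_constToDiff p m ht) (spencer p m ht) ⋙
      HomologicalComplex.eval _ _ r)).Exact := by
  have h1 : ((T.map (SheafOfModules.restrictScalars (constToDiff p m ht))).map
      (sumFunctor (Subsets n r))).Exact := sumFunctor_exact _ (restrictScalars_exact hT)
  let η : homComplexFunctor (isCentral_constToDiff p m ht) (spencer p m ht) ⋙
      HomologicalComplex.eval _ _ r ≅ SheafOfModules.restrictScalars (constToDiff p m ht) ⋙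
        sumFunctor (Subsets n r) := Functor.isoWhiskerRight (homSpencerIso p m ht) _
  exact (ShortComplex.exact_iff_of_iso (T.mapNatIso η)).2 h1

end Main

/-! ### The total complex of a bicomplex with exact augmented rows -/

section Total
variable {C : Type*} [Category C] [Preadditive C]
  (K : HomologicalComplex₂ C (ComplexShape.up ℤ) (ComplexShape.up ℤ))
  [K.HasTotal (ComplexShape.up ℤ)]

/-- The projection of the total complex to one of its summands. -/
noncomputable def totalPr (p q k : ℤ) (h : p + q = k) :
    (K.total (ComplexShape.up ℤ)).X k ⟶ (K.X p).X q :=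
  K.totalDesc fun p' q' h' => if hp : p' = p then
    (K.XXIsoOfEq _ _ _ hp (by
      have h'' : p' + q' = k := h'
      omega)).hom else 0

theorem ιTotal_totalPr (p q k : ℤ) (h : p + q = k) :
    K.ιTotal (ComplexShape.up ℤ) p q k h ≫ totalPr K p q k h = 𝟙 _ := by
  rw [totalPr, HomologicalComplex₂.ι_totalDesc, dif_pos rfl]
  simp

theorem ιTotal_totalPr_of_ne {p q p' q' k : ℤ} (h : p + q = k) (h' : p' + q' = k) (hp : p' ≠ p) :
    K.ιTotal (ComplexShape.up ℤ) p' q' k h' ≫ totalPr K p q k h = 0 := by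
  rw [totalPr, HomologicalComplex₂.ι_totalDesc, dif_neg hp]

theorem ιTotal_d (p q k : ℤ) (h : p + q = k) :
    K.ιTotal (ComplexShape.up ℤ) p q k h ≫ (K.total (ComplexShape.up ℤ)).d k (k + 1) =
      (K.d p (p + 1)).f q ≫ K.ιTotal (ComplexShape.up ℤ) (p + 1) q (k + 1)
          (show p + 1 + q = k + 1 by omega) +
        p.negOnePow • ((K.X p).d q (q + 1) ≫ K.ιTotal (ComplexShape.up ℤ) p (q + 1) (k + 1)
          (show p + (q + 1) = k + 1 by omega)) := by
  rw [HomologicalComplex₂.total_d, Preadditive.comp_add, HomologicalComplex₂.ι_D₁,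
    HomologicalComplex₂.ι_D₂, K.d₁_eq (ComplexShape.up ℤ) (i₁ := p) (i₁' := p + 1) rfl q (k + 1)
      (show p + 1 + q = k + 1 by omega), K.d₂_eq (ComplexShape.up ℤ) p (i₂ := q) (i₂' := q + 1) rfl
      (k + 1) (show p + (q + 1) = k + 1 by omega)]
  congr 1
  exact one_smul _ _

/-- The component of the differential of the total complex in the summand `(p + 1, q + 1)`. -/
theorem d_totalPr (p q k : ℤ) (h : p + (q + 1) = k) :
    (K.total (ComplexShape.up ℤ)).d k (k + 1) ≫ totalPr K (p + 1) (q + 1) (k + 1) (by omega) =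
      totalPr K p (q + 1) k h ≫ (K.d p (p + 1)).f (q + 1) +
        (p + 1).negOnePow • (totalPr K (p + 1) q k (by omega) ≫ (K.X (p + 1)).d q (q + 1)) := by
  refine HomologicalComplex₂.total.hom_ext _ fun p' q' h' => ?_
  have h'' : p' + q' = k := h'
  rw [← Category.assoc, ιTotal_d K p' q' k h'', Preadditive.add_comp, Preadditive.comp_add,
    Category.assoc, Linear.units_smul_comp, Linear.comp_units_smul, Category.assoc]
  by_cases h1 : p' = p
  · subst h1
    obtain rfl : q' = q + 1 := by omega
    rw [ιTotal_totalPr, ιTotal_totalPr_of_ne _ _ _ (by omega), ← Category.assoc, ιTotal_totalPr,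
      ← Category.assoc, ιTotal_totalPr_of_ne _ _ _ (by omega)]
    simp
  · by_cases h2 : p' = p + 1
    · subst h2
      obtain rfl : q' = q := by omega
      rw [ιTotal_totalPr, ιTotal_totalPr_of_ne _ _ _ (by omega), ← Category.assoc,
        ιTotal_totalPr_of_ne _ _ _ (by omega), ← Category.assoc, ιTotal_totalPr]
      simp
    · rw [ιTotal_totalPr_of_ne _ _ _ (by omega), ιTotal_totalPr_of_ne _ _ _ (by omega),
        ← Category.assoc, ιTotal_totalPr_of_ne _ _ _ (by omega), ← Category.assoc,
        ιTotal_totalPr_of_ne _ _ _ (by omega)]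
      simp

/-- If the components of `y` in column `p + 1` and those of its differential vanish, the component
of `y` in column `p` is a cycle for the differential of the rows. -/
theorem totalPr_comp_f_eq_zero {A : C} {p q k : ℤ} (h : p + q = k)
    (y : A ⟶ (K.total (ComplexShape.up ℤ)).X k)
    (h1 : y ≫ (K.total (ComplexShape.up ℤ)).d k (k + 1) ≫
      totalPr K (p + 1) q (k + 1) (by omega) = 0)
    (h2 : ∀ q' h', y ≫ totalPr K (p + 1) q' k h' = 0) :
    (y ≫ totalPr K p q k h) ≫ (K.d p (p + 1)).f q = 0 := by
  obtain ⟨q, rfl⟩ : ∃ q', q = q' + 1 := ⟨q - 1, by omega⟩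
  rw [d_totalPr K p q k h, Preadditive.comp_add, Linear.comp_units_smul,
    ← Category.assoc y (totalPr K (p + 1) q k _), h2, zero_comp, smul_zero, add_zero,
    ← Category.assoc] at h1
  exact h1

variable (hK : ∀ p q, p < 0 ∨ q < 0 → IsZero ((K.X p).X q))

include hK in
/-- An element of the total complex of a first quadrant bicomplex without components in the columns
of positive index is concentrated in column `0`. -/
theorem eq_of_totalPr {A : C} {k : ℤ} (y : A ⟶ (K.total (ComplexShape.up ℤ)).X k)
    (hy : ∀ p q h, 0 < p → y ≫ totalPr K p q k h = 0) :
    y = y ≫ totalPr K 0 k k (zero_add k) ≫ K.ιTotal (ComplexShape.up ℤ) 0 k k (zero_add k) := by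
  have h1 : ∑ i ∈ Finset.range (k.toNat + 1), totalPr K i (k - i) k (by omega) ≫
      K.ιTotal (ComplexShape.up ℤ) i (k - i) k (show (i : ℤ) + (k - i) = k by omega) = 𝟙 _ := by
    refine HomologicalComplex₂.total.hom_ext _ fun p q h => ?_
    have h' : p + q = k := h
    by_cases h0 : p < 0 ∨ q < 0
    · exact (hK p q h0).eq_of_src _ _
    push Not at h0
    obtain ⟨i, rfl⟩ := Int.eq_ofNat_of_zero_le h0.1
    obtain rfl : q = k - i := by omega
    rw [Preadditive.comp_sum, Finset.sum_eq_single i, ← Category.assoc, ιTotal_totalPr,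
      Category.id_comp, Category.comp_id]
    · intro j _ hj
      rw [← Category.assoc, ιTotal_totalPr_of_ne _ _ _ (by omega), zero_comp]
    · intro hi
      rw [Finset.mem_range] at hi
      omega
  conv_lhs => rw [← Category.comp_id y, ← h1]
  rw [Finset.sum_range_succ', Preadditive.comp_add, Preadditive.comp_sum, Finset.sum_eq_zero,
    zero_add]
  · have h2 : ∀ j (h : 0 + j = k), y ≫ totalPr K 0 j k h ≫ K.ιTotal (ComplexShape.up ℤ) 0 j k h =
        y ≫ totalPr K 0 k k (zero_add k) ≫ K.ιTotal (ComplexShape.up ℤ) 0 k k (zero_add k) := by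
      intro j h
      obtain rfl : j = k := by omega
      rfl
    exact h2 (k - (0 : ℕ)) (by simp)
  · intro j _
    rw [← Category.assoc, hy _ _ _ (by omega), zero_comp]

/-- A morphism from a complex `G` to the column `K^{0, •}` of a bicomplex whose composition with the
differential `K^{0, •} ⟶ K^{1, •}` is zero defines a morphism to the total complex. -/
noncomputable def totalAugmentation {G : CochainComplex C ℤ} (e : G ⟶ K.X 0)
    (he : e ≫ K.d 0 1 = 0) : G ⟶ K.total (ComplexShape.up ℤ) where
  f k := e.f k ≫ K.ιTotal (ComplexShape.up ℤ) 0 k k (zero_add k)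
  comm' k k' h := by
    obtain rfl : k + 1 = k' := h
    have h1 : e.f k ≫ (K.d 0 (0 + 1)).f k = 0 := congr(($he).f k)
    rw [Category.assoc, ιTotal_d K 0 k k (zero_add k), Preadditive.comp_add, ← Category.assoc, h1,
      zero_comp, zero_add, Int.negOnePow_zero, one_smul, ← Category.assoc, e.comm, Category.assoc]

end Total

section Total
variable {C : Type*} [Category C] [Abelian C]
  (K : HomologicalComplex₂ C (ComplexShape.up ℤ) (ComplexShape.up ℤ))
  [K.HasTotal (ComplexShape.up ℤ)] (hK : ∀ p q, p < 0 ∨ q < 0 → IsZero ((K.X p).X q))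
  {G : CochainComplex C ℤ} (e : G ⟶ K.X 0) (he : e ≫ K.d 0 1 = 0)
  (he' : ∀ q, (ShortComplex.mk (e.f q) ((K.d 0 1).f q) congr(($he).f q)).Exact)
  (hd : ∀ (p : ℕ) (q : ℤ), (ShortComplex.mk ((K.d p (p + 1)).f q) ((K.d (p + 1) (p + 1 + 1)).f q)
    congr(($(K.d_comp_d p (p + 1) (p + 1 + 1))).f q)).Exact)

include hK he' hd in
/-- If the rows are exact, an element of the total complex whose differential is concentrated in
column `0` can be moved into column `0` by a boundary: one removes its components one by one,
starting from the column of largest index. -/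
theorem exists_eq_boundary_add (P : ℕ) : ∀ {A : C} {k : ℤ}
    (y : A ⟶ (K.total (ComplexShape.up ℤ)).X (k + 1))
    (_ : ∀ p q h, 0 < p → y ≫ (K.total (ComplexShape.up ℤ)).d (k + 1) (k + 1 + 1) ≫
      totalPr K p q (k + 1 + 1) h = 0)
    (_ : ∀ p q h, (P : ℤ) < p → y ≫ totalPr K p q (k + 1) h = 0),
    ∃ (A' : C) (π : A' ⟶ A) (_ : Epi π) (y' : A' ⟶ (K.total (ComplexShape.up ℤ)).X k)
      (z : A' ⟶ G.X (k + 1)), π ≫ y = y' ≫ (K.total (ComplexShape.up ℤ)).d k (k + 1) +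
        z ≫ (totalAugmentation K e he).f (k + 1) := by
  induction P with
  | zero =>
    intro A k y hy hP
    have h1 : (y ≫ totalPr K 0 (k + 1) (k + 1) (zero_add _)) ≫ (K.d 0 1).f (k + 1) = 0 :=
      totalPr_comp_f_eq_zero K _ y (hy _ _ _ (by omega)) fun _ _ => hP _ _ _ (by omega)
    obtain ⟨A', π, hπ, z, hz⟩ := (he' (k + 1)).exact_up_to_refinements _ h1
    refine ⟨A', π, hπ, 0, z, ?_⟩
    have h2 := eq_of_totalPr K hK y fun p q h hp => hP p q h hp
    rw [zero_comp, zero_add]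
    conv_lhs => rw [h2]
    rw [← Category.assoc, ← Category.assoc, Category.assoc π]
    exact (congrArg (· ≫ _) hz).trans (Category.assoc _ _ _)
  | succ P ih =>
    intro A k y hy hP
    have h1 : (y ≫ totalPr K (P + 1) (k - P) (k + 1) (by omega)) ≫
        (K.d (P + 1) (P + 1 + 1)).f (k - P) = 0 :=
      totalPr_comp_f_eq_zero K _ y (hy _ _ _ (by omega)) fun _ _ => hP _ _ _ (by push_cast; omega)
    obtain ⟨A₁, π₁, hπ₁, w, hw⟩ := (hd P (k - P)).exact_up_to_refinements _ h1
    -- The component of `y` in column `P + 1` comes from `w` in column `P`; subtracting the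
    -- boundary of `w` removes it.
    let y₁ : A₁ ⟶ (K.total (ComplexShape.up ℤ)).X (k + 1) :=
      π₁ ≫ y - w ≫ K.ιTotal (ComplexShape.up ℤ) P (k - P) k (show (P : ℤ) + (k - P) = k by omega) ≫
        (K.total (ComplexShape.up ℤ)).d k (k + 1)
    obtain ⟨A₂, π₂, hπ₂, y', z, hz⟩ := ih y₁
      (fun p q h hp => by
        rw [Preadditive.sub_comp, Category.assoc, hy p q h hp, Category.assoc, Category.assoc,
          ← Category.assoc ((K.total (ComplexShape.up ℤ)).d k (k + 1)),
          (K.total (ComplexShape.up ℤ)).d_comp_d k (k + 1) (k + 1 + 1), zero_comp, comp_zero,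
          comp_zero, comp_zero, sub_zero])
      (fun p q h hp => by
        rw [Preadditive.sub_comp, Category.assoc, ιTotal_d, Category.assoc, Preadditive.add_comp,
          Linear.units_smul_comp, Category.assoc, Category.assoc,
          ιTotal_totalPr_of_ne K (p' := P) _ _ (by omega), comp_zero, smul_zero, add_zero]
        by_cases h' : p = P + 1
        · subst h'
          obtain rfl : q = k - P := by omega
          rw [ιTotal_totalPr, Category.comp_id, sub_eq_zero]
          exact hw
        · rw [hP _ _ _ (by push_cast; omega), ιTotal_totalPr_of_ne K _ _ (by omega), comp_zero,
            comp_zero, comp_zero, sub_zero])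
    refine ⟨A₂, π₂ ≫ π₁, epi_comp _ _, y' + π₂ ≫ w ≫ K.ιTotal (ComplexShape.up ℤ) P (k - P) k
      (show (P : ℤ) + (k - P) = k by omega), z, ?_⟩
    rw [Preadditive.comp_sub, sub_eq_iff_eq_add] at hz
    rw [Category.assoc, hz, Preadditive.add_comp]
    simp only [Category.assoc]
    abel

include hK he' hd in
/-- If the augmented rows `0 ⟶ G^q ⟶ K^{0, q} ⟶ K^{1, q} ⟶ …` of a first quadrant bicomplex are
exact, then `G` is quasi-isomorphic to the total complex. -/
theorem quasiIso_totalAugmentation (hm : ∀ q, Mono (e.f q)) :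
    QuasiIso (totalAugmentation K e he) := by
  have hm' : ∀ q, Mono ((totalAugmentation K e he).f q) := fun q => by
    have : (totalAugmentation K e he).f q ≫ totalPr K 0 q q (zero_add q) = e.f q := by
      rw [totalAugmentation, Category.assoc, ιTotal_totalPr, Category.comp_id]
    exact mono_of_mono_fac this
  have key : ∀ {A : C} {k : ℤ} (y : A ⟶ (K.total (ComplexShape.up ℤ)).X (k + 1))
      (_ : ∀ p q h, 0 < p → y ≫ (K.total (ComplexShape.up ℤ)).d (k + 1) (k + 1 + 1) ≫
        totalPr K p q (k + 1 + 1) h = 0),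
      ∃ (A' : C) (π : A' ⟶ A) (_ : Epi π) (y' : A' ⟶ (K.total (ComplexShape.up ℤ)).X k)
        (z : A' ⟶ G.X (k + 1)), π ≫ y = y' ≫ (K.total (ComplexShape.up ℤ)).d k (k + 1) +
          z ≫ (totalAugmentation K e he).f (k + 1) := fun {A k} y hy =>
    exists_eq_boundary_add K hK e he he' hd (k + 1).toNat y hy fun p q h hp =>
      (hK p q (Or.inr (by omega))).eq_of_tgt _ _
  have hz : ∀ {A : C} {k : ℤ} (z : A ⟶ G.X k), z ≫ (totalAugmentation K e he).f k ≫
      (K.total (ComplexShape.up ℤ)).d k (k + 1) = (z ≫ G.d k (k + 1)) ≫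
        (totalAugmentation K e he).f (k + 1) := fun z => by
    rw [HomologicalComplex.Hom.comm, Category.assoc]
  refine ⟨fun j => ?_⟩
  obtain ⟨k, rfl⟩ : ∃ k, j = k + 1 := ⟨j - 1, by omega⟩
  obtain ⟨l, rfl⟩ : ∃ l, k = l + 1 := ⟨k - 1, by omega⟩
  rw [quasiIsoAt_iff_isIso_homologyMap]
  have h1 : (ComplexShape.up ℤ).prev (l + 1 + 1) = l + 1 := (ComplexShape.up ℤ).prev_eq' rfl
  have h2 : (ComplexShape.up ℤ).next (l + 1 + 1) = l + 1 + 1 + 1 := (ComplexShape.up ℤ).next_eq' rfl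
  have : Mono (HomologicalComplex.homologyMap (totalAugmentation K e he) (l + 1 + 1)) := by
    rw [HomologicalComplex.mono_homologyMap_iff_up_to_refinements _ _ _ _ h1 h2]
    intro A x hx y hy
    obtain ⟨A', π, hπ, y', z, h⟩ := key y fun p q h hp => by
      rw [← Category.assoc, ← hy, totalAugmentation, Category.assoc, Category.assoc,
        ιTotal_totalPr_of_ne K _ _ hp.ne, comp_zero, comp_zero]
    refine ⟨A', π, hπ, z, ?_⟩
    have h3 := congrArg (· ≫ (K.total (ComplexShape.up ℤ)).d (l + 1) (l + 1 + 1)) h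
    rw [Preadditive.add_comp, Category.assoc, ← hy, Category.assoc, HomologicalComplex.d_comp_d,
      comp_zero, zero_add, Category.assoc, hz, ← Category.assoc] at h3
    exact (cancel_mono _).1 h3
  have : Epi (HomologicalComplex.homologyMap (totalAugmentation K e he) (l + 1 + 1)) := by
    rw [HomologicalComplex.epi_homologyMap_iff_up_to_refinements _ _ _ _ h1 h2]
    intro A y hy
    obtain ⟨A', π, hπ, y', z, h⟩ := key y fun p q h hp => by
      rw [← Category.assoc, hy, zero_comp]
    refine ⟨A', π, hπ, z, ?_, y', h.trans (add_comm (_ : A' ⟶ _) _)⟩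
    have h3 := congrArg (· ≫ (K.total (ComplexShape.up ℤ)).d (l + 1 + 1) (l + 1 + 1 + 1)) h
    rw [Preadditive.add_comp, Category.assoc, hy, Category.assoc, HomologicalComplex.d_comp_d,
      comp_zero, comp_zero, zero_add, Category.assoc, hz] at h3
    exact (cancel_mono ((totalAugmentation K e he).f (l + 1 + 1 + 1))).1
        (h3.symm.trans zero_comp.symm)
  exact isIso_of_mono_of_epi _

end Total

/-! ### The hypercomplex of a functor with values in complexes -/

section Hyper
variable {A B : Type*} [Category A] [Abelian A] [Category B] [Abelian B]
  (G : A ⥤ CochainComplex B ℤ) [G.Additive]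

/-- The bicomplex with columns `G(I^p)`. -/
noncomputable abbrev hyperBicomplex (I : CochainComplex A ℤ) :
    HomologicalComplex₂ B (ComplexShape.up ℤ) (ComplexShape.up ℤ) :=
  (G.mapHomologicalComplex (ComplexShape.up ℤ)).obj I

section Row
variable {I : CochainComplex A ℤ}
  (hG' : ∀ F r, r < 0 → IsZero ((G.obj F).X r)) (hI : I.IsStrictlyGE 0)

include hG' hI in
theorem isZero_hyperBicomplex (p q : ℤ) (h : p < 0 ∨ q < 0) :
    IsZero (((hyperBicomplex G I).X p).X q) := by
  rcases h with h | h
  · exact (HomologicalComplex.eval _ _ q).map_isZero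
      (G.map_isZero (CochainComplex.isZero_of_isStrictlyGE I 0 p h))
  · exact hG' _ _ h

end Row

section FirstRow
variable {M : A ⥤ B} [M.Additive] (α : M ⟶ G ⋙ HomologicalComplex.eval B (ComplexShape.up ℤ) 0)
  (hα : ∀ F, α.app F ≫ (G.obj F).d 0 1 = 0)

/-- The augmentation of the bicomplex `G(I)` along its first row. -/
noncomputable def rowZeroHom (I : CochainComplex A ℤ) :
    (M.mapHomologicalComplex (ComplexShape.up ℤ)).obj I ⟶ (hyperBicomplex G I).flip.X 0 where
  f q := α.app (I.X q)
  comm' q q' _ := (α.naturality (I.d q q')).symm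

include hα in
theorem rowZeroHom_comp_d (I : CochainComplex A ℤ) :
    rowZeroHom G α I ≫ (hyperBicomplex G I).flip.d 0 1 = 0 :=
  HomologicalComplex.hom_ext _ _ fun q => hα (I.X q)

end FirstRow

variable [HasCoproducts.{0} B]

/-- The extension to complexes of a functor with values in complexes: it sends `I` to the total
complex of the bicomplex with columns `G(I^p)`. -/
noncomputable def totalFunctor : CochainComplex A ℤ ⥤ CochainComplex B ℤ where
  obj I := (hyperBicomplex G I).total (ComplexShape.up ℤ)
  map f := HomologicalComplex₂.total.map ((G.mapHomologicalComplex (ComplexShape.up ℤ)).map f)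
    (ComplexShape.up ℤ)
  map_id I := by
    rw [CategoryTheory.Functor.map_id]
    exact HomologicalComplex₂.total.map_id _ _
  map_comp f g := by
    rw [Functor.map_comp]
    exact HomologicalComplex₂.total.map_comp _ _ _

section Row
variable {F : A} {I : CochainComplex A ℤ} (η : F ⟶ I.X 0) (hη : η ≫ I.d 0 1 = 0)

/-- The morphism from `G(F)` to the hypercomplex of `I` given by an augmentation `F ⟶ I^0`. -/
noncomputable def rowAugmentation : G.obj F ⟶ (totalFunctor G).obj I :=
  totalAugmentation (hyperBicomplex G I) (G.map η) (by
    refine (G.map_comp _ _).symm.trans ?_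
    rw [hη, G.map_zero]
    rfl)

theorem rowAugmentation_naturality {F' : A} {I' : CochainComplex A ℤ} (η' : F' ⟶ I'.X 0)
    (hη' : η' ≫ I'.d 0 1 = 0) (g : F ⟶ F') (φ : I ⟶ I') (h : η ≫ φ.f 0 = g ≫ η') :
    rowAugmentation G η hη ≫ (totalFunctor G).map φ = G.map g ≫ rowAugmentation G η' hη' := by
  refine HomologicalComplex.hom_ext _ _ fun k => ?_
  have h1 : (G.map η).f k ≫ (G.map (φ.f 0)).f k = (G.map g).f k ≫ (G.map η').f k := by
    rw [← HomologicalComplex.comp_f, ← G.map_comp, h, G.map_comp, HomologicalComplex.comp_f]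
  refine (Category.assoc _ _ _).trans ((congrArg (_ ≫ ·)
    (HomologicalComplex₂.ιTotal_map _ _ _ _ 0 k k (zero_add k))).trans ?_)
  exact (Category.assoc _ _ _).symm.trans ((congrArg (· ≫ _) h1).trans (Category.assoc _ _ _))

variable (hG : ∀ (T : ShortComplex A), T.Exact → ∀ r,
    (T.map (G ⋙ HomologicalComplex.eval _ _ r)).Exact)
  (hG' : ∀ F r, r < 0 → IsZero ((G.obj F).X r)) (hI : I.IsStrictlyGE 0) (hm : Mono η)
  (h0 : (ShortComplex.mk η (I.d 0 1) hη).Exact)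
  (h1 : ∀ p : ℕ, (ShortComplex.mk (I.d p (p + 1)) (I.d (p + 1) (p + 1 + 1))
    (I.d_comp_d _ _ _)).Exact)

include hG hG' hI hm h0 h1 in
/-- If `F ⟶ I` is a resolution and the terms of `G` are exact functors, `G(F)` is quasi-isomorphic
to the hypercomplex of `I`. -/
theorem quasiIso_rowAugmentation : QuasiIso (rowAugmentation G η hη) := by
  refine quasiIso_totalAugmentation _ (isZero_hyperBicomplex G hG' hI) _ _
    (fun q => hG _ h0 q) (fun p q => hG _ (h1 p) q) fun q => ?_
  have h2 : (ShortComplex.mk (0 : F ⟶ F) η zero_comp).Exact :=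
    (ShortComplex.exact_iff_mono _ rfl).2 hm
  exact (ShortComplex.exact_iff_mono _ ((G ⋙ HomologicalComplex.eval _ _ q).map_zero _ _)).1
    (hG _ h2 q)

end Row

section Column
variable {M : A ⥤ B} [M.Additive] (α : M ⟶ G ⋙ HomologicalComplex.eval B (ComplexShape.up ℤ) 0)
  (hα : ∀ F, α.app F ≫ (G.obj F).d 0 1 = 0)

/-- The morphism from the complex `M(I)` to the hypercomplex of `I` given by augmentations
`M(F) ⟶ G(F)^0`. -/
noncomputable def columnAugmentation (I : CochainComplex A ℤ) :
    (M.mapHomologicalComplex (ComplexShape.up ℤ)).obj I ⟶ (totalFunctor G).obj I :=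
  totalAugmentation (hyperBicomplex G I).flip (rowZeroHom G α I) (rowZeroHom_comp_d G α hα I) ≫
      ((hyperBicomplex G I).totalFlipIso (ComplexShape.up ℤ)).hom

theorem columnAugmentation_f (I : CochainComplex A ℤ) (q : ℤ) :
    (columnAugmentation G α hα I).f q = α.app (I.X q) ≫
      (hyperBicomplex G I).ιTotal (ComplexShape.up ℤ) q 0 q (add_zero q) := by
  refine (Category.assoc _ _ _).trans (congrArg (α.app (I.X q) ≫ ·) ?_)
  refine (HomologicalComplex₂.ιTotal_totalFlipIso_f_hom
    (hyperBicomplex G I) (ComplexShape.up ℤ) q 0 q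
    (zero_add q)).trans ?_
  -- Exchanging rows and columns introduces the sign `(-1)^{q q'}`, which is trivial in row
  -- `0`.
  have : ComplexShape.σ (ComplexShape.up ℤ) (ComplexShape.up ℤ) (ComplexShape.up ℤ) q 0 = 1 := by
    change (q * 0).negOnePow = 1
    rw [mul_zero, Int.negOnePow_zero]
  rw [this, one_smul]

theorem columnAugmentation_naturality {I I' : CochainComplex A ℤ} (φ : I ⟶ I') :
    columnAugmentation G α hα I ≫ (totalFunctor G).map φ =
      (M.mapHomologicalComplex (ComplexShape.up ℤ)).map φ ≫ columnAugmentation G α hα I' := by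
  refine HomologicalComplex.hom_ext _ _ fun k => ?_
  rw [HomologicalComplex.comp_f, HomologicalComplex.comp_f, columnAugmentation_f,
    columnAugmentation_f]
  refine (Category.assoc _ _ _).trans ((congrArg (α.app (I.X k) ≫ ·)
    (HomologicalComplex₂.ιTotal_map _ _ _ _ k 0 k (add_zero k))).trans ?_)
  exact (Category.assoc _ _ _).symm.trans
    ((congrArg (· ≫ _) (α.naturality (φ.f k)).symm).trans (Category.assoc _ _ _))

variable {I : CochainComplex A ℤ} (hG' : ∀ F r, r < 0 → IsZero ((G.obj F).X r))
  (hI : I.IsStrictlyGE 0) (hm : ∀ q, Mono (α.app (I.X q)))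
  (h0 : ∀ q, (ShortComplex.mk (α.app (I.X q)) ((G.obj (I.X q)).d 0 1) (hα _)).Exact)
  (h1 : ∀ (q : ℤ) (p : ℕ), (ShortComplex.mk ((G.obj (I.X q)).d p (p + 1))
    ((G.obj (I.X q)).d (p + 1) (p + 1 + 1)) ((G.obj (I.X q)).d_comp_d _ _ _)).Exact)

include hG' hI hm h0 h1 in
/-- If `M(I^q) ⟶ G(I^q)` are resolutions, then `M(I)` is quasi-isomorphic to the hypercomplex
of `I`. -/
theorem quasiIso_columnAugmentation : QuasiIso (columnAugmentation G α hα I) := by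
  have := quasiIso_totalAugmentation
    (hyperBicomplex G I).flip
    (fun p q h => isZero_hyperBicomplex G hG' hI q p h.symm)
    (rowZeroHom G α I) (rowZeroHom_comp_d G α hα I) h0 (fun p q => h1 q p) hm
  have := quasiIso_of_isIso ((hyperBicomplex G I).totalFlipIso (ComplexShape.up ℤ)).hom
  exact quasiIso_comp (totalAugmentation (hyperBicomplex G I).flip (rowZeroHom G α I)
    (rowZeroHom_comp_d G α hα I)) ((hyperBicomplex G I).totalFlipIso (ComplexShape.up ℤ)).hom

end Column
end Hyper

section Resolution
variable {A : Type*} [Category A] [Abelian A] {F : A} (R : InjectiveResolution F)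

/-- The augmentation of an injective resolution, as a morphism to the complex indexed by `ℕ`. -/
noncomputable def resolutionUnitNat : F ⟶ R.cocomplex.X 0 :=
  R.ι.f 0

theorem resolutionUnitNat_d : resolutionUnitNat R ≫ R.cocomplex.d 0 1 = 0 :=
  R.ι_f_zero_comp_complex_d

instance : Mono (resolutionUnitNat R) :=
  (inferInstance : Mono (C := A) (R.ι.f 0))

theorem exact_resolutionUnitNat : (ShortComplex.mk (resolutionUnitNat R) (R.cocomplex.d 0 1)
    (resolutionUnitNat_d R)).Exact :=
  R.exact₀

/-- The augmentation of an injective resolution, as a morphism to the complex indexed by `ℤ`. -/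
noncomputable def resolutionUnit : F ⟶ R.cochainComplex.X 0 :=
  resolutionUnitNat R ≫ (R.cochainComplexXIso 0 0 rfl).inv

theorem ι'_f_zero_eq : R.ι'.f 0 =
    (HomologicalComplex.singleObjXSelf (ComplexShape.up ℤ) 0 F).hom ≫ resolutionUnit R :=
  R.ι'_f_zero

theorem resolutionUnit_d : resolutionUnit R ≫ R.cochainComplex.d 0 1 = 0 := by
  rw [resolutionUnit, R.cochainComplex_d 0 1 0 1 rfl rfl, Category.assoc,
    Iso.inv_hom_id_assoc, ← Category.assoc, resolutionUnitNat_d, zero_comp]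

instance : Mono (resolutionUnit R) :=
  mono_comp _ _

theorem exact_resolutionUnit :
    (ShortComplex.mk (resolutionUnit R) (R.cochainComplex.d 0 1) (resolutionUnit_d R)).Exact := by
  let φ : ShortComplex.mk (resolutionUnitNat R) (R.cocomplex.d 0 1) (resolutionUnitNat_d R) ≅
      ShortComplex.mk (resolutionUnit R) (R.cochainComplex.d 0 1) (resolutionUnit_d R) :=
    ShortComplex.isoMk (Iso.refl F) (R.cochainComplexXIso 0 0 rfl).symm
      (R.cochainComplexXIso 1 1 rfl).symm (Category.id_comp _)
      ((congrArg (_ ≫ ·) (R.cochainComplex_d 0 1 0 1 rfl rfl)).trans (Iso.inv_hom_id_assoc _ _))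
  exact (ShortComplex.exact_iff_of_iso φ).1 (exact_resolutionUnitNat R)

theorem exact_cochainComplex_d (p : ℕ) : (ShortComplex.mk (R.cochainComplex.d p (p + 1))
    (R.cochainComplex.d (p + 1) (p + 1 + 1)) (R.cochainComplex.d_comp_d _ _ _)).Exact := by
  refine (ShortComplex.exact_iff_of_iso (ShortComplex.isoMk (R.cochainComplexXIso p p rfl).symm
    (R.cochainComplexXIso (p + 1) (p + 1) rfl).symm
    (R.cochainComplexXIso (p + 1 + 1) (p + 2) rfl).symm ?_ ?_)).1 (R.exact_succ p)
  · exact (congrArg (_ ≫ ·) (R.cochainComplex_d _ _ p (p + 1) rfl rfl)).trans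
      (Iso.inv_hom_id_assoc _ _)
  · exact (congrArg (_ ≫ ·) (R.cochainComplex_d _ _ (p + 1) (p + 2) rfl rfl)).trans
      (Iso.inv_hom_id_assoc _ _)

theorem resolutionUnit_naturality {F' : A} {R' : InjectiveResolution F'} {g : F ⟶ F'}
    (φ : InjectiveResolution.Hom R R' g) :
    resolutionUnit R ≫ φ.hom'.f 0 = g ≫ resolutionUnit R' := by
  have h : resolutionUnitNat R ≫ φ.hom.f 0 = g ≫ resolutionUnitNat R' :=
    φ.ι_f_zero_comp_hom_f_zero.trans
      (congrArg (· ≫ resolutionUnitNat R') (CochainComplex.single₀_map_f_zero g))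
  rw [resolutionUnit, φ.hom'_f 0 0 rfl, Category.assoc, Iso.inv_hom_id_assoc, ← Category.assoc, h,
    Category.assoc, resolutionUnit]

end Resolution

/-! ### Comparison with the right derived functor -/

section Derived
variable {A B : Type*} [Category A] [Abelian A] [Category B] [Abelian B]
  [HasDerivedCategory A] [HasDerivedCategory B] [EnoughInjectives A] (H : A ⥤ B) [H.Additive]

/-- The right derived functor of `H`, as a functor on bounded below complexes. -/
noncomputable def derivedOnComplexes : CochainComplex.Plus A ⥤ DerivedCategory B :=
  HomotopyCategory.Plus.quotient A ⋙ DerivedCategory.Plus.Qh ⋙ H.rightDerivedFunctorPlus ⋙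
    DerivedCategory.Plus.ι

/-- The canonical morphism from the complex `H(K)` to the right derived functor of `H`. -/
noncomputable def toDerived : CochainComplex.Plus.ι A ⋙
    H.mapHomologicalComplex (ComplexShape.up ℤ) ⋙ DerivedCategory.Q ⟶ derivedOnComplexes H where
  app K := (DerivedCategory.quotientCompQhIso _).inv.app _ ≫ DerivedCategory.Plus.ι.map
    (H.rightDerivedFunctorPlusUnit.app ((HomotopyCategory.Plus.quotient A).obj K))
  naturality K L f := by
    have h1 := (DerivedCategory.quotientCompQhIso B).inv.naturality
      ((H.mapHomologicalComplex (ComplexShape.up ℤ)).map f.hom)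
    have h2 := congrArg (DerivedCategory.Plus.ι (C := B)).map
      (H.rightDerivedFunctorPlusUnit.naturality ((HomotopyCategory.Plus.quotient A).map f))
    rw [Functor.map_comp, Functor.map_comp] at h2
    exact (Category.assoc _ _ _).symm.trans ((congrArg (· ≫ _) h1).trans
        ((Category.assoc _ _ _).trans
      ((congrArg (_ ≫ ·) h2).trans (Category.assoc _ _ _).symm)))

/-- Complexes of injective objects compute the right derived functor. -/
instance (K : CochainComplex.Plus A) [∀ n, Injective (K.obj.X n)] :
    IsIso ((toDerived H).app K) := by
  have h : IsIso (H.rightDerivedFunctorPlusUnit.app ((HomotopyCategory.Plus.quotient A).obj K)) :=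
    inferInstance
  have h' := Functor.map_isIso (DerivedCategory.Plus.ι (C := B))
    (H.rightDerivedFunctorPlusUnit.app ((HomotopyCategory.Plus.quotient A).obj K))
  exact ((DerivedCategory.quotientCompQhIso B).symm.app
    ((H.mapHomologicalComplex (ComplexShape.up ℤ)).obj K.obj) ≪≫ @asIso _ _ _ _ _ h').isIso_hom

theorem isIso_derivedOnComplexes_map {K L : CochainComplex.Plus A} (f : K ⟶ L)
    (hf : QuasiIso f.hom) : IsIso ((derivedOnComplexes H).map f) := by
  have h : HomotopyCategory.Plus.quasiIso A ((HomotopyCategory.Plus.quotient A).map f) :=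
    (HomotopyCategory.quotient_map_mem_quasiIso_iff f.hom).2 hf
  have h' := Localization.inverts (DerivedCategory.Plus.Qh (C := A))
    (HomotopyCategory.Plus.quasiIso A) _ h
  exact (inferInstance : IsIso ((H.rightDerivedFunctorPlus ⋙ DerivedCategory.Plus.ι).map
    ((DerivedCategory.Plus.Qh (C := A)).map ((HomotopyCategory.Plus.quotient A).map f))))

/-- An object, as a bounded below complex. -/
noncomputable def singlePlus (F : A) : CochainComplex.Plus A :=
  ⟨(CochainComplex.singleFunctor A 0).obj F, 0, inferInstance⟩

/-- The right derived functor of `H` on objects. -/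
noncomputable def derivedOnObjects : A ⥤ DerivedCategory B :=
  DerivedCategory.Plus.singleFunctor A 0 ⋙ H.rightDerivedFunctorPlus ⋙ DerivedCategory.Plus.ι

/-- A morphism in an additive category is invertible if it is a direct sum decomposition. -/
theorem isIso_biproduct_desc {C : Type*} [Category C] [Preadditive C] [HasFiniteBiproducts C]
    {N : ℕ} {Y Z : C} (a : Fin N → (Y ⟶ Z)) (b : Fin N → (Z ⟶ Y))
    (hab : ∀ i j, a i ≫ b j = if i = j then 𝟙 Y else 0) (hba : ∑ i, b i ≫ a i = 𝟙 Z) :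
    IsIso (biproduct.desc a) := by
  refine ⟨biproduct.lift b, ?_, ?_⟩
  · refine biproduct.hom_ext' _ _ fun i => biproduct.hom_ext _ _ fun j => ?_
    rw [biproduct.ι_desc_assoc, Category.assoc, biproduct.lift_π, hab, Category.comp_id,
      biproduct.ι_π]
    split_ifs <;> rfl
  · rw [biproduct.lift_desc, hba]

theorem copiesι_naturality {C : Type*} [Category C] [Preadditive C] [HasFiniteBiproducts C]
    (N : ℕ) (i : Fin N) {Y Z : C} (g : Y ⟶ Z) :
    copiesι N i Y ≫ (copies N).map g = g ≫ copiesι N i Z :=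
  biproduct.ι_map (fun _ : Fin N => g) i

/-- An injective resolution, as a bounded below complex. -/
noncomputable def resolutionPlus {F : A} (R : InjectiveResolution F) : CochainComplex.Plus A :=
  ⟨R.cochainComplex, 0, inferInstance⟩

/-- The quasi-isomorphism to an injective resolution, as a morphism of bounded below complexes. -/
noncomputable def resolutionHom {F : A} (R : InjectiveResolution F) :
    singlePlus F ⟶ resolutionPlus R :=
  ObjectProperty.homMk R.ι'

instance {F : A} (R : InjectiveResolution F) :
    IsIso ((derivedOnComplexes H).map (resolutionHom R)) :=
  isIso_derivedOnComplexes_map H _ (inferInstanceAs (QuasiIso R.ι'))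

instance {F : A} (R : InjectiveResolution F) (n : ℤ) : Injective ((resolutionPlus R).obj.X n) :=
  inferInstanceAs (Injective (R.cochainComplex.X n))

end Derived

section Adapted
variable {A B : Type*} [Category A] [Abelian A] [Category B] [Abelian B]

/-- The functor `G` with values in complexes in nonnegative degrees has exact terms, and the
augmentation `α` makes `G(J)` a resolution of `M(J)` for all injective objects `J`. -/
structure IsAdaptedAugmentation (G : A ⥤ CochainComplex B ℤ) [G.Additive] {M : A ⥤ B}
    (α : M ⟶ G ⋙ HomologicalComplex.eval B (ComplexShape.up ℤ) 0) : Prop where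
  comp_d : ∀ F, α.app F ≫ (G.obj F).d 0 1 = 0
  exact_map : ∀ (T : ShortComplex A), T.Exact → ∀ r,
      (T.map (G ⋙ HomologicalComplex.eval _ _ r)).Exact
  isZero : ∀ F r, r < 0 → IsZero ((G.obj F).X r)
  mono : ∀ (J : A) [Injective J], Mono (α.app J)
  exact_zero : ∀ (J : A) [Injective J],
    (ShortComplex.mk (α.app J) ((G.obj J).d 0 1) (comp_d J)).Exact
  exact_succ : ∀ (J : A) [Injective J] (p : ℕ), (ShortComplex.mk ((G.obj J).d p (p + 1))
    ((G.obj J).d (p + 1) (p + 1 + 1)) ((G.obj J).d_comp_d _ _ _)).Exact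

variable {G : A ⥤ CochainComplex B ℤ} [G.Additive] {M : A ⥤ B}
  {α : M ⟶ G ⋙ HomologicalComplex.eval B (ComplexShape.up ℤ) 0} (hα : IsAdaptedAugmentation G α)
  {H : A ⥤ B}

include hα in
theorem comp_augmentation_comp_d (s : H ⟶ M) (F : A) (k : ℤ) (hk : (ComplexShape.up ℤ).Rel 0 k) :
    (s.app F ≫ α.app F) ≫ (G.obj F).d 0 k = 0 := by
  obtain rfl : k = 1 := hk.symm
  exact (Category.assoc _ _ _).trans ((congrArg (s.app F ≫ ·) (hα.comp_d F)).trans comp_zero)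

variable [H.Additive]

/-- The morphism from `H(F)`, placed in degree `0`, to `G(F)` given by a natural transformation from
`H` to the functor `M` that augments `G`. -/
noncomputable def augmentationHom (s : H ⟶ M) (F : A) :
    (H.mapHomologicalComplex (ComplexShape.up ℤ)).obj ((CochainComplex.singleFunctor A 0).obj F) ⟶
      G.obj F :=
  (HomologicalComplex.singleMapHomologicalComplex H (ComplexShape.up ℤ) 0).hom.app F ≫
    HomologicalComplex.mkHomFromSingle (s.app F ≫ α.app F) (comp_augmentation_comp_d hα s F)

theorem augmentationHom_f_zero (s : H ⟶ M) (F : A) : (augmentationHom hα s F).f 0 =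
    H.map (HomologicalComplex.singleObjXSelf (ComplexShape.up ℤ) 0 F).hom ≫
      s.app F ≫ α.app F := by
  have h1 := HomologicalComplex.singleMapHomologicalComplex_hom_app_self H (ComplexShape.up ℤ) 0 F
  have h2 := HomologicalComplex.mkHomFromSingle_f (c := ComplexShape.up ℤ) (K := G.obj F)
    (s.app F ≫ α.app F) (comp_augmentation_comp_d hα s F)
  refine (congrArg₂ (· ≫ ·) h1 h2).trans ((Category.assoc _ _ _).trans (congrArg (_ ≫ ·) ?_))
  exact Iso.inv_hom_id_assoc _ _

variable [HasCoproducts.{0} B]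

/-- The augmentation from `G(F)` to the hypercomplex of an injective resolution of `F`. -/
noncomputable def resolutionRow (G : A ⥤ CochainComplex B ℤ) [G.Additive] {F : A}
    (R : InjectiveResolution F) : G.obj F ⟶ (totalFunctor G).obj R.cochainComplex :=
  rowAugmentation G (resolutionUnit R) (resolutionUnit_d R)

include hα in
theorem quasiIso_resolutionRow {F : A} (R : InjectiveResolution F) :
    QuasiIso (resolutionRow G R) :=
  quasiIso_rowAugmentation G _ _ hα.exact_map hα.isZero inferInstance inferInstance
    (exact_resolutionUnit R) (exact_cochainComplex_d R)

theorem resolutionRow_naturality {F F' : A} {R : InjectiveResolution F}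
    {R' : InjectiveResolution F'} {g : F ⟶ F'} (φ : InjectiveResolution.Hom R R' g) :
    resolutionRow G R ≫ (totalFunctor G).map φ.hom' = G.map g ≫ resolutionRow G R' :=
  rowAugmentation_naturality G _ _ _ _ g φ.hom' (resolutionUnit_naturality R φ)

variable [M.Additive]

theorem quasiIso_columnAugmentation_of_injective (I : CochainComplex A ℤ)
    (hI : I.IsStrictlyGE 0) [∀ q, Injective (I.X q)] :
    QuasiIso (columnAugmentation G α hα.comp_d I) :=
  quasiIso_columnAugmentation G α hα.comp_d hα.isZero hI (fun q => hα.mono (I.X q))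
    (fun q => hα.exact_zero (I.X q)) (fun q => hα.exact_succ (I.X q))

/-- The morphism from `H(F)`, placed in degree `0`, to `G(F)` agrees with the morphism of
complexes `H(I) ⟶ M(I)` for an injective resolution `I` of `F`. -/
theorem comp_resolutionRow (s : H ⟶ M) {F : A} (R : InjectiveResolution F)
    (a : (H.mapHomologicalComplex (ComplexShape.up ℤ)).obj
      ((CochainComplex.singleFunctor A 0).obj F) ⟶ G.obj F)
    (ha : a.f 0 = H.map (HomologicalComplex.singleObjXSelf (ComplexShape.up ℤ) 0 F).hom ≫
      s.app F ≫ α.app F) :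
    a ≫ resolutionRow G R = (H.mapHomologicalComplex (ComplexShape.up ℤ)).map R.ι' ≫
      (NatTrans.mapHomologicalComplex s (ComplexShape.up ℤ)).app R.cochainComplex ≫
        columnAugmentation G α hα.comp_d R.cochainComplex := by
  refine HomologicalComplex.hom_ext _ _ fun k => ?_
  by_cases hk : k = 0
  · subst hk
    let e := (HomologicalComplex.singleObjXSelf (ComplexShape.up ℤ) 0 F).hom
    let w := (hyperBicomplex G R.cochainComplex).ιTotal (ComplexShape.up ℤ) 0 0 0 (zero_add 0)
    have h1 : a.f 0 ≫ (G.map (resolutionUnit R)).f 0 =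
        H.map (R.ι'.f 0) ≫ s.app (R.cochainComplex.X 0) ≫ α.app (R.cochainComplex.X 0) := by
      have h2 := s.naturality (resolutionUnit R)
      have h3 : M.map (resolutionUnit R) ≫ α.app (R.cochainComplex.X 0) =
        α.app F ≫ (G.map (resolutionUnit R)).f 0 := α.naturality (resolutionUnit R)
      have h4 : H.map (R.ι'.f 0) = H.map e ≫ H.map (resolutionUnit R) :=
        (congrArg H.map (ι'_f_zero_eq R)).trans (H.map_comp _ _)
      refine (congrArg (· ≫ _) ha).trans ?_
      refine (Category.assoc _ _ _).trans ((congrArg (H.map e ≫ ·) ((Category.assoc _ _ _).trans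
        ((congrArg (s.app F ≫ ·) h3.symm).trans ?_))).trans ((Category.assoc _ _ _).symm.trans
          (congrArg (· ≫ _) h4.symm)))
      exact (Category.assoc _ _ _).symm.trans ((congrArg (· ≫ _) h2.symm).trans
          (Category.assoc _ _ _))
    have h5 : (columnAugmentation G α hα.comp_d R.cochainComplex).f 0 =
      α.app (R.cochainComplex.X 0) ≫ w := columnAugmentation_f G α hα.comp_d R.cochainComplex 0
    have h6 : (a ≫ resolutionRow G R).f 0 = (a.f 0 ≫ (G.map (resolutionUnit R)).f 0) ≫ w :=
      (Category.assoc _ _ _).symm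
    refine h6.trans ((congrArg (· ≫ w) h1).trans ?_)
    refine (Category.assoc _ _ _).trans (congrArg (H.map (R.ι'.f 0) ≫ ·) ?_)
    exact (Category.assoc _ _ _).trans (congrArg (s.app (R.cochainComplex.X 0) ≫ ·) h5.symm)
  · exact (H.map_isZero
      (HomologicalComplex.isZero_single_obj_X (ComplexShape.up ℤ) 0 F k hk)).eq_of_src _ _

end Adapted

section Comparison
variable {A B : Type*} [Category A] [Abelian A] [Category B] [Abelian B]
  [HasDerivedCategory B] [HasCoproducts.{0} B]
  {G : A ⥤ CochainComplex B ℤ} [G.Additive] {H M : A ⥤ B} [H.Additive] [M.Additive]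
  {α : M ⟶ G ⋙ HomologicalComplex.eval B (ComplexShape.up ℤ) 0} (hα : IsAdaptedAugmentation G α)
  {N : ℕ} (s : Fin N → (H ⟶ M))

/-- The morphism from the complex `H(K)` to the hypercomplex of `K` through the `i`-th summand
of `M(K)`, in the derived category. -/
noncomputable def toHyper (K : CochainComplex A ℤ) (i : Fin N) :
    DerivedCategory.Q.obj ((H.mapHomologicalComplex (ComplexShape.up ℤ)).obj K) ⟶
      DerivedCategory.Q.obj ((totalFunctor G).obj K) :=
  DerivedCategory.Q.map ((NatTrans.mapHomologicalComplex (s i) (ComplexShape.up ℤ)).app K ≫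
    columnAugmentation G α hα.comp_d K)

theorem toHyper_naturality {K L : CochainComplex A ℤ} (φ : K ⟶ L) (i : Fin N) :
    toHyper hα s K i ≫ DerivedCategory.Q.map ((totalFunctor G).map φ) =
      DerivedCategory.Q.map ((H.mapHomologicalComplex (ComplexShape.up ℤ)).map φ) ≫
        toHyper hα s L i := by
  refine (DerivedCategory.Q.map_comp _ _).symm.trans (Eq.trans ?_ (DerivedCategory.Q.map_comp _ _))
  refine congrArg DerivedCategory.Q.map ?_
  have h := (NatTrans.mapHomologicalComplex (s i) (ComplexShape.up ℤ)).naturality φ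
  rw [Category.assoc, columnAugmentation_naturality, ← Category.assoc, ← h, Category.assoc]

variable (t : Fin N → (M ⟶ H))
  (hst : ∀ i j, s i ≫ t j = if i = j then 𝟙 H else 0) (hts : ∑ i, t i ≫ s i = 𝟙 M)

include hst hts in
/-- If `M` is the direct sum of `N` copies of `H`, then for a complex `K` of injective objects in
nonnegative degrees the `N` morphisms from `H(K)` to the hypercomplex of `K` form a direct sum
decomposition in the derived category. -/
theorem isIso_desc_toHyper (K : CochainComplex A ℤ) (hK : K.IsStrictlyGE 0)
    [∀ q, Injective (K.X q)] : IsIso (biproduct.desc (toHyper hα s K)) := by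
  let S i := DerivedCategory.Q.map
    ((NatTrans.mapHomologicalComplex (s i) (ComplexShape.up ℤ)).app K)
  let T i := DerivedCategory.Q.map
    ((NatTrans.mapHomologicalComplex (t i) (ComplexShape.up ℤ)).app K)
  have h1 : IsIso (biproduct.desc S) := by
    refine isIso_biproduct_desc S T (fun i j => ?_) ?_
    · refine (DerivedCategory.Q.map_comp _ _).symm.trans ?_
      have : (NatTrans.mapHomologicalComplex (s i) (ComplexShape.up ℤ)).app K ≫
          (NatTrans.mapHomologicalComplex (t j) (ComplexShape.up ℤ)).app K =
          if i = j then 𝟙 _ else 0 := by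
        refine HomologicalComplex.hom_ext _ _ fun k => ?_
        have h := congrArg (fun x => NatTrans.app x (K.X k)) (hst i j)
        refine Eq.trans h ?_
        split_ifs <;> rfl
      rw [this]
      split_ifs
      · exact DerivedCategory.Q.map_id _
      · exact DerivedCategory.Q.map_zero _ _
    · have : ∑ i, (NatTrans.mapHomologicalComplex (t i) (ComplexShape.up ℤ)).app K ≫
          (NatTrans.mapHomologicalComplex (s i) (ComplexShape.up ℤ)).app K = 𝟙 _ := by
        refine HomologicalComplex.hom_ext _ _ fun k => ?_
        have h := congrArg (fun x => NatTrans.app x (K.X k)) hts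
        rw [NatTrans.app_sum] at h
        exact ((HomologicalComplex.eval B (ComplexShape.up ℤ) k).map_sum _ _).trans h
      refine Eq.trans ?_ ((congrArg DerivedCategory.Q.map this).trans (DerivedCategory.Q.map_id _))
      rw [Functor.map_sum]
      exact Finset.sum_congr rfl fun i _ => (DerivedCategory.Q.map_comp _ _).symm
  have := quasiIso_columnAugmentation_of_injective hα K hK
  have h2 : biproduct.desc (toHyper hα s K) =
      biproduct.desc S ≫ DerivedCategory.Q.map (columnAugmentation G α hα.comp_d K) :=
    biproduct.hom_ext' _ _ fun i => by
      rw [biproduct.ι_desc, biproduct.ι_desc_assoc]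
      exact DerivedCategory.Q.map_comp _ _
  rw [h2]
  infer_instance

variable [HasDerivedCategory A] [EnoughInjectives A]

/-- For a bounded below complex `K` of injective objects, the hypercomplex of `K` is isomorphic to
the sum of `N` copies of the right derived functor of `H` at `K`. -/
noncomputable def hyperIso (K : CochainComplex.Plus A) (hK : K.obj.IsStrictlyGE 0)
    [∀ q, Injective (K.obj.X q)] : DerivedCategory.Q.obj ((totalFunctor G).obj K.obj) ≅
      (copies N).obj ((derivedOnComplexes H).obj K) :=
  have := isIso_desc_toHyper hα s t hst hts K.obj hK
  (asIso (biproduct.desc (toHyper hα s K.obj))).symm ≪≫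
    (copies N).mapIso (asIso ((toDerived H).app K))

theorem toHyper_comp_hyperIso_hom (K : CochainComplex.Plus A) (hK : K.obj.IsStrictlyGE 0)
    [∀ q, Injective (K.obj.X q)] (i : Fin N) :
    toHyper hα s K.obj i ≫ (hyperIso hα s t hst hts K hK).hom =
      (toDerived H).app K ≫ copiesι N i _ := by
  have := isIso_desc_toHyper hα s t hst hts K.obj hK
  have h : toHyper hα s K.obj i ≫ inv (biproduct.desc (toHyper hα s K.obj)) =
      copiesι N i _ := by
    exact (IsIso.comp_inv_eq (biproduct.desc (toHyper hα s K.obj))).2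
      (biproduct.ι_desc (toHyper hα s K.obj) i).symm
  refine (Category.assoc _ _ _).symm.trans ((congrArg (· ≫ _) h).trans ?_)
  exact copiesι_naturality N i _

theorem hyperIso_naturality {K L : CochainComplex.Plus A} (hK : K.obj.IsStrictlyGE 0)
    (hL : L.obj.IsStrictlyGE 0) [∀ q, Injective (K.obj.X q)] [∀ q, Injective (L.obj.X q)]
    (φ : K ⟶ L) :
    DerivedCategory.Q.map ((totalFunctor G).map φ.hom) ≫ (hyperIso hα s t hst hts L hL).hom =
      (hyperIso hα s t hst hts K hK).hom ≫ (copies N).map ((derivedOnComplexes H).map φ) := by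
  have := isIso_desc_toHyper hα s t hst hts K.obj hK
  rw [← cancel_epi (biproduct.desc (toHyper hα s K.obj))]
  refine biproduct.hom_ext' _ _ fun i => ?_
  rw [biproduct.ι_desc_assoc, biproduct.ι_desc_assoc, ← Category.assoc, toHyper_naturality,
    Category.assoc, toHyper_comp_hyperIso_hom, ← Category.assoc (toHyper hα s K.obj i),
    toHyper_comp_hyperIso_hom]
  have h1 := (toDerived H).naturality φ
  have h2 : copiesι N i ((derivedOnComplexes H).obj K) ≫
      (copies N).map ((derivedOnComplexes H).map φ) =
      (derivedOnComplexes H).map φ ≫ copiesι N i _ := copiesι_naturality N i _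
  rw [Category.assoc, h2, ← Category.assoc, ← Category.assoc]
  exact congrArg (· ≫ copiesι N i _) h1

/-- The comparison isomorphism between `G(F)` and the sum of `N` copies of the right derived functor
of `H`, for a chosen injective resolution of `F`. -/
noncomputable def comparisonIso {F : A} (R : InjectiveResolution F) :
    DerivedCategory.Q.obj (G.obj F) ≅ (copies N).obj ((derivedOnObjects H).obj F) :=
  have := quasiIso_resolutionRow hα R
  asIso (DerivedCategory.Q.map (resolutionRow G R)) ≪≫
    hyperIso hα s t hst hts (resolutionPlus R)
      (inferInstanceAs (R.cochainComplex.IsStrictlyGE 0)) ≪≫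
      (copies N).mapIso (asIso ((derivedOnComplexes H).map (resolutionHom R))).symm

theorem comparisonIso_hom_comp {F : A} (R : InjectiveResolution F) :
    (comparisonIso hα s t hst hts R).hom ≫
      (copies N).map ((derivedOnComplexes H).map (resolutionHom R)) =
    DerivedCategory.Q.map (resolutionRow G R) ≫ (hyperIso hα s t hst hts (resolutionPlus R)
      (inferInstanceAs (R.cochainComplex.IsStrictlyGE 0))).hom := by
  have h : (copies N).map (inv ((derivedOnComplexes H).map (resolutionHom R))) ≫
      (copies N).map ((derivedOnComplexes H).map (resolutionHom R)) = 𝟙 _ := by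
    rw [← Functor.map_comp, IsIso.inv_hom_id, CategoryTheory.Functor.map_id]
  refine (Category.assoc _ _ _).trans ((congrArg (_ ≫ ·) ((Category.assoc _ _ _).trans
    ((congrArg (_ ≫ ·) h).trans (Category.comp_id _)))))

/-- A morphism `F ⟶ F'` lifts to the injective resolutions. In particular the comparison isomorphism
does not depend on the resolution. -/
theorem comparisonIso_naturality {F F' : A} (R : InjectiveResolution F)
    (R' : InjectiveResolution F') (g : F ⟶ F') :
    DerivedCategory.Q.map (G.map g) ≫ (comparisonIso hα s t hst hts R').hom =
      (comparisonIso hα s t hst hts R).hom ≫ (copies N).map ((derivedOnObjects H).map g) := by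
  let φ : InjectiveResolution.Hom R R' g :=
    { hom := InjectiveResolution.desc g R' R
      ι_f_zero_comp_hom_f_zero :=
        HomologicalComplex.congr_hom (InjectiveResolution.desc_commutes g R' R) 0 }
  let φ' : resolutionPlus R ⟶ resolutionPlus R' := ObjectProperty.homMk φ.hom'
  let g' : singlePlus F ⟶ singlePlus F' :=
    ObjectProperty.homMk ((CochainComplex.singleFunctor A 0).map g)
  have h1 : g' ≫ resolutionHom R' = resolutionHom R ≫ φ' :=
    ObjectProperty.hom_ext _ φ.ι'_comp_hom'.symm
  have h2 : (copies N).map ((derivedOnObjects H).map g) ≫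
      (copies N).map ((derivedOnComplexes H).map (resolutionHom R')) =
      (copies N).map ((derivedOnComplexes H).map (resolutionHom R)) ≫
      (copies N).map ((derivedOnComplexes H).map φ') :=
    ((derivedOnComplexes H ⋙ copies N).map_comp g' (resolutionHom R')).symm.trans
      ((congrArg (derivedOnComplexes H ⋙ copies N).map h1).trans
        ((derivedOnComplexes H ⋙ copies N).map_comp _ _))
  have h3 : DerivedCategory.Q.map (G.map g) ≫ DerivedCategory.Q.map (resolutionRow G R') =
      DerivedCategory.Q.map (resolutionRow G R) ≫ DerivedCategory.Q.map
        ((totalFunctor G).map φ.hom') := by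
    rw [← Functor.map_comp, ← Functor.map_comp, resolutionRow_naturality φ]
  -- The comparison of the derived functors on `F'` and on its resolution is invertible.
  refine (cancel_mono ((copies N).map ((derivedOnComplexes H).map (resolutionHom R')))).1 ?_
  have h4 := comparisonIso_hom_comp hα s t hst hts R
  have h4' := comparisonIso_hom_comp hα s t hst hts R'
  have h5 := hyperIso_naturality hα s t hst hts (K := resolutionPlus R) (L := resolutionPlus R')
    (inferInstanceAs (R.cochainComplex.IsStrictlyGE 0))
    (inferInstanceAs (R'.cochainComplex.IsStrictlyGE 0)) φ'
  refine (Category.assoc _ _ _).trans ((congrArg (_ ≫ ·) h4').trans ?_)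
  refine Eq.trans ?_ ((Category.assoc _ _ _).trans (congrArg (_ ≫ ·) h2)).symm
  refine Eq.trans ?_ ((Category.assoc _ _ _).symm.trans (congrArg (· ≫ _) h4)).symm
  refine (Category.assoc _ _ _).symm.trans ((congrArg (· ≫ _) h3).trans ?_)
  exact (Category.assoc _ _ _).trans ((congrArg (_ ≫ ·) h5).trans (Category.assoc _ _ _).symm)

/-- The comparison isomorphism as a natural isomorphism. -/
noncomputable def comparisonNatIso :
    G ⋙ DerivedCategory.Q ≅ derivedOnObjects H ⋙ copies N :=
  NatIso.ofComponents
    (fun F => comparisonIso hα s t hst hts (InjectiveResolution.of F))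
    fun g => comparisonIso_naturality hα s t hst hts _ _ g

/-- The comparison isomorphism is the canonical morphism to the derived functor on the summands. -/
theorem map_comp_comparisonNatIso (F : A) (i : Fin N)
    (a : (H.mapHomologicalComplex (ComplexShape.up ℤ)).obj
      ((CochainComplex.singleFunctor A 0).obj F) ⟶ G.obj F)
    (ha : a.f 0 = H.map (HomologicalComplex.singleObjXSelf (ComplexShape.up ℤ) 0 F).hom ≫
      (s i).app F ≫ α.app F) :
    DerivedCategory.Q.map a ≫ (comparisonNatIso hα s t hst hts).hom.app F =
      (toDerived H).app (singlePlus F) ≫ copiesι N i ((derivedOnObjects H).obj F) := by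
  let R := InjectiveResolution.of F
  let P := resolutionPlus R
  have hP : P.obj.IsStrictlyGE 0 := inferInstanceAs (R.cochainComplex.IsStrictlyGE 0)
  let D := derivedOnComplexes H
  refine (cancel_mono ((copies N).map (D.map (resolutionHom R)))).1 ?_
  have h1 := comparisonIso_hom_comp hα s t hst hts R
  have h2 : DerivedCategory.Q.map a ≫ DerivedCategory.Q.map (resolutionRow G R) =
      DerivedCategory.Q.map ((H.mapHomologicalComplex (ComplexShape.up ℤ)).map R.ι') ≫
        toHyper hα s P.obj i := by
    rw [← Functor.map_comp, comp_resolutionRow hα (s i) R a ha, Functor.map_comp]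
    rfl
  have h3 := toHyper_comp_hyperIso_hom hα s t hst hts P hP i
  have h4 : DerivedCategory.Q.map ((H.mapHomologicalComplex (ComplexShape.up ℤ)).map R.ι') ≫
      (toDerived H).app P = (toDerived H).app (singlePlus F) ≫ D.map (resolutionHom R) :=
    (toDerived H).naturality (resolutionHom R)
  refine (Category.assoc _ _ _).trans ((congrArg (_ ≫ ·) h1).trans ?_)
  refine (Category.assoc _ _ _).symm.trans ((congrArg (· ≫ _) h2).trans ?_)
  refine (Category.assoc _ _ _).trans ((congrArg (_ ≫ ·) h3).trans ?_)
  refine (Category.assoc _ _ _).symm.trans ((congrArg (· ≫ _) h4).trans ?_)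
  refine (Category.assoc _ _ _).trans (Eq.trans ?_ (Category.assoc _ _ _).symm)
  exact congrArg (_ ≫ ·) (copiesι_naturality N i (D.map (resolutionHom R))).symm

end Comparison

/-! ### The comparison isomorphism of the higher de Rham complex -/

section LeftResolution
variable {C : Type*} [Category C] [Abelian C] {L : CochainComplex C ℤ} {Y : C}
  (π : L ⟶ (CochainComplex.singleFunctor C 0).obj Y) [QuasiIso π]

/-- The morphism in degree `0` from a complex to an object placed in degree `0`. -/
noncomputable def singleAugmentation {L : CochainComplex C ℤ} {Y : C}
    (π : L ⟶ (CochainComplex.singleFunctor C 0).obj Y) : L.X 0 ⟶ Y :=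
  π.f 0 ≫ (HomologicalComplex.singleObjXSelf (ComplexShape.up ℤ) 0 Y).hom

theorem d_comp_singleAugmentation {L : CochainComplex C ℤ} {Y : C}
    (π : L ⟶ (CochainComplex.singleFunctor C 0).obj Y) (r : ℤ) (hr : r ≠ 0) :
    L.d r 0 ≫ singleAugmentation π = 0 := by
  have h1 : L.d r 0 ≫ π.f 0 = 0 := (π.comm r 0).symm.trans
    ((HomologicalComplex.isZero_single_obj_X (ComplexShape.up ℤ) 0 Y r hr).eq_of_tgt _ _ |>
      fun h => (congrArg (· ≫ _) h).trans zero_comp)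
  exact (Category.assoc _ _ _).symm.trans ((congrArg (· ≫ _) h1).trans zero_comp)

include π in
theorem exact_of_quasiIso_single (p : ℕ) :
    (ShortComplex.mk (L.d (-((p : ℤ) + 1 + 1)) (-((p : ℤ) + 1)))
    (L.d (-((p : ℤ) + 1)) (-(p : ℤ))) (L.d_comp_d _ _ _)).Exact := by
  have h : L.ExactAt (-((p : ℤ) + 1)) := (quasiIsoAt_iff_exactAt' π _
    (HomologicalComplex.exactAt_single_obj (ComplexShape.up ℤ) 0 Y _ (by omega))).1 inferInstance
  exact (L.exactAt_iff' _ _ _ ((CochainComplex.prev _ _).trans (by omega))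
    ((CochainComplex.next _ _).trans (by omega))).1 h

variable (hL : IsZero (L.X 1))

include hL in
/-- As `L` vanishes in degree `1`, its homology in degree `0` is the cokernel of `L^{-1} ⟶ L^0`, so
this cokernel is `Y`. -/
theorem exists_iso_opcycles_singleAugmentation :
    ∃ θ : L.opcycles 0 ≅ Y, L.pOpcycles 0 ≫ θ.hom = singleAugmentation π := by
  let Z := (CochainComplex.singleFunctor C 0).obj Y
  have h1 := L.isIso_homologyι 0 1 (CochainComplex.next _ _) (hL.eq_of_tgt _ _)
  have h2 := Z.isIso_homologyι 0 1 (CochainComplex.next _ _)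
    ((HomologicalComplex.isZero_single_obj_X (ComplexShape.up ℤ) 0 Y 1 (by omega)).eq_of_tgt _ _)
  have h3 := Z.isIso_pOpcycles (-1) 0 (CochainComplex.prev _ _)
    ((HomologicalComplex.isZero_single_obj_X (ComplexShape.up ℤ) 0 Y (-1) (by omega)).eq_of_src _ _)
  have h4 : IsIso (HomologicalComplex.opcyclesMap π 0) := by
    have h5 : IsIso (L.homologyι 0 ≫ HomologicalComplex.opcyclesMap π 0) := by
      rw [← HomologicalComplex.homologyι_naturality]
      infer_instance
    exact IsIso.of_isIso_comp_left (L.homologyι 0) _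
  refine ⟨asIso (HomologicalComplex.opcyclesMap π 0) ≪≫ (asIso (Z.pOpcycles 0)).symm ≪≫
    HomologicalComplex.singleObjXSelf (ComplexShape.up ℤ) 0 Y, ?_⟩
  have h6 : L.pOpcycles 0 ≫ HomologicalComplex.opcyclesMap π 0 ≫ inv (Z.pOpcycles 0) = π.f 0 := by
    rw [← Category.assoc, HomologicalComplex.p_opcyclesMap, Category.assoc, IsIso.hom_inv_id,
      Category.comp_id]
  refine Eq.trans ?_ (congrArg (· ≫ (HomologicalComplex.singleObjXSelf _ 0 Y).hom) h6)
  exact ((Category.assoc _ _ _).trans (congrArg (_ ≫ ·) (Category.assoc _ _ _))).symm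

include hL in
theorem epi_singleAugmentation : Epi (singleAugmentation π) := by
  obtain ⟨θ, hθ⟩ := exists_iso_opcycles_singleAugmentation π hL
  rw [← hθ]
  infer_instance

include hL in
theorem exact_singleAugmentation : (ShortComplex.mk (L.d (-1) 0) (singleAugmentation π)
    (d_comp_singleAugmentation π (-1) (by omega))).Exact := by
  obtain ⟨θ, hθ⟩ := exists_iso_opcycles_singleAugmentation π hL
  have h : (ShortComplex.mk (L.d (-1) 0) (L.pOpcycles 0) (L.d_pOpcycles _ _)).Exact :=
    ShortComplex.exact_of_g_is_cokernel _ (L.opcyclesIsCokernel (-1) 0 (CochainComplex.prev _ _))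
  let φ : ShortComplex.mk (L.d (-1) 0) (L.pOpcycles 0) (L.d_pOpcycles _ _) ≅
      ShortComplex.mk (L.d (-1) 0) (singleAugmentation π)
        (d_comp_singleAugmentation π (-1) (by omega)) :=
    ShortComplex.isoMk (Iso.refl _) (Iso.refl _) θ
      ((Category.id_comp _).trans (Category.comp_id _).symm) ((Category.id_comp _).trans hθ.symm)
  exact (ShortComplex.exact_iff_of_iso φ).1 h

end LeftResolution

section HomOut
variable {X : Type u} [TopologicalSpace X] {D K : Sheaf (Opens.grothendieckTopology X) RingCat.{u}}
  {c : K ⟶ D} (hc : IsCentral c)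

/-- The natural transformation `Hom_D(M', -) ⟶ Hom_D(M, -)` given by `M ⟶ M'`. -/
noncomputable def sheafHomPrecomp {M M' : SheafOfModules.{u} D} (g : M ⟶ M') :
    sheafHomFunctor hc M' ⟶ sheafHomFunctor hc M where
  app F := sheafHomMap hc g (𝟙 F)
  naturality _ _ _ := rfl

theorem sheafHomPrecomp_comp {M M' M'' : SheafOfModules.{u} D} (g : M ⟶ M') (g' : M' ⟶ M'') :
    sheafHomPrecomp hc (g ≫ g') = sheafHomPrecomp hc g' ≫ sheafHomPrecomp hc g :=
  rfl

theorem sheafHomPrecomp_id (M : SheafOfModules.{u} D) : sheafHomPrecomp hc (𝟙 M) = 𝟙 _ :=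
  rfl

theorem sheafHomPrecomp_zero {M M' : SheafOfModules.{u} D} :
    sheafHomPrecomp hc (0 : M ⟶ M') = 0 :=
  NatTrans.ext (funext fun _ => sheafHomMap_zero hc)

theorem sheafHomPrecomp_sum {J : Type*} (J' : Finset J) {M M' : SheafOfModules.{u} D}
    (g : J → (M ⟶ M')) :
    sheafHomPrecomp hc (∑ j ∈ J', g j) = ∑ j ∈ J', sheafHomPrecomp hc (g j) := by
  refine NatTrans.ext (funext fun F => ?_)
  rw [NatTrans.app_sum]
  refine Eq.trans ?_ ((sheafHomInto hc F).map_sum (fun j => (g j).op) J')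
  rw [← op_sum]
  rfl

variable {L : CochainComplex (SheafOfModules.{u} D) ℤ} {Y : SheafOfModules.{u} D}
  (π : L ⟶ (CochainComplex.singleFunctor _ 0).obj Y)

/-- The augmentation `Hom_D(Y, -) ⟶ Hom_D(L, -)` given by an augmentation `L ⟶ Y`. -/
noncomputable def homAugmentation : sheafHomFunctor hc Y ⟶
    homComplexFunctor hc L ⋙ HomologicalComplex.eval _ (ComplexShape.up ℤ) 0 where
  app F := sheafHomMap hc (singleAugmentation π) (𝟙 F)
  naturality _ _ _ := rfl

variable [QuasiIso π] (hL : IsZero (L.X 1))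
  (hL' : ∀ F r, r < 0 → IsZero (((homComplexFunctor hc L).obj F).X r))
  (hL'' : ∀ T : ShortComplex (SheafOfModules.{u} D), T.Exact → ∀ r,
    (T.map (homComplexFunctor hc L ⋙ HomologicalComplex.eval _ _ r)).Exact)

include hL hL' hL'' in
/-- If `L` is a resolution of `Y` and the functors `Hom_D(L^r, -)` are exact, then `Hom_D(L, -)` is
adapted to `Hom_D(Y, -)`: for an injective module `J` the functor `Hom_D(-, J)` is exact, so
`Hom_D(L, J)` is a resolution of `Hom_D(Y, J)`. -/
theorem isAdaptedAugmentation_homAugmentation :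
    IsAdaptedAugmentation (A := SheafOfModules.{u} D) (B := SheafOfModules.{u} K)
      (homComplexFunctor hc L) (homAugmentation hc π) where
  comp_d F := sheafHomMap_comp_zero hc F _ _ (d_comp_singleAugmentation π (-1) (by omega))
  exact_map := hL''
  isZero := hL'
  mono J _ :=
    have := epi_singleAugmentation π hL
    mono_sheafHomMap_of_epi hc (singleAugmentation π) J
  exact_zero J _ := sheafHom_exact_of_injective hc (exact_singleAugmentation π hL) J
  exact_succ J _ p := sheafHom_exact_of_injective hc (exact_of_quasiIso_single π p) J

end HomOut

section Main
variable (p m : ℕ) {n : ℕ} {X S : Scheme.{u}} {f : X ⟶ S} {t : Fin n → Γ(X, ⊤)}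
  (ht : IsCoordinates f t)

theorem isZero_biproduct_subsets {C : Type*} [Category C] [Preadditive C] [HasFiniteBiproducts C]
    (n : ℕ) (r : ℤ) (hr : r < 0) (M : C) : IsZero (⨁ fun _ : Subsets n r => M) := by
  refine (IsZero.iff_id_eq_zero _).2 (biproduct.hom_ext' _ _ fun s => ?_)
  have h := s.2
  omega

theorem isZero_spencer_X_one : IsZero ((spencer p m ht).X 1) :=
  isZero_biproduct_subsets n _ (by omega) _

theorem isZero_homComplex_spencer_X (F : SheafOfModules.{u} (diffSheaf p m ht)) (r : ℤ)
    (hr : r < 0) : IsZero (((homComplexFunctor (isCentral_constToDiff p m ht)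
      (spencer p m ht)).obj F).X r) :=
  (isZero_biproduct_subsets n r hr _).of_iso
    ((HomologicalComplex.eval _ _ r).mapIso ((homSpencerIso p m ht).app F))

end Main

section Main
variable (p m : ℕ) [Fact p.Prime] {n : ℕ} {X S : Scheme.{u}} {f : X ⟶ S} {t : Fin n → Γ(X, ⊤)}
  (ht : IsCoordinates f t)

/-- The inclusions and projections of the summands of `Hom_D(O_X^{⊕ N}, -)`. -/
theorem sheafHomPrecomp_copiesπ_comp_copiesι {X : Type u} [TopologicalSpace X]
    {D K : Sheaf (Opens.grothendieckTopology X) RingCat.{u}} {c : K ⟶ D} (hc : IsCentral c) (N : ℕ)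
    (M : SheafOfModules.{u} D) (i j : Fin N) :
    sheafHomPrecomp hc (copiesπ N i M) ≫ sheafHomPrecomp hc (copiesι N j M) =
      if i = j then 𝟙 (sheafHomFunctor hc M) else 0 := by
  rw [← sheafHomPrecomp_comp]
  have h : copiesι N j M ≫ copiesπ N i M = if i = j then 𝟙 M else 0 := by
    refine (biproduct.ι_π (fun _ : Fin N => M) j i).trans ?_
    by_cases hij : i = j
    · subst hij
      rw [dif_pos rfl, if_pos rfl]
      rfl
    · rw [dif_neg (Ne.symm hij), if_neg hij]
  rw [h]
  split_ifs
  · exact sheafHomPrecomp_id hc M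
  · exact sheafHomPrecomp_zero hc

theorem sum_sheafHomPrecomp_copiesι_comp_copiesπ {X : Type u} [TopologicalSpace X]
    {D K : Sheaf (Opens.grothendieckTopology X) RingCat.{u}} {c : K ⟶ D} (hc : IsCentral c) (N : ℕ)
    (M : SheafOfModules.{u} D) :
    ∑ i, sheafHomPrecomp hc (copiesι N i M) ≫ sheafHomPrecomp hc (copiesπ N i M) =
      𝟙 (sheafHomFunctor hc ((copies N).obj M)) := by
  have h : ∑ i, copiesπ N i M ≫ copiesι N i M = 𝟙 _ := biproduct.total
  rw [← sheafHomPrecomp_id, ← h, sheafHomPrecomp_sum]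
  rfl

theorem isAdaptedAugmentation_spencerAugmentation
    (hU : ∀ U : X.Opens, IsNilpotent (p : Γ(X, U))) :
    IsAdaptedAugmentation (A := SheafOfModules.{u} (diffSheaf p m ht))
      (B := SheafOfModules.{u} (constSheaf f))
      (homComplexFunctor (isCentral_constToDiff p m ht) (spencer p m ht))
      (homAugmentation (isCentral_constToDiff p m ht) (spencerAugmentation p m ht)) :=
  have := quasiIso_spencerAugmentation p m ht hU
  isAdaptedAugmentation_homAugmentation _ _ (isZero_spencer_X_one p m ht)
    (isZero_homComplex_spencer_X p m ht) fun _ hT r => homComplex_spencer_exact p m ht hT r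

variable [Smooth f] (hU : ∀ U : X.Opens, IsNilpotent (p : Γ(X, U)))
  [HasDerivedCategory.{w₁} (SheafOfModules.{u} (diffSheaf p m ht))]
  [HasDerivedCategory.{w₂} (SheafOfModules.{u} (constSheaf f))]

instance {X : Type u} [TopologicalSpace X] (K : Sheaf (Opens.grothendieckTopology X) RingCat.{u}) :
    HasCoproducts.{0} (SheafOfModules.{u} K) :=
  hasCoproducts_shrink.{0, u}

/-- The complex `Hom_D(Sp, F)` computes `p^{mn}` copies of the derived functor `RHom_D(O_X, F)`. -/
noncomputable def homSpencerDerivedIso :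
    homComplexFunctor (isCentral_constToDiff p m ht) (spencer p m ht) ⋙ DerivedCategory.Q ≅
      rhom p m ht (structModule p m ht) ⋙ copies (p ^ (m * n)) :=
  comparisonNatIso (isAdaptedAugmentation_spencerAugmentation p m ht hU)
    (fun i => sheafHomPrecomp (isCentral_constToDiff p m ht) (copiesπ _ i _))
    (fun i => sheafHomPrecomp (isCentral_constToDiff p m ht) (copiesι _ i _))
    (sheafHomPrecomp_copiesπ_comp_copiesι _ _ _) (sum_sheafHomPrecomp_copiesι_comp_copiesπ _ _ _)

end Main

end HigherDeRham

open HigherDeRham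

theorem mainTheorem8 (p m n : ℕ) [Fact p.Prime] {X S : Scheme.{u}} (f : X ⟶ S) [Smooth f]
    (hp : IsNilpotent (p : Γ(S, ⊤))) (t : Fin n → Γ(X, ⊤)) (ht : IsCoordinates f t)
    [HasDerivedCategory.{w₁} (SheafOfModules.{u} (diffSheaf p m ht))]
    [HasDerivedCategory.{w₂} (SheafOfModules.{u} (constSheaf f))] :
    ∃ (π : spencer p m ht ⟶ (CochainComplex.singleFunctor _ 0).obj
        ((copies (p ^ (m * n))).obj (structModule p m ht)))
      (e : higherDeRham p m ht ≅
        homComplexFunctor (isCentral_constToDiff p m ht) (spencer p m ht))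
      (Φ : higherDeRham p m ht ⋙ DerivedCategory.Q ≅
        rhom p m ht (structModule p m ht) ⋙ copies (p ^ (m * n))),
      QuasiIso π ∧
      ∀ (F : SheafOfModules.{u} (diffSheaf p m ht)) (i : Fin (p ^ (m * n))),
        ∃ a : ((sheafHomFunctor (isCentral_constToDiff p m ht)
            (structModule p m ht)).mapHomologicalComplex (ComplexShape.up ℤ)).obj
              ((CochainComplex.singleFunctor _ 0).obj F) ⟶
            (homComplexFunctor (isCentral_constToDiff p m ht) (spencer p m ht)).obj F,
          a.f 0 = sheafHomMap (isCentral_constToDiff p m ht)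
            (π.f 0 ≫ (HomologicalComplex.singleObjXSelf (ComplexShape.up ℤ) 0 _).hom ≫ copiesπ _ i _)
            (HomologicalComplex.singleObjXSelf (ComplexShape.up ℤ) 0 F).hom ∧
          DerivedCategory.Q.map (a ≫ e.inv.app F) ≫ Φ.hom.app F =
            homToRHom p m ht (structModule p m ht) F ≫ copiesι _ i _ := by
  have hU : ∀ U : X.Opens, IsNilpotent (p : Γ(X, U)) := isNilpotent_sections f hp
  have hα := isAdaptedAugmentation_spencerAugmentation p m ht hU
  let e := homSpencerIso p m ht
  let a F i := augmentationHom hα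
    (sheafHomPrecomp (isCentral_constToDiff p m ht) (copiesπ (p ^ (m * n)) i _)) F
  refine ⟨spencerAugmentation p m ht, e.symm, Functor.isoWhiskerRight e.symm DerivedCategory.Q ≪≫
    homSpencerDerivedIso p m ht hU, quasiIso_spencerAugmentation p m ht hU, fun F i =>
      ⟨a F i, augmentationHom_f_zero _ _ _, ?_⟩⟩
  refine Eq.trans ?_ (map_comp_comparisonNatIso hα _ _
    (sheafHomPrecomp_copiesπ_comp_copiesι _ _ _) (sum_sheafHomPrecomp_copiesι_comp_copiesπ _ _ _)
    F i (a F i) (augmentationHom_f_zero _ _ _))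
  have h : DerivedCategory.Q.map (a F i ≫ e.hom.app F) ≫
      DerivedCategory.Q.map (e.inv.app F) = DerivedCategory.Q.map (a F i) := by
    rw [← Functor.map_comp, Category.assoc, Iso.hom_inv_id_app, Category.comp_id]
  exact (Category.assoc _ _ _).symm.trans (congrArg (· ≫ _) h)
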